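/- Let \[ f(x) = x^9 - x^8 + x^6 - x^4 + x^3 + x^2 - 2x + 1, \qquad g(x) = 3(x^2+1)(x^4+1)(x^6+x^3+1), \] polynomials with integer coefficients, of degrees $9$ and $12$ respectively. For every prime $p$, identify the ternary cubic forms \[ C(X,Y,Z) = a_0X^3+a_1X^2Y+a_2X^2Z+a_3XY^2+a_4XYZ+a_5XZ^2+a_6Y^3+a_7Y^2Z+a_8YZ^2+a_9Z^3 \] with coefficients in $\mathbb{Z}_p$ with $\mathbb{Z}_p^{10}$ by means of their coefficient vectors $(a_0,\dots,a_9)$, and equip $\mathbb{Z}_p^{10}$ with the product of the additive Haar probability measures on $\mathbb{Z}_p$. Let $\rho(p)$ be the probability that $C$ has a nontrivial zero over $\mathbb{Q}_p$, i.e. the measure of the (measurable) set of those $C$ for which there is $(x,y,z)\in\mathbb{Q}_p^3\setminus\{0\}$ with $C(x,y,z)=0$. Then, for every prime $p$, \[ \rho(p) = 1 - \frac{f(p)}{g(p)}. \] -/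

import Mathlib

open MeasureTheory

namespace TernaryCubic

/-- The ternary cubic form
`aX³ + bX²Y + cX²Z + dXY² + eXYZ + fXZ² + gY³ + hY²Z + iYZ² + jZ³`
with coefficient vector `c = (a, b, c, d, e, f, g, h, i, j)`. -/
noncomputable def form {R : Type*} [CommRing R] (c : Fin 10 → R) : MvPolynomial (Fin 3) R :=
  let X : MvPolynomial (Fin 3) R := MvPolynomial.X 0
  let Y : MvPolynomial (Fin 3) R := MvPolynomial.X 1
  let Z : MvPolynomial (Fin 3) R := MvPolynomial.X 2
  MvPolynomial.C (c 0) * X ^ 3 + MvPolynomial.C (c 1) * X ^ 2 * Y +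
    MvPolynomial.C (c 2) * X ^ 2 * Z + MvPolynomial.C (c 3) * X * Y ^ 2 +
    MvPolynomial.C (c 4) * X * Y * Z + MvPolynomial.C (c 5) * X * Z ^ 2 +
    MvPolynomial.C (c 6) * Y ^ 3 + MvPolynomial.C (c 7) * Y ^ 2 * Z +
    MvPolynomial.C (c 8) * Y * Z ^ 2 + MvPolynomial.C (c 9) * Z ^ 3

section Local

variable (p : ℕ) [Fact p.Prime]

/-- `ℤ_p` carries its Borel σ-algebra. -/
noncomputable instance instMeasurableSpacePadicInt : MeasurableSpace ℤ_[p] := borel ℤ_[p]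

instance instBorelSpacePadicInt : BorelSpace ℤ_[p] := ⟨rfl⟩

/-- The additive Haar measure on `ℤ_p`, normalised so that `ℤ_p` has measure `1`. -/
noncomputable def padicHaar : Measure ℤ_[p] := Measure.addHaarMeasure ⊤

instance instIsProbabilityMeasurePadicHaar : IsProbabilityMeasure (padicHaar p) :=
  ⟨Measure.addHaarMeasure_self⟩

/-- The probability measure on ternary cubic forms over `ℤ_p`: the ten coefficients are
independent and Haar distributed. -/
noncomputable def coeffMeasure : Measure (Fin 10 → ℤ_[p]) := Measure.pi fun _ => padicHaar p

/-- The set of coefficient vectors of the ternary cubic forms over `ℤ_p` which are soluble over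
`ℚ_p`, that is, have a nontrivial zero over `ℚ_p`. -/
def solubleSet : Set (Fin 10 → ℤ_[p]) :=
  {c | ∃ x : Fin 3 → ℚ_[p], x ≠ 0 ∧ MvPolynomial.aeval x (form c) = 0}

/-- `ρ(p)`, the probability that a random ternary cubic form over `ℤ_p` is soluble over `ℚ_p`. -/
noncomputable def rho : ℝ := (coeffMeasure p).real (solubleSet p)

end Local

open Polynomial in
/-- The numerator `f` of the probability of insolubility. -/
noncomputable def f : ℤ[X] := X ^ 9 - X ^ 8 + X ^ 6 - X ^ 4 + X ^ 3 + X ^ 2 - 2 * X + 1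

open Polynomial in
/-- The denominator `g` of the probability of insolubility. -/
noncomputable def g : ℤ[X] := 3 * (X ^ 2 + 1) * (X ^ 4 + 1) * (X ^ 6 + X ^ 3 + 1)

end TernaryCubic

/-!
Call a form insoluble if it has no nontrivial zero over `ℚ_p`. By Hensel's lemma
(`soluble_of_smooth`) the residue modulo `p` of an insoluble cubic form has no smooth zero. By
`classification` such a residue is anisotropic, or a triple of conjugate lines through a rational
point, or a triple line, or zero.

Forms with anisotropic residue are insoluble, and they have to be counted. Over a finite field `K`
with `q` elements, every anisotropic ternary cubic form `F` is a product of three conjugate linear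
forms (`Anisotropic.exists_eq_prodLinear`); the proof avoids the Hasse-Weil bound. Anisotropy is
preserved by quadratic extensions, so that `q` can be taken large. At most four points impose
independent conditions on cubics, hence the number of zeros of a random cubic has the first four
moments of a sum of independent variables, and Chebyshev's inequality for the fourth moment shows
that at most about `3 q ^ 8` of the `q ^ 10` forms are anisotropic (`card_anisotropic_mul_le`). As
`GL₃` has about `q ^ 9` elements, the group `H` of substitutions preserving `F` is large. The
stabilizer of a line in `H` has at most `27` elements, because it permutes the three conjugate
zeros of `F` on that line, so that `H` would be too small if it were a `3`-group: the number
`q ^ 2 + q + 1` of lines not being divisible by `9`, some orbit would have at most three lines. Thus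
`H` contains an element of prime order different from `3` (`Anisotropic.not_isPGroup`). It fixes
no line, hence has three conjugate eigenvectors, and in coordinates given by them the only
monomial that it can preserve is `X Y Z`. Consequently anisotropic forms are norm forms,
determined by their restriction to a line and by the tangent at a conjugate zero there
(`Anisotropic.exists_eq_normForm`), which leads to `natCard_anisotropic`.

For the other residues, let `insolMass e K` be the measure of those coefficient vectors `c` with
residue in `K` for which the form with coefficients `p ^ e i * c i` is insoluble. Multiplying
variables by powers of `p` and dividing by powers of `p` changes the exponents `e`
(`insolMass_congr`), and coefficients divisible by `p` can be reparametrised (`insolMass_scale`).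
This yields finitely many linear relations between such masses, the decisive ones being
`lineMass_one`, `lineMass_two`, `insolMass_isTripleLine_eq` and `insolMass_concurrent_eq`, and the
linear system is solved in `solve_system`.
-/

namespace TernaryCubic

/-! ### Cubic forms, derivatives and substitutions -/

section Forms

variable {R S : Type*} [CommRing R] [CommRing S]

/-- The value at `x` of the ternary cubic form with coefficient vector `c`. -/
def evalAt (c : Fin 10 → R) (x : Fin 3 → R) : R :=
  c 0 * x 0 ^ 3 + c 1 * x 0 ^ 2 * x 1 + c 2 * x 0 ^ 2 * x 2 + c 3 * x 0 * x 1 ^ 2 +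
    c 4 * x 0 * x 1 * x 2 + c 5 * x 0 * x 2 ^ 2 + c 6 * x 1 ^ 3 + c 7 * x 1 ^ 2 * x 2 +
    c 8 * x 1 * x 2 ^ 2 + c 9 * x 2 ^ 3

/-- The derivative at `u`, in the direction `v`, of the cubic form with coefficient vector `c`:
the coefficient of `s² t` in its value at `s u + t v`. -/
def dirDeriv (c : Fin 10 → R) (u v : Fin 3 → R) : R :=
  (3 * c 0 * u 0 ^ 2 + 2 * c 1 * u 0 * u 1 + 2 * c 2 * u 0 * u 2 + c 3 * u 1 ^ 2 +
      c 4 * u 1 * u 2 + c 5 * u 2 ^ 2) * v 0 +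
    (c 1 * u 0 ^ 2 + 2 * c 3 * u 0 * u 1 + c 4 * u 0 * u 2 + 3 * c 6 * u 1 ^ 2 +
      2 * c 7 * u 1 * u 2 + c 8 * u 2 ^ 2) * v 1 +
    (c 2 * u 0 ^ 2 + c 4 * u 0 * u 1 + 2 * c 5 * u 0 * u 2 + c 7 * u 1 ^ 2 +
      2 * c 8 * u 1 * u 2 + 3 * c 9 * u 2 ^ 2) * v 2

/-- The full polarization of the cubic form with coefficient vector `c`: the coefficient of
`r s t` in its value at `r u + s v + t w`. -/
def polar (c : Fin 10 → R) (u v w : Fin 3 → R) : R :=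
  6 * c 0 * u 0 * v 0 * w 0 +
    2 * c 1 * (u 0 * v 0 * w 1 + u 0 * v 1 * w 0 + u 1 * v 0 * w 0) +
    2 * c 2 * (u 0 * v 0 * w 2 + u 0 * v 2 * w 0 + u 2 * v 0 * w 0) +
    2 * c 3 * (u 0 * v 1 * w 1 + u 1 * v 0 * w 1 + u 1 * v 1 * w 0) +
    c 4 * (u 0 * v 1 * w 2 + u 0 * v 2 * w 1 + u 1 * v 0 * w 2 + u 1 * v 2 * w 0 +
      u 2 * v 0 * w 1 + u 2 * v 1 * w 0) +
    2 * c 5 * (u 0 * v 2 * w 2 + u 2 * v 0 * w 2 + u 2 * v 2 * w 0) +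
    6 * c 6 * u 1 * v 1 * w 1 +
    2 * c 7 * (u 1 * v 1 * w 2 + u 1 * v 2 * w 1 + u 2 * v 1 * w 1) +
    2 * c 8 * (u 1 * v 2 * w 2 + u 2 * v 1 * w 2 + u 2 * v 2 * w 1) +
    6 * c 9 * u 2 * v 2 * w 2

/-- The coefficient vector of the cubic form `x ↦ F (g x)`, where `F` has coefficient
vector `c`. -/
def subst (g : Matrix (Fin 3) (Fin 3) R) (c : Fin 10 → R) : Fin 10 → R :=
  let u := g.col 0
  let v := g.col 1
  let w := g.col 2
  ![evalAt c u, dirDeriv c u v, dirDeriv c u w, dirDeriv c v u, polar c u v w, dirDeriv c w u,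
    evalAt c v, dirDeriv c v w, dirDeriv c w v, evalAt c w]

theorem evalAt_add_smul (c : Fin 10 → R) (u v : Fin 3 → R) (s t : R) :
    evalAt c (s • u + t • v) = s ^ 3 * evalAt c u + s ^ 2 * t * dirDeriv c u v +
      s * t ^ 2 * dirDeriv c v u + t ^ 3 * evalAt c v := by
  simp only [evalAt, dirDeriv, Pi.add_apply, Pi.smul_apply, smul_eq_mul]
  ring

theorem evalAt_smul (c : Fin 10 → R) (s : R) (u : Fin 3 → R) :
    evalAt c (s • u) = s ^ 3 * evalAt c u := by
  simp only [evalAt, Pi.smul_apply, smul_eq_mul]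
  ring

theorem evalAt_smul_left (c : Fin 10 → R) (s : R) (u : Fin 3 → R) :
    evalAt (s • c) u = s * evalAt c u := by
  simp only [evalAt, Pi.smul_apply, smul_eq_mul]
  ring

theorem evalAt_add_left (c d : Fin 10 → R) (u : Fin 3 → R) :
    evalAt (c + d) u = evalAt c u + evalAt d u := by
  simp only [evalAt, Pi.add_apply]
  ring

theorem evalAt_subst (g : Matrix (Fin 3) (Fin 3) R) (c : Fin 10 → R) (x : Fin 3 → R) :
    evalAt (subst g c) x = evalAt c (g.mulVec x) := by
  have h : g.mulVec x = x 0 • g.col 0 + x 1 • g.col 1 + x 2 • g.col 2 := by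
    ext i
    simp [Matrix.mulVec, dotProduct, Fin.sum_univ_three, mul_comm]
  rw [h]
  simp only [subst]
  generalize g.col 0 = u
  generalize g.col 1 = v
  generalize g.col 2 = w
  simp only [evalAt, Matrix.cons_val, dirDeriv, polar, Pi.add_apply, Pi.smul_apply, smul_eq_mul]
  ring

theorem dirDeriv_subst (g : Matrix (Fin 3) (Fin 3) R) (c : Fin 10 → R) (x y : Fin 3 → R) :
    dirDeriv (subst g c) x y = dirDeriv c (g.mulVec x) (g.mulVec y) := by
  have h (x : Fin 3 → R) : g.mulVec x = x 0 • g.col 0 + x 1 • g.col 1 + x 2 • g.col 2 := by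
    ext i
    simp [Matrix.mulVec, dotProduct, Fin.sum_univ_three, mul_comm]
  rw [h, h]
  simp only [subst]
  generalize g.col 0 = u
  generalize g.col 1 = v
  generalize g.col 2 = w
  simp only [evalAt, Matrix.cons_val, dirDeriv, polar, Pi.add_apply, Pi.smul_apply, smul_eq_mul]
  ring

theorem evalAt_map (φ : R →+* S) (c : Fin 10 → R) (x : Fin 3 → R) :
    evalAt (φ ∘ c) (φ ∘ x) = φ (evalAt c x) := by
  simp [evalAt]

theorem dirDeriv_map (φ : R →+* S) (c : Fin 10 → R) (x y : Fin 3 → R) :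
    dirDeriv (φ ∘ c) (φ ∘ x) (φ ∘ y) = φ (dirDeriv c x y) := by
  simp [dirDeriv, map_ofNat φ]

theorem subst_map (φ : R →+* S) (g : Matrix (Fin 3) (Fin 3) R) (c : Fin 10 → R) :
    subst (g.map φ) (φ ∘ c) = φ ∘ subst g c := by
  have h (j : Fin 3) : (g.map φ).col j = φ ∘ g.col j := by ext; simp
  ext i
  fin_cases i <;> simp [subst, h, evalAt_map, dirDeriv_map, polar, map_ofNat φ]

open Polynomial in
/-- The point `(1, T, T⁴)` of the polynomial ring separates the ten cubic monomials, which take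
there the values `T ^ (j + 4 k)`. -/
theorem evalAt_generic (c : Fin 10 → R) :
    evalAt (Polynomial.C ∘ c) ![1, (X : R[X]), X ^ 4] =
      C (c 0) + C (c 1) * X + C (c 3) * X ^ 2 + C (c 6) * X ^ 3 + C (c 2) * X ^ 4 +
        C (c 4) * X ^ 5 + C (c 7) * X ^ 6 + C (c 5) * X ^ 8 + C (c 8) * X ^ 9 +
        C (c 9) * X ^ 12 := by
  simp only [evalAt, Function.comp_apply, Matrix.cons_val]
  ring

open Polynomial in
theorem eq_zero_of_evalAt_generic {c : Fin 10 → R}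
    (h : evalAt (Polynomial.C ∘ c) ![1, (X : R[X]), X ^ 4] = 0) : c = 0 := by
  rw [evalAt_generic] at h
  have key (n : ℕ) := congrArg (fun P : R[X] ↦ P.coeff n) h
  have h0 := key 0
  have h1 := key 1
  have h2 := key 2
  have h3 := key 3
  have h4 := key 4
  have h5 := key 5
  have h6 := key 6
  have h8 := key 8
  have h9 := key 9
  have h12 := key 12
  simp [coeff_X, coeff_C] at h0 h1 h2 h3 h4 h5 h6 h8 h9 h12
  ext i
  fin_cases i <;> simp [*]

/-- A coefficient vector is determined by the values of its form over the polynomial ring. -/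
theorem ext_of_evalAt_polynomial {c d : Fin 10 → R}
    (h : ∀ x : Fin 3 → Polynomial R,
      evalAt (Polynomial.C ∘ c) x = evalAt (Polynomial.C ∘ d) x) : c = d := by
  rw [← sub_eq_zero]
  refine eq_zero_of_evalAt_generic ?_
  have h1 : (Polynomial.C ∘ (c - d) : Fin 10 → Polynomial R) =
      Polynomial.C ∘ c + (-1 : Polynomial R) • (Polynomial.C ∘ d) := by
    ext1 i
    simp [sub_eq_add_neg]
  rw [h1, evalAt_add_left, evalAt_smul_left, h]
  ring

theorem subst_add (g : Matrix (Fin 3) (Fin 3) R) (c d : Fin 10 → R) :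
    subst g (c + d) = subst g c + subst g d := by
  have hadd (a b : Fin 10 → R) : (Polynomial.C ∘ (a + b) : Fin 10 → Polynomial R) =
      Polynomial.C ∘ a + Polynomial.C ∘ b := by
    ext1 i
    simp
  refine ext_of_evalAt_polynomial fun x ↦ ?_
  rw [hadd, evalAt_add_left, ← subst_map, ← subst_map, ← subst_map, evalAt_subst, evalAt_subst,
    evalAt_subst, hadd, evalAt_add_left]

theorem subst_smul (g : Matrix (Fin 3) (Fin 3) R) (a : R) (c : Fin 10 → R) :
    subst g (a • c) = a • subst g c := by
  have hsmul (b : Fin 10 → R) : (Polynomial.C ∘ (a • b) : Fin 10 → Polynomial R) =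
      Polynomial.C a • (Polynomial.C ∘ b) := by
    ext1 i
    simp
  refine ext_of_evalAt_polynomial fun x ↦ ?_
  rw [hsmul, evalAt_smul_left, ← subst_map, ← subst_map, evalAt_subst, evalAt_subst, hsmul,
    evalAt_smul_left]

theorem subst_mul (g h : Matrix (Fin 3) (Fin 3) R) (c : Fin 10 → R) :
    subst (g * h) c = subst h (subst g c) := by
  refine ext_of_evalAt_polynomial fun x ↦ ?_
  rw [← subst_map, ← subst_map, ← subst_map, evalAt_subst, evalAt_subst, evalAt_subst,
    Matrix.mulVec_mulVec]
  congr 2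
  exact Matrix.map_mul

theorem subst_one (c : Fin 10 → R) : subst 1 c = c := by
  refine ext_of_evalAt_polynomial fun x ↦ ?_
  rw [← subst_map, evalAt_subst]
  congr 1
  rw [Matrix.map_one _ (map_zero _) (map_one _), Matrix.one_mulVec]

end Forms

/-! ### Anisotropic forms, extensions, and points in general position -/

/-- A cubic form is anisotropic if it has no nontrivial zero. -/
def Anisotropic {R : Type*} [CommRing R] (c : Fin 10 → R) : Prop :=
  ∀ x : Fin 3 → R, x ≠ 0 → evalAt c x ≠ 0

section QuadraticExtension

variable {K E : Type*} [Field K] [Field E]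

/-- An anisotropic cubic form stays anisotropic over a quadratic extension: a zero over the
extension and its conjugate span a line defined over the base, and this line meets the cubic in a
third point, which is defined over the base. -/
theorem Anisotropic.of_finrank_eq_two [Algebra K E] (hE : Module.finrank K E = 2)
    {c : Fin 10 → K} (hc : Anisotropic c) : Anisotropic (algebraMap K E ∘ c) := by
  intro x hx h0
  have : Module.Finite K E := Module.finite_of_finrank_pos (by omega)
  let e : Module.Basis (Fin 2) K E := Module.finBasisOfFinrankEq K E hE
  have hrep (y : E) :
      y = algebraMap K E (e.repr y 0) * e 0 + algebraMap K E (e.repr y 1) * e 1 := by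
    conv_lhs => rw [← e.sum_repr y]
    simp [Fin.sum_univ_two, Algebra.smul_def]
  have he0 : e 0 ≠ 0 := e.ne_zero 0
  set τ : E := e 1 / e 0 with hτ
  have he1 : e 1 = τ * e 0 := by rw [hτ]; field_simp
  have hind (α β : K) (h : algebraMap K E α + algebraMap K E β * τ = 0) : α = 0 ∧ β = 0 := by
    have h1 : α • e 0 + β • e 1 = 0 := by
      rw [Algebra.smul_def, Algebra.smul_def, he1]
      linear_combination e 0 * h
    have h2 := Fintype.linearIndependent_iff.1 e.linearIndependent ![α, β]
      (by simpa [Fin.sum_univ_two] using h1)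
    exact ⟨by simpa using h2 0, by simpa using h2 1⟩
  obtain ⟨m, n, hmn⟩ : ∃ m n : K, τ ^ 2 = algebraMap K E m + algebraMap K E n * τ := by
    refine ⟨e.repr (τ * e 1) 0, e.repr (τ * e 1) 1, ?_⟩
    have h1 := hrep (τ * e 1)
    generalize e.repr (τ * e 1) 0 = r at h1 ⊢
    generalize e.repr (τ * e 1) 1 = s at h1 ⊢
    rw [he1] at h1
    apply mul_right_cancel₀ he0
    linear_combination h1
  set a : Fin 3 → K := fun i ↦ e.repr (x i) 0
  set b : Fin 3 → K := fun i ↦ e.repr (x i) 1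
  have hxab : x = e 0 • ((1 : E) • (algebraMap K E ∘ a) + τ • (algebraMap K E ∘ b)) := by
    ext i
    have h1 := hrep (x i)
    simp only [Pi.smul_apply, Pi.add_apply, Function.comp_apply, smul_eq_mul, a, b]
    rw [he1] at h1
    linear_combination h1
  rw [hxab, evalAt_smul] at h0
  replace h0 := (mul_eq_zero.1 h0).resolve_left (pow_ne_zero 3 he0)
  by_cases hb : b = 0
  · have hb' : algebraMap K E ∘ b = 0 := by ext; simp [hb]
    rw [hb', smul_zero, add_zero, one_smul, evalAt_map, map_eq_zero] at h0
    refine hc a (fun ha ↦ hx ?_) h0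
    rw [hxab, ha, hb]
    ext
    simp
  have h00 := h0
  rw [evalAt_add_smul, evalAt_map, evalAt_map, dirDeriv_map, dirDeriv_map] at h0
  have hline (t : K) := evalAt_add_smul c a b 1 t
  have hD := hc b hb
  have hDb := hc b hb
  generalize evalAt c a = A at h0 hline
  generalize dirDeriv c a b = B at h0 hline
  generalize dirDeriv c b a = C at h0 hline
  generalize evalAt c b = D at h0 hline hD
  obtain ⟨h1, h2⟩ := hind (A + m * (C + n * D)) (B + m * D + n * (C + n * D)) (by
    simp only [map_add, map_mul]
    linear_combination h0 - (algebraMap K E D * τ + algebraMap K E C +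
      algebraMap K E n * algebraMap K E D) * hmn)
  -- the cubic polynomial vanishing at `τ` is the minimal polynomial of `τ` times a linear one
  obtain ⟨t, ht⟩ : ∃ t : K, t * D = -(C + n * D) := ⟨-(C + n * D) / D, by field_simp⟩
  have hz : (1 : K) • a + t • b = 0 := by
    by_contra hne
    refine hc _ hne ?_
    rw [hline]
    linear_combination h1 + t * h2 + (t ^ 2 - n * t - m) * ht
  have hz' : (1 : E) • (algebraMap K E ∘ a) + τ • (algebraMap K E ∘ b) =
      (τ - algebraMap K E t) • (algebraMap K E ∘ b) := by
    ext i
    have h3 := congrArg (algebraMap K E) (congrFun hz i)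
    simp only [Pi.add_apply, Pi.smul_apply, smul_eq_mul, map_add, map_mul, map_one, Pi.zero_apply,
      map_zero, Function.comp_apply] at h3 ⊢
    linear_combination h3
  rw [hz', evalAt_smul, evalAt_map] at h00
  have h3 : τ - algebraMap K E t = 0 :=
    pow_eq_zero_iff three_ne_zero |>.1 ((mul_eq_zero.1 h00).resolve_right (by simpa using hDb))
  have h4 := hind (-t) 1 (by rw [map_neg, map_one]; linear_combination h3)
  exact one_ne_zero h4.2

/-- An anisotropic cubic form over a finite field stays anisotropic over arbitrarily large finite
extensions. -/
theorem Anisotropic.exists_large_extension {K : Type} [Field K] [Finite K] {c : Fin 10 → K}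
    (hc : Anisotropic c) (N : ℕ) :
    ∃ (E : Type) (_ : Field E) (_ : Finite E) (φ : K →+* E), N ≤ Nat.card E ∧
      Anisotropic (φ ∘ c) := by
  induction N with
  | zero => exact ⟨K, inferInstance, inferInstance, RingHom.id K, Nat.zero_le _, by simpa using hc⟩
  | succ N ih =>
    obtain ⟨E, _, _, φ, hN, hE⟩ := ih
    obtain ⟨p, _⟩ := CharP.exists E
    have : Fact p.Prime := ⟨CharP.char_is_prime E p⟩
    let : Algebra (ZMod p) E := ZMod.algebra E p
    refine ⟨FiniteField.Extension E p 2, inferInstance, inferInstance,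
      (algebraMap E (FiniteField.Extension E p 2)).comp φ, ?_, ?_⟩
    · rw [FiniteField.natCard_extension]
      have : 2 ≤ Nat.card E := Finite.one_lt_card
      nlinarith
    · exact hE.of_finrank_eq_two (FiniteField.finrank_extension E p 2)

end QuadraticExtension

section Product

variable {R : Type*} [CommRing R]

/-- The coefficient vector of the product of three linear forms. -/
def prodLinear (l m n : Fin 3 → R) : Fin 10 → R :=
  ![l 0 * m 0 * n 0,
    l 0 * m 0 * n 1 + l 0 * m 1 * n 0 + l 1 * m 0 * n 0,
    l 0 * m 0 * n 2 + l 0 * m 2 * n 0 + l 2 * m 0 * n 0,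
    l 0 * m 1 * n 1 + l 1 * m 0 * n 1 + l 1 * m 1 * n 0,
    l 0 * m 1 * n 2 + l 0 * m 2 * n 1 + l 1 * m 0 * n 2 + l 1 * m 2 * n 0 + l 2 * m 0 * n 1 +
      l 2 * m 1 * n 0,
    l 0 * m 2 * n 2 + l 2 * m 0 * n 2 + l 2 * m 2 * n 0,
    l 1 * m 1 * n 1,
    l 1 * m 1 * n 2 + l 1 * m 2 * n 1 + l 2 * m 1 * n 1,
    l 1 * m 2 * n 2 + l 2 * m 1 * n 2 + l 2 * m 2 * n 1,
    l 2 * m 2 * n 2]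

theorem evalAt_prodLinear (l m n x : Fin 3 → R) :
    evalAt (prodLinear l m n) x = (l ⬝ᵥ x) * (m ⬝ᵥ x) * (n ⬝ᵥ x) := by
  simp only [evalAt, prodLinear, Matrix.cons_val, dotProduct, Fin.sum_univ_three]
  ring

end Product

section Moments

open scoped LinearAlgebra.Projectivization
open Finset

variable {K : Type*} [Field K]

/-- Two distinct points of a projective space are separated by a linear form. -/
theorem exists_linear_separating {v w : Fin 3 → K}
    (h : ∀ a : K, v ≠ a • w) : ∃ l : Fin 3 → K, l ⬝ᵥ v ≠ 0 ∧ l ⬝ᵥ w = 0 := by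
  obtain ⟨f, hf, hfw⟩ := Submodule.exists_dual_map_eq_bot_of_notMem
    (p := Submodule.span K {w}) (x := v)
    (by rw [Submodule.mem_span_singleton]; rintro ⟨a, ha⟩; exact h a ha.symm) inferInstance
  have hl (x : Fin 3 → K) : (fun i ↦ f (Pi.single i 1)) ⬝ᵥ x = f x := by
    rw [LinearMap.pi_apply_eq_sum_univ f x, dotProduct]
    refine Finset.sum_congr rfl fun i _ ↦ ?_
    rw [smul_eq_mul, mul_comm]
    congr 2
    ext j
    simp [Pi.single_apply, eq_comm]
  refine ⟨fun i ↦ f (Pi.single i 1), by rwa [hl], ?_⟩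
  rw [hl]
  have : f w ∈ (Submodule.span K {w}).map f :=
    Submodule.mem_map_of_mem (Submodule.mem_span_singleton_self w)
  rw [hfw] at this
  simpa using this

/-- Any at most four distinct points of the projective plane impose independent conditions on
cubic forms. -/
theorem exists_cubic_separating {j : ℕ} (hj : j ≤ 4) (P : Fin j ↪ ℙ K (Fin 3 → K)) (i : Fin j) :
    ∃ c : Fin 10 → K, evalAt c (P i).rep ≠ 0 ∧ ∀ i', i' ≠ i → evalAt c (P i').rep = 0 := by
  have hsep (i' : Fin j) : ∃ l : Fin 3 → K, l ⬝ᵥ (P i).rep ≠ 0 ∧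
      (i' ≠ i → l ⬝ᵥ (P i').rep = 0) := by
    by_cases hi : i' = i
    · obtain ⟨l, hl, -⟩ := exists_linear_separating (v := (P i).rep) (w := 0)
        (by simpa using (P i).rep_nonzero)
      exact ⟨l, hl, fun h ↦ absurd hi h⟩
    · obtain ⟨l, hl, hl'⟩ := exists_linear_separating (v := (P i).rep) (w := (P i').rep) (by
        intro a ha
        apply hi
        apply P.injective
        rw [← (P i').mk_rep, ← (P i).mk_rep]
        rw [Projectivization.mk_eq_mk_iff']
        have ha0 : a ≠ 0 := by
          rintro rfl
          exact (P i).rep_nonzero (by simpa using ha)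
        exact ⟨a⁻¹, by rw [ha, smul_smul, inv_mul_cancel₀ ha0, one_smul]⟩)
      exact ⟨l, hl, fun _ ↦ hl'⟩
  choose l hl hl' using hsep
  obtain ⟨o, ho⟩ : ∃ o : Fin 3 → Fin j, ∀ i', i' ≠ i → ∃ k, o k = i' := by
    clear hl hl' l P
    have hj0 : j ≠ 0 := by rintro rfl; exact i.elim0
    interval_cases j
    · exact absurd rfl hj0
    all_goals revert i; decide
  refine ⟨prodLinear (l (o 0)) (l (o 1)) (l (o 2)), ?_, fun i' hi' ↦ ?_⟩
  · rw [evalAt_prodLinear]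
    exact mul_ne_zero (mul_ne_zero (hl _) (hl _)) (hl _)
  · obtain ⟨k, hk⟩ := ho i' hi'
    have := hl' i' hi'
    rw [evalAt_prodLinear]
    rw [← hk] at this ⊢
    fin_cases k <;> simp at this <;> simp [this]

/-- Evaluation of cubic forms at finitely many points, as a linear map. -/
def evalPoints {j : ℕ} (x : Fin j → Fin 3 → K) : (Fin 10 → K) →ₗ[K] (Fin j → K) where
  toFun c i := evalAt c (x i)
  map_add' c d := by ext i; exact evalAt_add_left c d _
  map_smul' a c := by ext i; exact evalAt_smul_left c a _

theorem natCard_vanishing [Finite K] {j : ℕ} (hj : j ≤ 4) (P : Fin j ↪ ℙ K (Fin 3 → K)) :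
    Nat.card {c : Fin 10 → K // ∀ i, evalAt c (P i).rep = 0} = Nat.card K ^ (10 - j) := by
  have hsurj : LinearMap.range (evalPoints fun i ↦ (P i).rep) = ⊤ := by
    rw [eq_top_iff, ← (Pi.basisFun K (Fin j)).span_eq, Submodule.span_le]
    rintro _ ⟨i, rfl⟩
    obtain ⟨c, hc, hc'⟩ := exists_cubic_separating hj P i
    refine ⟨(evalAt c (P i).rep)⁻¹ • c, ?_⟩
    ext i'
    by_cases h : i' = i
    · subst h
      simp [evalPoints, hc]
    · simp [evalPoints, hc' i' h, h]
  have hker : Module.finrank K (LinearMap.ker (evalPoints fun i ↦ (P i).rep)) = 10 - j := by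
    have := LinearMap.finrank_range_add_finrank_ker (evalPoints fun i ↦ (P i).rep)
    rw [hsurj, finrank_top, Module.finrank_fin_fun, Module.finrank_fin_fun] at this
    omega
  have h1 := Module.natCard_eq_pow_finrank (K := K)
    (V := LinearMap.ker (evalPoints fun i ↦ (P i).rep))
  rw [hker] at h1
  rw [← h1]
  refine Nat.card_congr (Equiv.subtypeEquivRight fun c ↦ ?_)
  simp [LinearMap.mem_ker, evalPoints, funext_iff]

end Moments

/-! ### Moments of the number of zeros -/

section Moments

open scoped LinearAlgebra.Projectivization
open Finset

variable {K : Type*} [Field K]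

/-- The number of zeros of a cubic form in the projective plane. -/
noncomputable def numZeros (c : Fin 10 → K) : ℕ :=
  Nat.card {P : ℙ K (Fin 3 → K) // evalAt c P.rep = 0}

theorem Anisotropic.numZeros_eq_zero {c : Fin 10 → K} (hc : Anisotropic c) : numZeros c = 0 := by
  have : IsEmpty {P : ℙ K (Fin 3 → K) // evalAt c P.rep = 0} :=
    ⟨fun P ↦ hc _ P.1.rep_nonzero P.2⟩
  exact Nat.card_of_isEmpty

theorem natCard_projectivePlane [Finite K] :
    Nat.card (ℙ K (Fin 3 → K)) = Nat.card K ^ 2 + Nat.card K + 1 := by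
  rw [Projectivization.card_of_finrank K (Fin 3 → K) (n := 3) (by simp)]
  simp [Finset.sum_range_succ]
  ring

/-- The factorial moments, up to the fourth, of the number of zeros of a cubic form. -/
theorem sum_descFactorial_numZeros [Fintype K] {j : ℕ} (hj : j ≤ 4) :
    ∑ c : Fin 10 → K, (numZeros c).descFactorial j =
      (Fintype.card K ^ 2 + Fintype.card K + 1).descFactorial j * Fintype.card K ^ (10 - j) := by
  classical
  have : Fintype (ℙ K (Fin 3 → K)) := Fintype.ofFinite _
  have h1 (c : Fin 10 → K) : (numZeros c).descFactorial j =
      #{P : Fin j ↪ ℙ K (Fin 3 → K) | ∀ i, evalAt c (P i).rep = 0} := by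
    have e : {P : Fin j ↪ ℙ K (Fin 3 → K) // ∀ i, evalAt c (P i).rep = 0} ≃
        (Fin j ↪ {P : ℙ K (Fin 3 → K) // evalAt c P.rep = 0}) :=
      { toFun P := ⟨fun i ↦ ⟨P.1 i, P.2 i⟩, fun a b h ↦ P.1.injective (congrArg Subtype.val h)⟩
        invFun P := ⟨P.trans (Function.Embedding.subtype _), fun i ↦ (P i).2⟩
        left_inv P := rfl
        right_inv P := rfl }
    rw [← Fintype.card_subtype, Fintype.card_congr e, Fintype.card_embedding_eq, numZeros,
      Nat.card_eq_fintype_card, Fintype.card_fin]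
  have h2 (P : Fin j ↪ ℙ K (Fin 3 → K)) :
      #{c : Fin 10 → K | ∀ i, evalAt c (P i).rep = 0} = Fintype.card K ^ (10 - j) := by
    have := natCard_vanishing hj P
    rwa [Nat.card_eq_fintype_card, Nat.card_eq_fintype_card, Fintype.card_subtype] at this
  simp_rw [h1]
  have h3 := Finset.sum_card_bipartiteAbove_eq_sum_card_bipartiteBelow
    (s := (univ : Finset (Fin 10 → K))) (t := (univ : Finset (Fin j ↪ ℙ K (Fin 3 → K))))
    (fun c P ↦ ∀ i, evalAt c (P i).rep = 0)
  simp only [bipartiteAbove, bipartiteBelow] at h3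
  rw [h3, Finset.sum_congr rfl fun P _ ↦ h2 P, Finset.sum_const, Finset.card_univ,
    Fintype.card_embedding_eq, Fintype.card_fin, smul_eq_mul]
  congr 2
  have := natCard_projectivePlane (K := K)
  rwa [Nat.card_eq_fintype_card, Nat.card_eq_fintype_card] at this

theorem cast_descFactorial_four_int (n : ℕ) :
    ((n.descFactorial 4 : ℕ) : ℤ) = n * (n - 1) * (n - 2) * (n - 3) := by
  rcases n with _ | _ | _ | n <;> simp [Nat.descFactorial_succ]
  ring

theorem cast_descFactorial_three_int (n : ℕ) :
    ((n.descFactorial 3 : ℕ) : ℤ) = n * (n - 1) * (n - 2) := by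
  rcases n with _ | _ | n <;> simp [Nat.descFactorial_succ]
  ring

theorem cast_descFactorial_two_int (n : ℕ) :
    ((n.descFactorial 2 : ℕ) : ℤ) = n * (n - 1) := by
  rcases n with _ | n <;> simp [Nat.descFactorial_succ]
  ring

/-- The number of zeros has mean about `q + 1` and fourth central moment about `3 q²`, so that
it vanishes for at most about `3 q ^ 8` of the `q ^ 10` cubic forms. -/
theorem card_anisotropic_mul_le [Fintype K] :
    Nat.card {c : Fin 10 → K // Anisotropic c} * (Fintype.card K + 1) ^ 4 ≤
      4 * Fintype.card K ^ 12 := by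
  classical
  set q := Fintype.card K with hqdef
  have h (j : ℕ) (hj : j ≤ 4) := congrArg (Nat.cast : ℕ → ℤ)
    (sum_descFactorial_numZeros (K := K) hj)
  have h0 := h 0 (by norm_num)
  have h1 := h 1 (by norm_num)
  have h2 := h 2 (by norm_num)
  have h3 := h 3 (by norm_num)
  have h4 := h 4 (by norm_num)
  rw [← hqdef] at h0 h1 h2 h3 h4
  push_cast [cast_descFactorial_two_int, cast_descFactorial_three_int, cast_descFactorial_four_int,
    Nat.descFactorial_zero, Nat.descFactorial_one] at h0 h1 h2 h3 h4
  have hexp : ∑ c : Fin 10 → K, ((numZeros c : ℤ) - (q + 1)) ^ 4 =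
      (∑ c : Fin 10 → K, (numZeros c : ℤ) * (numZeros c - 1) * (numZeros c - 2) *
        (numZeros c - 3)) +
      (6 - 4 * (q + 1 : ℤ)) * (∑ c : Fin 10 → K, (numZeros c : ℤ) * (numZeros c - 1) *
        (numZeros c - 2)) +
      (7 - 12 * (q + 1 : ℤ) + 6 * (q + 1) ^ 2) *
        (∑ c : Fin 10 → K, (numZeros c : ℤ) * (numZeros c - 1)) +
      (1 - 4 * (q + 1 : ℤ) + 6 * (q + 1) ^ 2 - 4 * (q + 1) ^ 3) *
        (∑ c : Fin 10 → K, (numZeros c : ℤ)) +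
      (q + 1 : ℤ) ^ 4 * (∑ c : Fin 10 → K, (1 : ℤ)) := by
    simp only [Finset.mul_sum, ← Finset.sum_add_distrib]
    refine Finset.sum_congr rfl fun c _ ↦ ?_
    ring
  have hlow : (Nat.card {c : Fin 10 → K // Anisotropic c} : ℤ) * (q + 1) ^ 4 ≤
      ∑ c : Fin 10 → K, ((numZeros c : ℤ) - (q + 1)) ^ 4 := by
    rw [Nat.card_eq_fintype_card, Fintype.card_subtype, ← nsmul_eq_mul, ← Finset.sum_const]
    calc ∑ c : Fin 10 → K with Anisotropic c, (q + 1 : ℤ) ^ 4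
        = ∑ c : Fin 10 → K with Anisotropic c, ((numZeros c : ℤ) - (q + 1)) ^ 4 := by
          refine Finset.sum_congr rfl fun c hc ↦ ?_
          rw [(Finset.mem_filter.1 hc).2.numZeros_eq_zero]
          push_cast
          ring
      _ ≤ _ := Finset.sum_le_sum_of_subset_of_nonneg (Finset.filter_subset _ _)
          fun c _ _ ↦ by positivity
  rw [hexp, h4, h3, h2, h1, h0] at hlow
  have hq : (2 : ℤ) ≤ q := by exact_mod_cast (Fintype.one_lt_card (α := K))
  zify
  refine hlow.trans ?_
  generalize (q : ℤ) = Q at hq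
  have h5 : 0 ≤ Q ^ 6 * (Q ^ 5 * (Q - 1) + 2 * Q ^ 4 + 2 * Q ^ 3 + Q * (Q - 2)) := by
    have h6 : 0 ≤ Q - 1 := by linarith
    have h7 : 0 ≤ Q - 2 := by linarith
    positivity
  linear_combination h5

end Moments

/-! ### Zeros on a line over a cubic extension -/

section CubicExtension

open Polynomial

variable {K : Type} [Field K]

/-- A cubic polynomial without roots over a finite field has a root in a Galois extension of
degree `3`, in which `1, θ, θ²` are linearly independent. -/
theorem exists_cubic_extension [Finite K] {P : K[X]} (hdeg : P.natDegree = 3)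
    (hroot : ∀ x, P.eval x ≠ 0) :
    ∃ (E : Type) (_ : Field E) (_ : Algebra K E) (_ : FiniteDimensional K E) (_ : IsGalois K E)
      (θ : E), Nat.card Gal(E/K) = 3 ∧ aeval θ P = 0 ∧
      (∀ a b d : K, algebraMap K E a + algebraMap K E b * θ + algebraMap K E d * θ ^ 2 = 0 →
        a = 0 ∧ b = 0 ∧ d = 0) ∧ (∀ θ' : E, aeval θ' P = 0 → ∃ σ : Gal(E/K), σ θ = θ') ∧
      (∀ y : E, ∃ a b d : K,
        y = algebraMap K E a + algebraMap K E b * θ + algebraMap K E d * θ ^ 2) ∧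
      ∀ (F : Type) (_ : Field F) (φ : K →+* F) (t : F), P.eval₂ φ t = 0 →
        ∃ χ : E →+* F, χ θ = t ∧ ∀ a, χ (algebraMap K E a) = φ a := by
  have hP0 : P ≠ 0 := by rintro rfl; simp at hdeg
  have hirr : Irreducible P := by
    rw [Polynomial.irreducible_iff_roots_eq_zero_of_degree_le_three (by omega) (by omega)]
    rw [Multiset.eq_zero_iff_forall_notMem]
    intro x hx
    exact hroot x ((mem_roots hP0).1 hx)
  have : Fact (Irreducible P) := ⟨hirr⟩
  have hfd : FiniteDimensional K (AdjoinRoot P) := (AdjoinRoot.powerBasis hP0).finite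
  have : Finite (AdjoinRoot P) := Module.finite_of_finite K
  have hgal : IsGalois K (AdjoinRoot P) := inferInstance
  have hind : ∀ a b d : K, algebraMap K (AdjoinRoot P) a + algebraMap K (AdjoinRoot P) b *
      AdjoinRoot.root P + algebraMap K (AdjoinRoot P) d * AdjoinRoot.root P ^ 2 = 0 →
      a = 0 ∧ b = 0 ∧ d = 0 := by
    intro a b d h
    have h1 : AdjoinRoot.mk P (C a + C b * X + C d * X ^ 2) = 0 := by
      simpa [AdjoinRoot.algebraMap_eq] using h
    rw [AdjoinRoot.mk_eq_zero] at h1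
    have h2 : C a + C b * X + C d * X ^ 2 = 0 := by
      refine eq_zero_of_dvd_of_natDegree_lt h1 ?_
      rw [hdeg]
      refine lt_of_le_of_lt (b := 2) ?_ (by norm_num)
      compute_degree
    have key (n : ℕ) := congrArg (fun Q : K[X] ↦ Q.coeff n) h2
    have k0 := key 0
    have k1 := key 1
    have k2 := key 2
    simp [coeff_X, coeff_C] at k0 k1 k2
    exact ⟨k0, k1, k2⟩
  have hfin : Module.finrank K (AdjoinRoot P) = 3 := by
    rw [(AdjoinRoot.powerBasis hP0).finrank, AdjoinRoot.powerBasis_dim, hdeg]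
  refine ⟨AdjoinRoot P, inferInstance, inferInstance, hfd, hgal, AdjoinRoot.root P, ?_, ?_, hind,
    ?_, ?_, ?_⟩
  · rw [IsGalois.card_aut_eq_finrank, hfin]
  · rw [AdjoinRoot.aeval_eq, AdjoinRoot.mk_self]
  · intro θ' hθ'
    have hb : Function.Bijective (AdjoinRoot.liftAlgHom P (Algebra.ofId K (AdjoinRoot P)) θ'
        (by simpa [aeval_def] using hθ')) :=
      Finite.injective_iff_bijective.1 (RingHom.injective _)
    exact ⟨AlgEquiv.ofBijective _ hb, by simp⟩
  · have hinj : Function.Injective fun v : Fin 3 → K ↦ algebraMap K (AdjoinRoot P) (v 0) +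
        algebraMap K (AdjoinRoot P) (v 1) * AdjoinRoot.root P +
        algebraMap K (AdjoinRoot P) (v 2) * AdjoinRoot.root P ^ 2 := by
      intro v w hvw
      dsimp only at hvw
      obtain ⟨h0, h1, h2⟩ := hind (v 0 - w 0) (v 1 - w 1) (v 2 - w 2) (by
        rw [map_sub, map_sub, map_sub]
        linear_combination hvw)
      ext i
      fin_cases i
      exacts [sub_eq_zero.1 h0, sub_eq_zero.1 h1, sub_eq_zero.1 h2]
    have hbij := hinj.bijective_of_nat_card_le (by
      rw [Module.natCard_eq_pow_finrank (K := K) (V := AdjoinRoot P), hfin, Nat.card_fun,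
        Nat.card_fin])
    intro y
    obtain ⟨v, hv⟩ := hbij.2 y
    exact ⟨v 0, v 1, v 2, hv.symm⟩
  · intro F _ φ t ht
    exact ⟨AdjoinRoot.lift φ t ht, AdjoinRoot.lift_root ht, fun a ↦ AdjoinRoot.lift_of ht⟩

end CubicExtension

/-- Every element of a finite field of characteristic three is a cube. -/
theorem exists_pow_three_eq {K : Type*} [Field K] [Finite K] (h3 : (3 : K) = 0) (a : K) :
    ∃ t : K, t ^ 3 = a := by
  have hchar : CharP K 3 := by
    have : ringChar K ∣ 3 := ringChar.dvd (by exact_mod_cast h3)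
    rcases (Nat.dvd_prime Nat.prime_three).1 this with h | h
    · exact absurd h CharP.ringChar_ne_one
    · exact h ▸ ringChar.charP K
  have hp : Fact (Nat.Prime 3) := ⟨Nat.prime_three⟩
  obtain ⟨t, ht⟩ := (bijective_frobenius K 3).2 a
  exact ⟨t, by rwa [frobenius_def] at ht⟩

section Binary

variable {K : Type} [Field K]

/-- The first two coordinates of the point `(θ : 1 : 0)` on the line `z = 0`. -/
def linePoint {E : Type*} [Field E] (θ : E) : Fin 3 → E := ![θ, 1, 0]

/-- The restriction of an anisotropic form to the line `z = 0` has a root of degree `3`. -/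
theorem exists_cubic_root [Finite K] {c : Fin 10 → K}
    (hc : ∀ x y : K, (x ≠ 0 ∨ y ≠ 0) → evalAt c ![x, y, 0] ≠ 0) :
    ∃ (E : Type) (_ : Field E) (_ : Algebra K E) (_ : FiniteDimensional K E) (_ : IsGalois K E)
      (θ : E), Nat.card Gal(E/K) = 3 ∧ evalAt (algebraMap K E ∘ c) (linePoint θ) = 0 ∧
      (∀ a b d : K, algebraMap K E a + algebraMap K E b * θ + algebraMap K E d * θ ^ 2 = 0 →
        a = 0 ∧ b = 0 ∧ d = 0) ∧
      ∀ θ' : E, evalAt (algebraMap K E ∘ c) (linePoint θ') = 0 → ∃ σ : Gal(E/K), σ θ = θ' := by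
  open Polynomial in
  have h0 : c 0 ≠ 0 := by simpa [evalAt] using hc 1 0 (by simp)
  obtain ⟨E, i1, i2, i3, i4, θ, h1, h2, h3, h4, -⟩ := exists_cubic_extension
    (P := C (c 0) * X ^ 3 + C (c 1) * X ^ 2 + C (c 3) * X + C (c 6))
    (by compute_degree!) (by
      intro x
      have := hc x 1 (by simp)
      intro h
      apply this
      simp [evalAt] at h ⊢
      linear_combination h)
  refine ⟨E, i1, i2, i3, i4, θ, h1, ?_, h3, fun θ' hθ' ↦ h4 θ' ?_⟩
  · simp [evalAt, linePoint] at h2 ⊢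
    linear_combination h2
  · simp [evalAt, linePoint] at hθ' ⊢
    linear_combination hθ'

end Binary

/-! ### Substitutions preserving an anisotropic form and a line -/

section LineStabilizer

open Matrix

/-- The group of invertible substitutions that preserve a cubic form. -/
def substStabilizer {K : Type*} [Field K] (c : Fin 10 → K) : Subgroup (GL (Fin 3) K) where
  carrier := {g | subst g.1 c = c}
  one_mem' := subst_one c
  mul_mem' {g h} hg hh := by
    change subst (g.1 * h.1) c = c
    rw [subst_mul, hg, hh]
  inv_mem' {g} hg := by
    change subst g⁻¹.1 c = c
    conv_lhs => rw [← show subst g.1 c = c from hg, ← subst_mul]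
    rw [Units.mul_inv, subst_one]

theorem mem_substStabilizer {K : Type*} [Field K] {c : Fin 10 → K} {g : GL (Fin 3) K} :
    g ∈ substStabilizer c ↔ subst g.1 c = c :=
  Iff.rfl

variable {K : Type} [Field K]

/-- The matrix `g` preserves the line `z = 0`, acts as the scalar `d` on the corresponding plane,
and multiplies the form `z` by `γ`. -/
structure IsPlaneScalar (g : GL (Fin 3) K) (d γ : K) : Prop where
  col_zero : g.1 *ᵥ ![1, 0, 0] = d • ![1, 0, 0]
  col_one : g.1 *ᵥ ![0, 1, 0] = d • ![0, 1, 0]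
  row_two : ![0, 0, 1] ᵥ* g.1 = γ • ![0, 0, 1]

theorem IsPlaneScalar.mul {g h : GL (Fin 3) K} {d γ d' γ' : K} (hg : IsPlaneScalar g d γ)
    (hh : IsPlaneScalar h d' γ') : IsPlaneScalar (g * h) (d * d') (γ * γ') where
  col_zero := by
    rw [Units.val_mul, ← mulVec_mulVec, hh.col_zero, mulVec_smul, hg.col_zero, smul_smul, mul_comm]
  col_one := by
    rw [Units.val_mul, ← mulVec_mulVec, hh.col_one, mulVec_smul, hg.col_one, smul_smul, mul_comm]
  row_two := by
    rw [Units.val_mul, ← vecMul_vecMul, hg.row_two, smul_vecMul, hh.row_two, smul_smul]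

theorem isPlaneScalar_iff {g : GL (Fin 3) K} {d γ : K} : IsPlaneScalar g d γ ↔
    g.1 = !![d, 0, g.1 0 2; 0, d, g.1 1 2; 0, 0, γ] := by
  constructor
  · rintro ⟨h0, h1, h2⟩
    ext i j
    have a0 := congrFun h0 i
    have a1 := congrFun h1 i
    have a2 := congrFun h2 j
    fin_cases i <;> fin_cases j <;>
      simp_all [mulVec, vecMul, dotProduct, Fin.sum_univ_three]
  · intro h
    generalize g.1 0 2 = α at h
    generalize g.1 1 2 = β at h
    constructor <;> rw [h] <;> ext i <;> fin_cases i <;>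
      simp [mulVec, vecMul, dotProduct, Fin.sum_univ_three]

theorem IsPlaneScalar.inv {g : GL (Fin 3) K} {d γ : K} (hg : IsPlaneScalar g d γ) (hd : d ≠ 0)
    (hγ : γ ≠ 0) : IsPlaneScalar g⁻¹ d⁻¹ γ⁻¹ where
  col_zero := by
    have h : ![(1 : K), 0, 0] = d⁻¹ • (g.1 *ᵥ ![1, 0, 0]) := by
      rw [hg.col_zero, smul_smul, inv_mul_cancel₀ hd, one_smul]
    conv_lhs => rw [h]
    rw [mulVec_smul, mulVec_mulVec, Units.inv_mul, one_mulVec]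
  col_one := by
    have h : ![(0 : K), 1, 0] = d⁻¹ • (g.1 *ᵥ ![0, 1, 0]) := by
      rw [hg.col_one, smul_smul, inv_mul_cancel₀ hd, one_smul]
    conv_lhs => rw [h]
    rw [mulVec_smul, mulVec_mulVec, Units.inv_mul, one_mulVec]
  row_two := by
    have h : ![(0 : K), 0, 1] = γ⁻¹ • (![0, 0, 1] ᵥ* g.1) := by
      rw [hg.row_two, smul_smul, inv_mul_cancel₀ hγ, one_smul]
    conv_lhs => rw [h]
    rw [smul_vecMul, vecMul_vecMul, Units.mul_inv, vecMul_one]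

variable {c : Fin 10 → K}

theorem evalAt_mulVec_of_mem {g : GL (Fin 3) K} (hg : g ∈ substStabilizer c) (x : Fin 3 → K) :
    evalAt c (g.1 *ᵥ x) = evalAt c x := by
  rw [← evalAt_subst, mem_substStabilizer.1 hg]

theorem pow_three_eq_one_of_mulVec_eq_smul (hc : Anisotropic c) {g : GL (Fin 3) K}
    (hg : g ∈ substStabilizer c) {x : Fin 3 → K} (hx : x ≠ 0) {a : K} (h : g.1 *ᵥ x = a • x) :
    a ^ 3 = 1 := by
  have h1 := evalAt_mulVec_of_mem hg x
  rw [h, evalAt_smul] at h1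
  exact mul_right_cancel₀ (hc x hx) (h1.trans (one_mul _).symm)

theorem IsPlaneScalar.pow_three (hc : Anisotropic c) {g : GL (Fin 3) K}
    (hg : g ∈ substStabilizer c) {d γ : K} (h : IsPlaneScalar g d γ) : d ^ 3 = 1 ∧ γ ^ 3 = 1 := by
  have hd : d ^ 3 = 1 := pow_three_eq_one_of_mulVec_eq_smul hc hg (by simp) h.col_zero
  refine ⟨hd, ?_⟩
  by_cases hdγ : γ = d
  · rwa [hdγ]
  -- otherwise `g` has an eigenvector with eigenvalue `γ` off the plane `z = 0`
  refine pow_three_eq_one_of_mulVec_eq_smul hc hg (x := ![g.1 0 2, g.1 1 2, γ - d]) ?_ ?_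
  · intro h0
    exact hdγ (sub_eq_zero.1 (by simpa using congrFun h0 2))
  · have h1 := isPlaneScalar_iff.1 h
    generalize g.1 0 2 = α at *
    generalize g.1 1 2 = β at *
    rw [h1]
    ext i
    fin_cases i <;> simp [mulVec, dotProduct, Fin.sum_univ_three] <;> ring

/-- An anisotropic cubic form is not preserved by a nontrivial elation. -/
theorem IsPlaneScalar.eq_one [Finite K] (hc : Anisotropic c) {g : GL (Fin 3) K}
    (hg : g ∈ substStabilizer c) (h : IsPlaneScalar g 1 1) : g = 1 := by
  have h1 := isPlaneScalar_iff.1 h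
  obtain ⟨α, hα⟩ : ∃ α, g.1 0 2 = α := ⟨_, rfl⟩
  obtain ⟨β, hβ⟩ : ∃ β, g.1 1 2 = β := ⟨_, rfl⟩
  rw [hα, hβ] at h1
  suffices h0 : α = 0 ∧ β = 0 by
    ext i j
    rw [h1, h0.1, h0.2]
    fin_cases i <;> fin_cases j <;> simp
  have h2 := mem_substStabilizer.1 hg
  rw [h1] at h2
  have e2 := congrFun h2 2
  have e4 := congrFun h2 4
  have e7 := congrFun h2 7
  simp [subst, dirDeriv, polar] at e2 e4 e7
  by_contra hne
  have hab : ![α, β, (0 : K)] ≠ 0 := by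
    intro h0
    exact hne ⟨by simpa using congrFun h0 0, by simpa using congrFun h0 1⟩
  have h3 := hc _ hab
  have h30 : (3 : K) = 0 := by
    have : (3 : K) * evalAt c ![α, β, 0] = 0 := by
      simp only [evalAt, Matrix.cons_val]
      linear_combination α ^ 2 * e2 + α * β * e4 + β ^ 2 * e7
    exact (mul_eq_zero.1 this).resolve_right h3
  have h13 : c 1 = 0 ∧ c 3 = 0 := by
    by_cases hα0 : α = 0
    · have hβ0 : β ≠ 0 := fun h ↦ hne ⟨hα0, h⟩
      constructor
      · apply mul_right_cancel₀ hβ0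
        linear_combination e2 - c 0 * α * h30
      · apply mul_right_cancel₀ hβ0
        linear_combination -e4 + c 3 * β * h30 + 2 * c 1 * hα0
    · have h3' : c 3 = 0 := by
        apply mul_right_cancel₀ hα0
        linear_combination e7 - c 6 * β * h30
      refine ⟨?_, h3'⟩
      apply mul_right_cancel₀ hα0
      linear_combination -e4 + c 1 * α * h30 + 2 * β * h3'
  have hc0 : c 0 ≠ 0 := by simpa [evalAt] using hc ![1, 0, 0] (by simp)
  obtain ⟨t, ht⟩ := exists_pow_three_eq h30 (-(c 6) / c 0)
  refine hc ![t, 1, 0] (by simp) ?_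
  simp [evalAt, h13.1, h13.2, ht]
  field_simp
  ring

/-- The form on the line `z = 0` has three roots, conjugate over a cubic extension, and they are
permuted by every substitution that preserves the form and the line. -/
theorem exists_mulVec_linePoint {E : Type*} [Field E] [Algebra K E]
    {θ : E} (hθ : evalAt (algebraMap K E ∘ c) (linePoint θ) = 0)
    (hind : ∀ a b d : K, algebraMap K E a + algebraMap K E b * θ + algebraMap K E d * θ ^ 2 = 0 →
        a = 0 ∧ b = 0 ∧ d = 0)
    (hconj : ∀ θ' : E, evalAt (algebraMap K E ∘ c) (linePoint θ') = 0 → ∃ σ : Gal(E/K), σ θ = θ')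
    {g : GL (Fin 3) K} (hg : g ∈ substStabilizer c) {a : K}
    (hline : ![0, 0, 1] ᵥ* g.1 = a • ![0, 0, 1]) :
    ∃ (σ : Gal(E/K)) (μ : E), μ ≠ 0 ∧
      g.1.map (algebraMap K E) *ᵥ linePoint θ = μ • linePoint (σ θ) := by
  have h20 : g.1 2 0 = 0 := by
    simpa [vecMul, dotProduct, Fin.sum_univ_three] using congrFun hline 0
  have h21 : g.1 2 1 = 0 := by
    simpa [vecMul, dotProduct, Fin.sum_univ_three] using congrFun hline 1
  have hv : g.1.map (algebraMap K E) *ᵥ linePoint θ =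
      ![algebraMap K E (g.1 0 0) * θ + algebraMap K E (g.1 0 1),
        algebraMap K E (g.1 1 0) * θ + algebraMap K E (g.1 1 1), 0] := by
    ext i
    fin_cases i <;> simp [linePoint, mulVec, dotProduct, Fin.sum_univ_three, h20, h21]
  have hz : evalAt (algebraMap K E ∘ c) (g.1.map (algebraMap K E) *ᵥ linePoint θ) = 0 := by
    rw [← evalAt_subst, subst_map, mem_substStabilizer.1 hg, hθ]
  have hdet : g.1.det ≠ 0 := (Matrix.isUnit_iff_isUnit_det _).1 g.isUnit |>.ne_zero
  set μ := algebraMap K E (g.1 1 0) * θ + algebraMap K E (g.1 1 1) with hμ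
  have hμ0 : μ ≠ 0 := by
    intro h0
    obtain ⟨h11, h10, -⟩ := hind (g.1 1 1) (g.1 1 0) 0 (by rw [map_zero]; linear_combination h0)
    apply hdet
    rw [Matrix.det_fin_three, h20, h21, h11, h10]
    ring
  set θ' := (algebraMap K E (g.1 0 0) * θ + algebraMap K E (g.1 0 1)) / μ with hθ'
  have hv' : g.1.map (algebraMap K E) *ᵥ linePoint θ = μ • linePoint θ' := by
    rw [hv]
    ext i
    fin_cases i
    · simp [linePoint, hθ']; field_simp
    · simp [linePoint]
    · simp [linePoint]
  rw [hv', evalAt_smul] at hz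
  obtain ⟨σ, hσ⟩ := hconj θ' ((mul_eq_zero.1 hz).resolve_left (pow_ne_zero 3 hμ0))
  exact ⟨σ, μ, hμ0, by rw [hv', hσ]⟩

theorem isPlaneScalar_of_mulVec_linePoint {E : Type*} [Field E] [Algebra K E] {θ : E}
    (hind : ∀ a b d : K, algebraMap K E a + algebraMap K E b * θ + algebraMap K E d * θ ^ 2 = 0 →
        a = 0 ∧ b = 0 ∧ d = 0)
    {g : GL (Fin 3) K} {a : K} (hline : ![0, 0, 1] ᵥ* g.1 = a • ![0, 0, 1]) {ν : E}
    (h : g.1.map (algebraMap K E) *ᵥ linePoint θ = ν • linePoint θ) :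
    IsPlaneScalar g (g.1 0 0) a := by
  have h20 : g.1 2 0 = 0 := by
    simpa [vecMul, dotProduct, Fin.sum_univ_three] using congrFun hline 0
  have h21 : g.1 2 1 = 0 := by
    simpa [vecMul, dotProduct, Fin.sum_univ_three] using congrFun hline 1
  have e0 := congrFun h 0
  have e1 := congrFun h 1
  simp [linePoint, mulVec, dotProduct, Fin.sum_univ_three] at e0 e1
  obtain ⟨k0, k1, k2⟩ := hind (g.1 0 1) (g.1 0 0 - g.1 1 1) (-g.1 1 0) (by
    simp only [map_sub, map_neg]
    linear_combination e0 - θ * e1)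
  have h11 : g.1 1 1 = g.1 0 0 := (sub_eq_zero.1 k1).symm
  have h10 : g.1 1 0 = 0 := by simpa using k2
  refine ⟨?_, ?_, hline⟩ <;> ext i <;> fin_cases i <;>
    simp [mulVec, dotProduct, Fin.sum_univ_three, k0, h11, h10, h20, h21]

end LineStabilizer

section LineStabilizer

open Matrix

variable {K : Type} [Field K] {c : Fin 10 → K}

theorem Anisotropic.line (hc : Anisotropic c) (x y : K) (h : x ≠ 0 ∨ y ≠ 0) :
    evalAt c ![x, y, 0] ≠ 0 := by
  refine hc _ fun h0 ↦ ?_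
  have h1 := congrFun h0 0
  have h2 := congrFun h0 1
  simp at h1 h2
  tauto

theorem map_mulVec_linePoint {E : Type*} [Field E] [Algebra K E] (σ : Gal(E/K))
    (g : Matrix (Fin 3) (Fin 3) K) (θ : E) :
    σ ∘ (g.map (algebraMap K E) *ᵥ linePoint θ) = g.map (algebraMap K E) *ᵥ linePoint (σ θ) := by
  ext i
  simp [mulVec, dotProduct, Fin.sum_univ_three, linePoint]

theorem comp_smul_linePoint {E : Type*} [Field E] [Algebra K E] (σ : Gal(E/K)) (μ θ : E) :
    σ ∘ (μ • linePoint θ) = σ μ • linePoint (σ θ) := by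
  ext i
  fin_cases i <;> simp [linePoint]

/-- A substitution preserving an anisotropic cubic form and the line `z = 0` permutes the three
points of the form on that line cyclically, so that its cube is a scalar on the plane `z = 0`. -/
theorem pow_nine_eq_one [Finite K] (hc : Anisotropic c) {g : GL (Fin 3) K}
    (hg : g ∈ substStabilizer c) {a : K} (hline : ![0, 0, 1] ᵥ* g.1 = a • ![0, 0, 1]) :
    g ^ 9 = 1 := by
  obtain ⟨E, _, _, _, _, θ, hcard, hθ, hind, hconj⟩ := exists_cubic_root hc.line
  obtain ⟨σ, μ, hμ, hv⟩ := exists_mulVec_linePoint hθ hind hconj hg hline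
  have hv1 : g.1.map (algebraMap K E) *ᵥ linePoint (σ θ) = σ μ • linePoint (σ (σ θ)) := by
    rw [← map_mulVec_linePoint, hv, comp_smul_linePoint]
  have hv2 : g.1.map (algebraMap K E) *ᵥ linePoint (σ (σ θ)) =
      σ (σ μ) • linePoint (σ (σ (σ θ))) := by
    rw [← map_mulVec_linePoint, hv1, comp_smul_linePoint]
  have hσ : σ (σ (σ θ)) = θ := by
    have : σ ^ 3 = 1 := by rw [← hcard]; exact pow_card_eq_one'
    calc σ (σ (σ θ)) = (σ ^ 3) θ := rfl
      _ = θ := by rw [this]; rfl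
  have h3 : (g ^ 3).1.map (algebraMap K E) *ᵥ linePoint θ = (μ * σ μ * σ (σ μ)) • linePoint θ := by
    have : (g ^ 3).1.map (algebraMap K E) = g.1.map (algebraMap K E) *
        (g.1.map (algebraMap K E) * g.1.map (algebraMap K E)) := by
      rw [← Matrix.map_mul, ← Matrix.map_mul, pow_succ', pow_two]
      rfl
    rw [this, ← mulVec_mulVec, ← mulVec_mulVec, hv, mulVec_smul, mulVec_smul, hv1, mulVec_smul, hv2,
      hσ, smul_smul, smul_smul]
  have hrow : ![0, 0, 1] ᵥ* (g ^ 3).1 = a ^ 3 • ![0, 0, 1] := by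
    have : (g ^ 3).1 = g.1 * g.1 * g.1 := by rw [pow_succ, pow_two]; rfl
    rw [this, ← vecMul_vecMul, ← vecMul_vecMul, hline, smul_vecMul, hline, smul_vecMul,
      smul_vecMul, hline, smul_smul, smul_smul]
    congr 1
    ring
  have hps := isPlaneScalar_of_mulVec_linePoint hind hrow h3
  have hmem : g ^ 3 ∈ substStabilizer c := pow_mem hg 3
  obtain ⟨hd, hγ⟩ := hps.pow_three hc hmem
  have hps3 := (hps.mul hps).mul hps
  rw [← pow_two, ← pow_succ, ← pow_two, ← pow_succ, hd, ← pow_two, ← pow_succ, hγ, ← pow_mul]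
    at hps3
  exact hps3.eq_one hc (pow_mem hg 9)

theorem IsPlaneScalar.eq_entry {g : GL (Fin 3) K} {d γ : K} (h : IsPlaneScalar g d γ) :
    d = g.1 0 0 ∧ γ = g.1 2 2 := by
  have := isPlaneScalar_iff.1 h
  generalize g.1 0 2 = α at this
  generalize g.1 1 2 = β at this
  rw [this]
  simp

theorem IsPlaneScalar.ext [Finite K] (hc : Anisotropic c) {g h : GL (Fin 3) K}
    (hg : g ∈ substStabilizer c) (hh : h ∈ substStabilizer c) {d γ : K}
    (hgs : IsPlaneScalar g d γ) (hhs : IsPlaneScalar h d γ) : g = h := by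
  obtain ⟨hd, hγ⟩ := hgs.pow_three hc hg
  have hd0 : d ≠ 0 := by rintro rfl; simp at hd
  have hγ0 : γ ≠ 0 := by rintro rfl; simp at hγ
  have h1 := (hgs.inv hd0 hγ0).mul hhs
  rw [inv_mul_cancel₀ hd0, inv_mul_cancel₀ hγ0] at h1
  exact inv_mul_eq_one.1 (h1.eq_one hc (mul_mem (inv_mem hg) hh))

/-- The stabilizer of a line in the group preserving an anisotropic cubic form: there are at most
three actions on the zeros on that line, and each is realized by at most nine substitutions. -/
theorem natCard_lineStabilizer_le [Finite K] (hc : Anisotropic c) :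
    Nat.card {g : GL (Fin 3) K // g ∈ substStabilizer c ∧
      ∃ a : K, ![0, 0, 1] ᵥ* g.1 = a • ![0, 0, 1]} ≤ 27 := by
  classical
  have : Fintype (GL (Fin 3) K) := Fintype.ofFinite _
  obtain ⟨E, _, _, _, _, θ, hcard, hθ, hind, hconj⟩ := exists_cubic_root hc.line
  have : Fintype Gal(E/K) := Fintype.ofFinite _
  have hex (g : {g : GL (Fin 3) K // g ∈ substStabilizer c ∧
      ∃ a : K, ![0, 0, 1] ᵥ* g.1 = a • ![0, 0, 1]}) : ∃ (σ : Gal(E/K)) (μ : E), μ ≠ 0 ∧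
      g.1.1.map (algebraMap K E) *ᵥ linePoint θ = μ • linePoint (σ θ) := by
    obtain ⟨g, hg, a, ha⟩ := g
    exact exists_mulVec_linePoint hθ hind hconj hg ha
  choose s μ hμ hs using hex
  have : Fintype {g : GL (Fin 3) K // g ∈ substStabilizer c ∧
      ∃ a : K, ![0, 0, 1] ᵥ* g.1 = a • ![0, 0, 1]} := Fintype.ofFinite _
  have hroots : (Polynomial.nthRootsFinset 3 (1 : K)).card ≤ 3 := by
    rw [Polynomial.nthRootsFinset_def]
    exact (Multiset.toFinset_card_le _).trans (Polynomial.card_nthRoots 3 1)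
  have hfib := Finset.card_le_mul_card_image (f := s) Finset.univ 9 (by
    intro σ hσ
    obtain ⟨⟨g₀, hg₀, a₀, ha₀⟩, -, hg₀σ⟩ := Finset.mem_image.1 hσ
    -- on a fibre, `g₀⁻¹ g` is a scalar on the plane `z = 0`, hence given by two cube roots of one
    have hps (g : {g : GL (Fin 3) K // g ∈ substStabilizer c ∧
        ∃ a : K, ![0, 0, 1] ᵥ* g.1 = a • ![0, 0, 1]}) (hgσ : s g = σ) :
        IsPlaneScalar (g₀⁻¹ * g.1) ((g₀⁻¹ * g.1).1 0 0) ((g₀⁻¹ * g.1).1 2 2) := by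
      have h1 := hs g
      have h2 := hs ⟨g₀, hg₀, a₀, ha₀⟩
      have hμ0 := hμ ⟨g₀, hg₀, a₀, ha₀⟩
      rw [hgσ] at h1
      rw [hg₀σ] at h2
      obtain ⟨g, hg, a, ha⟩ := g
      generalize μ ⟨g₀, hg₀, a₀, ha₀⟩ = μ₀ at *
      generalize μ ⟨g, hg, a, ha⟩ = ν at *
      have ha0 : a₀ ≠ 0 := by
        rintro rfl
        have h4 := congrArg (· ᵥ* g₀⁻¹.1) ha₀
        simp at h4
      have hrow : ![0, 0, 1] ᵥ* (g₀⁻¹ * g).1 = (a₀⁻¹ * a) • ![0, 0, 1] := by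
        have h4 : ![0, 0, 1] ᵥ* g₀⁻¹.1 = a₀⁻¹ • ![0, 0, 1] := by
          have h3 : ![(0 : K), 0, 1] = a₀⁻¹ • (![0, 0, 1] ᵥ* g₀.1) := by
            rw [ha₀, smul_smul, inv_mul_cancel₀ ha0, one_smul]
          conv_lhs => rw [h3]
          rw [smul_vecMul, vecMul_vecMul, Units.mul_inv, vecMul_one]
        rw [Units.val_mul, ← vecMul_vecMul, h4, smul_vecMul, ha, smul_smul]
      have hv : (g₀⁻¹ * g).1.map (algebraMap K E) *ᵥ linePoint θ = (ν * μ₀⁻¹) • linePoint θ := by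
        have h5 : linePoint (σ θ) = μ₀⁻¹ • (g₀.1.map (algebraMap K E) *ᵥ linePoint θ) := by
          rw [h2, smul_smul, inv_mul_cancel₀ hμ0, one_smul]
        rw [Units.val_mul, Matrix.map_mul, ← mulVec_mulVec, h1, h5, mulVec_smul, mulVec_smul,
          mulVec_mulVec, ← Matrix.map_mul, Units.inv_mul, Matrix.map_one _ (map_zero _) (map_one _),
          one_mulVec, smul_smul]
      have h6 := isPlaneScalar_of_mulVec_linePoint hind hrow hv
      have h7 := h6.eq_entry.2
      rwa [h7] at h6
    have hmem (g : {g : GL (Fin 3) K // g ∈ substStabilizer c ∧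
        ∃ a : K, ![0, 0, 1] ᵥ* g.1 = a • ![0, 0, 1]}) : g₀⁻¹ * g.1 ∈ substStabilizer c :=
      mul_mem (inv_mem hg₀) g.2.1
    calc _ ≤ (Polynomial.nthRootsFinset 3 (1 : K) ×ˢ Polynomial.nthRootsFinset 3 (1 : K)).card := by
          refine Finset.card_le_card_of_injOn
            (fun g ↦ ((g₀⁻¹ * g.1).1 0 0, (g₀⁻¹ * g.1).1 2 2)) ?_ ?_
          · intro g hg
            have hgσ : s g = σ := by simpa using hg
            obtain ⟨h1, h2⟩ := (hps g hgσ).pow_three hc (hmem g)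
            simp only [Finset.coe_product, Set.mem_prod, Finset.mem_coe]
            exact ⟨(Polynomial.mem_nthRootsFinset (by norm_num) _).2 h1,
              (Polynomial.mem_nthRootsFinset (by norm_num) _).2 h2⟩
          · intro g hg h hh hgh
            have hgσ : s g = σ := by simpa using hg
            have hhσ : s h = σ := by simpa using hh
            simp only [Prod.mk.injEq] at hgh
            have h1 := hps g hgσ
            rw [hgh.1, hgh.2] at h1
            exact Subtype.ext (mul_left_cancel (h1.ext hc (hmem g) (hmem h) (hps h hhσ)))
      _ ≤ 9 := by
          rw [Finset.card_product]
          nlinarith)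
  have himg : (Finset.univ.image s).card ≤ 3 := by
    refine (Finset.card_le_univ _).trans ?_
    rw [← Nat.card_eq_fintype_card, hcard]
  rw [Nat.card_eq_fintype_card, ← Finset.card_univ]
  omega

end LineStabilizer

/-! ### The group of substitutions preserving an anisotropic form -/

section Transitivity

open Matrix

variable {K : Type*} [Field K]

/-- The general linear group is transitive on nonzero vectors. -/
theorem exists_mulVec_eq {v : Fin 3 → K} (hv : v ≠ 0) :
    ∃ g : GL (Fin 3) K, g.1 *ᵥ ![0, 0, 1] = v := by
  by_cases h2 : v 2 = 0
  · by_cases h1 : v 1 = 0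
    · have h0 : v 0 ≠ 0 := by
        intro h0
        exact hv (by ext i; fin_cases i <;> assumption)
      refine ⟨GeneralLinearGroup.mkOfDetNeZero !![0, 0, v 0; 1, 0, 0; 0, 1, 0]
        (by simpa [det_fin_three] using h0), ?_⟩
      ext i
      fin_cases i <;> simp [GeneralLinearGroup.mkOfDetNeZero, h1, h2]
    · refine ⟨GeneralLinearGroup.mkOfDetNeZero !![1, 0, v 0; 0, 0, v 1; 0, 1, 0]
        (by simpa [det_fin_three] using h1), ?_⟩
      ext i
      fin_cases i <;> simp [GeneralLinearGroup.mkOfDetNeZero, h2]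
  · refine ⟨GeneralLinearGroup.mkOfDetNeZero !![1, 0, v 0; 0, 1, v 1; 0, 0, v 2]
      (by simpa [det_fin_three] using h2), ?_⟩
    ext i
    fin_cases i <;> simp [GeneralLinearGroup.mkOfDetNeZero]

theorem exists_vecMul_eq {l : Fin 3 → K} (hl : l ≠ 0) :
    ∃ g : GL (Fin 3) K, l ᵥ* g.1 = ![0, 0, 1] := by
  obtain ⟨g, hg⟩ := exists_mulVec_eq hl
  have hu : IsUnit g.1ᵀ := (Matrix.isUnit_transpose _).2 g.isUnit
  obtain ⟨h, hh⟩ := hu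
  refine ⟨h⁻¹, ?_⟩
  rw [← hg, ← vecMul_transpose, ← hh, vecMul_vecMul, Units.mul_inv, vecMul_one]

end Transitivity

section LineAction

open Matrix
open scoped LinearAlgebra.Projectivization

variable {K : Type} [Field K] {c : Fin 10 → K}

theorem Anisotropic.subst (hc : Anisotropic c) (g : GL (Fin 3) K) :
    Anisotropic (subst g.1 c) := by
  intro x hx
  rw [evalAt_subst]
  refine hc _ fun h ↦ hx ?_
  have := congrArg (g⁻¹.1 *ᵥ ·) h
  simpa using this

theorem conj_mem {B g : GL (Fin 3) K} (hg : g ∈ substStabilizer c) :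
    B⁻¹ * g * B ∈ substStabilizer (subst B.1 c) := by
  rw [mem_substStabilizer, ← subst_mul]
  have : B.1 * (B⁻¹ * g * B).1 = g.1 * B.1 := by
    rw [← Units.val_mul, ← Units.val_mul, mul_assoc, mul_inv_cancel_left]
  rw [this, subst_mul, mem_substStabilizer.1 hg]

theorem conj_vecMul {B g : GL (Fin 3) K} {l : Fin 3 → K} (hB : l ᵥ* B.1 = ![0, 0, 1]) {a : K}
    (hl : l ᵥ* g.1 = a • l) : ![0, 0, 1] ᵥ* (B⁻¹ * g * B).1 = a • ![0, 0, 1] := by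
  rw [Units.val_mul, Units.val_mul, ← vecMul_vecMul, ← vecMul_vecMul]
  have : ![0, 0, 1] ᵥ* B⁻¹.1 = l := by
    rw [← hB, vecMul_vecMul, Units.mul_inv, vecMul_one]
  rw [this, hl, smul_vecMul, hB]

theorem pow_nine_eq_one_of_vecMul [Finite K] (hc : Anisotropic c) {g : GL (Fin 3) K}
    (hg : g ∈ substStabilizer c) {l : Fin 3 → K} (hl0 : l ≠ 0) {a : K} (hl : l ᵥ* g.1 = a • l) :
    g ^ 9 = 1 := by
  obtain ⟨B, hB⟩ := exists_vecMul_eq hl0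
  have := pow_nine_eq_one (hc.subst B) (conj_mem (B := B) hg) (conj_vecMul hB hl)
  have h2 : (B⁻¹ * g * B) ^ 9 = B⁻¹ * g ^ 9 * B := by
    simpa using conj_pow (i := 9) (a := B⁻¹) (b := g)
  rw [h2] at this
  have h3 := congrArg (fun h ↦ B * h * B⁻¹) this
  simpa [mul_assoc] using h3

theorem vecMul_ne_zero (g : GL (Fin 3) K) {v : Fin 3 → K} (hv : v ≠ 0) : v ᵥ* g.1 ≠ 0 := by
  intro h
  apply hv
  have := congrArg (· ᵥ* g⁻¹.1) h
  simpa using this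

theorem vecMulLinear_injective (g : GL (Fin 3) K) : Function.Injective g.1.vecMulLinear := by
  rw [injective_iff_map_eq_zero]
  intro v hv
  by_contra hne
  exact vecMul_ne_zero g hne hv

/-- The image of a line under an invertible matrix, a line being given by the coefficients of an
equation. -/
def lineMap (g : GL (Fin 3) K) (P : ℙ K (Fin 3 → K)) : ℙ K (Fin 3 → K) :=
  P.map g⁻¹.1.vecMulLinear (vecMulLinear_injective g⁻¹)

theorem lineMap_mk (g : GL (Fin 3) K) {v : Fin 3 → K} (hv : v ≠ 0) :
    lineMap g (Projectivization.mk K v hv) =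
      Projectivization.mk K (v ᵥ* g⁻¹.1) (vecMul_ne_zero g⁻¹ hv) :=
  rfl

/-- The action of the general linear group on the lines of the projective plane. -/
abbrev lineAction : MulAction (GL (Fin 3) K) (ℙ K (Fin 3 → K)) where
  smul := lineMap
  one_smul P := by
    induction P using Projectivization.ind with
    | h v hv =>
      change lineMap 1 _ = _
      rw [lineMap_mk]
      congr 1
      simp
  mul_smul g h P := by
    induction P using Projectivization.ind with
    | h v hv =>
      change lineMap _ _ = lineMap _ (lineMap _ _)
      rw [lineMap_mk, lineMap_mk, lineMap_mk]
      congr 1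
      simp

/-- In an action of a finite `3`-group on a set whose size is not divisible by `9`, some point has a
stabilizer of index at most `3`. -/
theorem exists_card_le_three_mul {G X : Type*} [Group G] [Finite G] [Finite X] [MulAction G X]
    (hG : IsPGroup 3 G) (hX : ¬ 9 ∣ Nat.card X) :
    ∃ x : X, Nat.card G ≤ 3 * Nat.card (MulAction.stabilizer G x) := by
  classical
  have : Fintype X := Fintype.ofFinite X
  by_contra! hlt
  apply hX
  rw [Nat.card_congr (MulAction.selfEquivSigmaOrbits G X), Nat.card_sigma]
  refine Finset.dvd_sum fun ω _ ↦ ?_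
  obtain ⟨n, hn⟩ := IsPGroup.iff_card.1 hG
  have horb : Nat.card (MulAction.orbit G ω.out) * Nat.card (MulAction.stabilizer G ω.out) =
      Nat.card G := by
    rw [← Nat.card_prod]
    exact Nat.card_congr (MulAction.orbitProdStabilizerEquivGroup G ω.out)
  obtain ⟨k, -, hk⟩ := (Nat.dvd_prime_pow Nat.prime_three).1
    (hn ▸ Dvd.intro _ horb : Nat.card (MulAction.orbit G ω.out) ∣ 3 ^ n)
  have h1 := hlt ω.out
  rw [← horb] at h1
  have h2 : 3 < Nat.card (MulAction.orbit G ω.out) := lt_of_mul_lt_mul_right h1 (Nat.zero_le _)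
  rw [hk] at h2 ⊢
  have h3 : 2 ≤ k := by
    by_contra! hlt
    interval_cases k <;> simp at h2
  exact pow_dvd_pow 3 h3

theorem not_nine_dvd (q : ℕ) : ¬ 9 ∣ q ^ 2 + q + 1 := by
  intro h
  have h1 : (q ^ 2 + q + 1) % 9 = 0 := Nat.mod_eq_zero_of_dvd h
  have h2 : q % 9 < 9 := Nat.mod_lt _ (by norm_num)
  rw [Nat.add_mod, Nat.add_mod (q ^ 2), Nat.pow_mod] at h1
  interval_cases q % 9 <;> simp at h1

/-- If the group of substitutions preserving an anisotropic cubic form is a `3`-group then, the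
number of lines not being divisible by `9`, some line has at most three images. -/
theorem natCard_substStabilizer_le [Finite K] (hc : Anisotropic c)
    (hH : IsPGroup 3 (substStabilizer c)) : Nat.card (substStabilizer c) ≤ 81 := by
  let act : MulAction (GL (Fin 3) K) (ℙ K (Fin 3 → K)) := lineAction
  obtain ⟨P, hP⟩ := exists_card_le_three_mul (X := ℙ K (Fin 3 → K)) hH
    (by rw [natCard_projectivePlane]; exact not_nine_dvd _)
  obtain ⟨B, hB⟩ := exists_vecMul_eq P.rep_nonzero
  have hstab (g : MulAction.stabilizer (substStabilizer c) P) :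
      ∃ a : K, P.rep ᵥ* g.1.1.1 = a • P.rep := by
    have h1 : g.1.1⁻¹ • P = P := by
      rw [inv_smul_eq_iff]
      exact (MulAction.mem_stabilizer_iff.1 g.2).symm
    have h2 : lineMap g.1.1⁻¹ (Projectivization.mk K P.rep P.rep_nonzero) =
        Projectivization.mk K P.rep P.rep_nonzero := by
      rw [P.mk_rep]
      exact h1
    rw [lineMap_mk, Projectivization.mk_eq_mk_iff'] at h2
    obtain ⟨a, ha⟩ := h2
    exact ⟨a, by simpa using ha.symm⟩
  have hle : Nat.card (MulAction.stabilizer (substStabilizer c) P) ≤ 27 := by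
    refine le_trans ?_ (natCard_lineStabilizer_le (hc.subst B))
    refine Nat.card_le_card_of_injective (fun g ↦ ⟨B⁻¹ * g.1.1 * B, conj_mem g.1.2, ?_⟩) ?_
    · obtain ⟨a, ha⟩ := hstab g
      exact ⟨a, conj_vecMul hB ha⟩
    · intro g h hgh
      have h1 : B⁻¹ * g.1.1 * B = B⁻¹ * h.1.1 * B := congrArg Subtype.val hgh
      exact Subtype.ext (Subtype.ext (mul_left_cancel (mul_right_cancel h1)))
  omega

/-- For a large finite field, the group of substitutions preserving an anisotropic cubic form is not
a `3`-group: its orbit would be too large for the number of anisotropic forms. -/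
theorem Anisotropic.not_isPGroup [Finite K] (hK : 1000 ≤ Nat.card K) (hc : Anisotropic c) :
    ¬ IsPGroup 3 (substStabilizer c) := by
  classical
  intro hH
  have h81 := natCard_substStabilizer_le hc hH
  have : Fintype K := Fintype.ofFinite K
  have : Fintype (GL (Fin 3) K) := Fintype.ofFinite _
  have : Fintype {c : Fin 10 → K // Anisotropic c} := Fintype.ofFinite _
  have hA := card_anisotropic_mul_le (K := K)
  have horb := Finset.card_le_mul_card_image
    (f := fun g : GL (Fin 3) K ↦ (⟨TernaryCubic.subst g.1 c, hc.subst g⟩ :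
      {c : Fin 10 → K // Anisotropic c})) Finset.univ 81 (by
    intro d hd
    obtain ⟨g₀, -, rfl⟩ := Finset.mem_image.1 hd
    refine le_trans ?_ h81
    rw [← Fintype.card_subtype, ← Nat.card_eq_fintype_card]
    refine Nat.card_le_card_of_injective (fun g ↦ ⟨g.1 * g₀⁻¹, ?_⟩) ?_
    · rw [mem_substStabilizer, Units.val_mul, subst_mul]
      have h1 := congrArg Subtype.val g.2
      simp only at h1
      rw [h1, ← subst_mul, Units.mul_inv, subst_one]
    · intro g h hgh
      exact Subtype.ext (mul_right_cancel (congrArg Subtype.val hgh)))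
  have h1 : Fintype.card (GL (Fin 3) K) ≤ 81 * Nat.card {c : Fin 10 → K // Anisotropic c} := by
    rw [Nat.card_eq_fintype_card]
    exact horb.trans (Nat.mul_le_mul_left _ (Finset.card_le_univ _))
  rw [← Nat.card_eq_fintype_card, Matrix.card_GL_field, Fin.prod_univ_three] at h1
  rw [Nat.card_eq_fintype_card] at hK
  generalize Nat.card {c : Fin 10 → K // Anisotropic c} = N at *
  generalize Fintype.card K = q at *
  obtain ⟨t, rfl⟩ : ∃ t, q = t + 1 := ⟨q - 1, by omega⟩
  have ht : 999 ≤ t := by omega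
  have e0 : (t + 1) ^ 2 * t ≤ (t + 1) ^ 3 - (t + 1) ^ ((0 : Fin 3) : ℕ) := by
    simp
    refine Nat.le_sub_of_add_le ?_
    nlinarith
  have e1 : (t + 1) ^ 2 * t ≤ (t + 1) ^ 3 - (t + 1) ^ ((1 : Fin 3) : ℕ) := by
    simp
    refine Nat.le_sub_of_add_le ?_
    nlinarith
  have e2 : (t + 1) ^ 2 * t ≤ (t + 1) ^ 3 - (t + 1) ^ ((2 : Fin 3) : ℕ) := by
    simp
    refine Nat.le_sub_of_add_le ?_
    nlinarith
  have h2 := (Nat.mul_le_mul (Nat.mul_le_mul e0 e1) e2).trans h1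
  have h3 : ((t + 1) ^ 2 * t) ^ 3 * (t + 1) ^ 4 ≤ 324 * (t + 1) ^ 12 := by
    calc ((t + 1) ^ 2 * t) ^ 3 * (t + 1) ^ 4
        = (t + 1) ^ 2 * t * ((t + 1) ^ 2 * t) * ((t + 1) ^ 2 * t) * (t + 1) ^ 4 := by ring
      _ ≤ 81 * N * (t + 1) ^ 4 := Nat.mul_le_mul_right _ h2
      _ ≤ 81 * N * (t + 1 + 1) ^ 4 := Nat.mul_le_mul_left _ (Nat.pow_le_pow_left (by omega) 4)
      _ ≤ 81 * (4 * (t + 1) ^ 12) := by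
          rw [mul_assoc]
          exact Nat.mul_le_mul_left _ hA
      _ = _ := by ring
  have h4 : (t + 1) ^ 10 * t ^ 3 ≤ (t + 1) ^ 10 * (324 * (t + 1) ^ 2) := by
    calc (t + 1) ^ 10 * t ^ 3 = ((t + 1) ^ 2 * t) ^ 3 * (t + 1) ^ 4 := by ring
      _ ≤ _ := h3
      _ = _ := by ring
  have h5 : t ^ 3 ≤ 324 * (t + 1) ^ 2 := Nat.le_of_mul_le_mul_left h4 (by positivity)
  nlinarith

end LineAction

/-! ### Anisotropic forms over a finite field are products of linear forms -/

section Splitting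

open Matrix

theorem subst_diagonal {R : Type*} [CommRing R] (a b d : R) (c : Fin 10 → R) :
    subst (diagonal ![a, b, d]) c =
      ![a ^ 3 * c 0, a ^ 2 * b * c 1, a ^ 2 * d * c 2, a * b ^ 2 * c 3, a * b * d * c 4,
        a * d ^ 2 * c 5, b ^ 3 * c 6, b ^ 2 * d * c 7, b * d ^ 2 * c 8, d ^ 3 * c 9] := by
  ext i
  fin_cases i <;> simp [subst, evalAt, dirDeriv, polar, diagonal] <;> ring

theorem subst_of_only_middle {R : Type*} [CommRing R] (W : Matrix (Fin 3) (Fin 3) R) (k : R) :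
    subst W ![0, 0, 0, 0, k, 0, 0, 0, 0, 0] = prodLinear (k • W.row 0) (W.row 1) (W.row 2) := by
  ext i
  fin_cases i <;> simp [subst, evalAt, dirDeriv, polar, prodLinear, Matrix.row] <;> ring

/-- A cubic form fixed by a diagonal substitution for which none of the monomials other than `XYZ`
is invariant is a multiple of `XYZ`. -/
theorem eq_middle_of_subst_diagonal {E : Type*} [Field E] {a b d : E} {c : Fin 10 → E}
    (hfix : subst (diagonal ![a, b, d]) c = c) (ha : a ^ 3 ≠ 1) (hb : b ^ 3 ≠ 1) (hd : d ^ 3 ≠ 1)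
    (hab : a ^ 2 * b ≠ 1) (had : a ^ 2 * d ≠ 1) (hba : b ^ 2 * a ≠ 1) (hbd : b ^ 2 * d ≠ 1)
    (hda : d ^ 2 * a ≠ 1) (hdb : d ^ 2 * b ≠ 1) : c = ![0, 0, 0, 0, c 4, 0, 0, 0, 0, 0] := by
  have kill {x y : E} (hx : x ≠ 1) (h : x * y = y) : y = 0 := by
    by_contra hy
    exact hx (mul_right_cancel₀ hy (h.trans (one_mul y).symm))
  rw [subst_diagonal] at hfix
  have k0 := kill ha (congrFun hfix 0)
  have k1 := kill hab (congrFun hfix 1)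
  have k2 := kill had (congrFun hfix 2)
  have k3 := kill (mul_comm a _ ▸ hba) (congrFun hfix 3)
  have k5 := kill (mul_comm a _ ▸ hda) (congrFun hfix 5)
  have k6 := kill hb (congrFun hfix 6)
  have k7 := kill hbd (congrFun hfix 7)
  have k8 := kill (mul_comm b _ ▸ hdb) (congrFun hfix 8)
  have k9 := kill hd (congrFun hfix 9)
  ext i
  fin_cases i
  exacts [k0, k1, k2, k3, rfl, k5, k6, k7, k8, k9]

/-- If `a² b = 1` for three numbers permuted cyclically by a field automorphism, then `a⁹ = 1`. -/
theorem pow_nine_eq_one_of_cyclic {E : Type*} [Field E] {a b d : E} (h1 : a ^ 2 * b = 1)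
    (h2 : b ^ 2 * d = 1) (h3 : d ^ 2 * a = 1) : a ^ 9 = 1 := by
  have h4 : b ^ 4 * (a ^ 8 - d ^ 2) = 0 := by
    linear_combination ((a ^ 2 * b) ^ 3 + (a ^ 2 * b) ^ 2 + a ^ 2 * b + 1) * h1 -
      (b ^ 2 * d + 1) * h2
  have hb0 : b ^ 4 ≠ 0 := by
    intro h
    rw [pow_eq_zero_iff (by norm_num)] at h
    simp [h] at h1
  linear_combination a * (mul_eq_zero.1 h4).resolve_left hb0 + h3

/-- Three eigenvectors with distinct eigenvalues form an invertible matrix. -/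
theorem isUnit_of_eigenvectors {E : Type*} [Field E] {G : Matrix (Fin 3) (Fin 3) E} {a b d : E}
    {u v w : Fin 3 → E} (hu : u ᵥ* G = a • u) (hv : v ᵥ* G = b • v) (hw : w ᵥ* G = d • w)
    (hu0 : u ≠ 0) (hv0 : v ≠ 0) (hw0 : w ≠ 0) (hab : b ≠ a) (hbd : d ≠ b) (had : d ≠ a) :
    IsUnit (Matrix.of ![u, v, w]) := by
  rw [← Matrix.linearIndependent_rows_iff_isUnit]
  refine Module.End.eigenvectors_linearIndependent' G.vecMulLinear ![a, b, d] ?_ _ ?_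
  · intro i j hij
    fin_cases i <;> fin_cases j
    exacts [rfl, absurd hij hab.symm, absurd hij had.symm, absurd hij hab, rfl,
      absurd hij hbd.symm, absurd hij had, absurd hij hbd, rfl]
  · intro i
    rw [Module.End.hasEigenvector_iff, Module.End.mem_eigenspace_iff]
    fin_cases i
    exacts [⟨hu, hu0⟩, ⟨hv, hv0⟩, ⟨hw, hw0⟩]

theorem mul_eq_diagonal_mul {E : Type*} [Field E] {G : Matrix (Fin 3) (Fin 3) E} {a b d : E}
    {u v w : Fin 3 → E} (hu : u ᵥ* G = a • u) (hv : v ᵥ* G = b • v) (hw : w ᵥ* G = d • w) :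
    Matrix.of ![u, v, w] * G = diagonal ![a, b, d] * Matrix.of ![u, v, w] := by
  ext i j
  rw [Matrix.diagonal_mul, Matrix.mul_apply]
  fin_cases i
  · simpa [vecMul, dotProduct] using congrFun hu j
  · simpa [vecMul, dotProduct] using congrFun hv j
  · simpa [vecMul, dotProduct] using congrFun hw j

/-- A cubic form preserved by a diagonalizable substitution, for whose eigenvalues no monomial
other than `XYZ` is invariant, splits into linear forms. -/
theorem eq_prodLinear_of_eigenvectors {E : Type*} [Field E] {G : Matrix (Fin 3) (Fin 3) E}
    {a b d : E} {u v w : Fin 3 → E} (hu : u ᵥ* G = a • u) (hv : v ᵥ* G = b • v)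
    (hw : w ᵥ* G = d • w) (hW : IsUnit (Matrix.of ![u, v, w])) {c : Fin 10 → E}
    (hc : subst G c = c) (ha : a ^ 3 ≠ 1) (hb : b ^ 3 ≠ 1) (hd : d ^ 3 ≠ 1)
    (hab : a ^ 2 * b ≠ 1) (had : a ^ 2 * d ≠ 1) (hba : b ^ 2 * a ≠ 1) (hbd : b ^ 2 * d ≠ 1)
    (hda : d ^ 2 * a ≠ 1) (hdb : d ^ 2 * b ≠ 1) : ∃ k : E, c = prodLinear (k • u) v w := by
  have hWG := mul_eq_diagonal_mul hu hv hw
  obtain ⟨W', hW'⟩ := hW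
  have hrow : W'.1.row 0 = u ∧ W'.1.row 1 = v ∧ W'.1.row 2 = w := by
    rw [hW']
    exact ⟨rfl, rfl, rfl⟩
  rw [← hW'] at hWG
  have hcc' : subst W'.1 (subst W'⁻¹.1 c) = c := by
    rw [← subst_mul, Units.inv_mul, subst_one]
  have hfix : subst (diagonal ![a, b, d]) (subst W'⁻¹.1 c) = subst W'⁻¹.1 c := by
    have h1 : W'⁻¹.1 * diagonal ![a, b, d] = G * W'⁻¹.1 := by
      calc W'⁻¹.1 * diagonal ![a, b, d] = W'⁻¹.1 * (diagonal ![a, b, d] * W'.1) * W'⁻¹.1 := by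
            rw [Matrix.mul_assoc, Matrix.mul_assoc, Units.mul_inv, Matrix.mul_one]
        _ = _ := by rw [← hWG, ← Matrix.mul_assoc, Units.inv_mul, Matrix.one_mul]
    rw [← subst_mul, h1, subst_mul, hc]
  have hmid := eq_middle_of_subst_diagonal hfix ha hb hd hab had hba hbd hda hdb
  rw [hmid, subst_of_only_middle, hrow.1, hrow.2.1, hrow.2.2] at hcc'
  exact ⟨_, hcc'.symm⟩

variable {K : Type} [Field K] {c : Fin 10 → K}

/-- An anisotropic cubic form preserved by a substitution of prime order `ℓ ≠ 3` splits into three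
linear forms: the substitution fixes no line, hence has three conjugate eigenvalues, and `XYZ` is
the only monomial in the coordinates given by the eigenvectors that it can preserve. -/
theorem exists_eq_prodLinear_of_orderOf [Finite K] (hc : Anisotropic c) {g : GL (Fin 3) K}
    (hg : g ∈ substStabilizer c) {ℓ : ℕ} (hℓ : ℓ.Prime) (hℓ3 : ℓ ≠ 3) (hord : orderOf g = ℓ) :
    ∃ (E : Type) (_ : Field E) (φ : K →+* E) (l m n : Fin 3 → E), φ ∘ c = prodLinear l m n := by
  have hroot (x : K) : g.1.charpoly.eval x ≠ 0 := by
    intro h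
    rw [Matrix.eval_charpoly] at h
    obtain ⟨v, hv0, hv⟩ := Matrix.exists_vecMul_eq_zero_iff.2 h
    rw [vecMul_sub, sub_eq_zero] at hv
    have h9 := pow_nine_eq_one_of_vecMul hc hg hv0 (a := x) (by rw [← hv]; simp)
    have h1 := orderOf_dvd_of_pow_eq_one h9
    rw [hord, show 9 = 3 ^ 2 by norm_num] at h1
    exact hℓ3 ((Nat.prime_dvd_prime_iff_eq hℓ Nat.prime_three).1 (hℓ.dvd_of_dvd_pow h1))
  obtain ⟨E, _, _, _, _, a, hcard, ha, hind, -⟩ := exists_cubic_extension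
    (P := g.1.charpoly) (by simp) hroot
  set G : Matrix (Fin 3) (Fin 3) E := g.1.map (algebraMap K E) with hG
  obtain ⟨w, hw0, hw⟩ : ∃ w : Fin 3 → E, w ≠ 0 ∧ w ᵥ* G = a • w := by
    have h1 : G.charpoly.eval a = 0 := by
      rw [hG]
      have := Matrix.charpoly_map g.1 (algebraMap K E)
      rw [this, Polynomial.eval_map_algebraMap, ha]
    rw [Matrix.eval_charpoly] at h1
    obtain ⟨v, hv0, hv⟩ := Matrix.exists_vecMul_eq_zero_iff.2 h1
    rw [vecMul_sub, sub_eq_zero] at hv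
    exact ⟨v, hv0, by rw [← hv]; simp⟩
  have hanot (x : K) : algebraMap K E x ≠ a := by
    intro h
    have := (hind x (-1) 0 (by simp [h])).2.1
    simp at this
  obtain ⟨σ, hσ⟩ : ∃ σ : Gal(E/K), σ a ≠ a := by
    by_contra! h
    obtain ⟨x, hx⟩ := IntermediateField.mem_bot.1 ((IsGalois.mem_bot_iff_fixed a).2 h)
    exact hanot x hx
  have hσ3 (x : E) : σ (σ (σ x)) = x := by
    have : σ ^ 3 = 1 := by rw [← hcard]; exact pow_card_eq_one'
    calc σ (σ (σ x)) = (σ ^ 3) x := rfl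
      _ = x := by rw [this]; rfl
  have hmap {v : Fin 3 → E} {μ : E} (h : v ᵥ* G = μ • v) : (σ ∘ v) ᵥ* G = σ μ • (σ ∘ v) := by
    ext i
    have := congrArg σ (congrFun h i)
    simpa [vecMul, dotProduct, Fin.sum_univ_three, hG] using this
  have hne0 {v : Fin 3 → E} (h : v ≠ 0) : σ ∘ v ≠ 0 := by
    intro h0
    apply h
    ext i
    have := congrFun h0 i
    simpa using this
  have hda : σ (σ (σ a)) = a := hσ3 a
  have hbd : σ (σ a) ≠ σ a := fun h ↦ hσ (σ.injective h)
  have had : σ (σ a) ≠ a := fun h ↦ by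
    have := congrArg σ h
    rw [hda] at this
    exact hσ this.symm
  have hgl : G ^ ℓ = 1 := by
    have h1 : g ^ ℓ = 1 := hord ▸ pow_orderOf_eq_one g
    have h2 : g.1 ^ ℓ = 1 := by rw [← Units.val_pow_eq_pow_val, h1, Units.val_one]
    have h3 : G = (algebraMap K E).mapMatrix g.1 := by rw [RingHom.mapMatrix_apply]
    rw [h3, ← map_pow, h2, map_one]
  have hal : a ^ ℓ = 1 := by
    have h1 (n : ℕ) : w ᵥ* G ^ n = a ^ n • w := by
      induction n with
      | zero => simp
      | succ n ih => rw [pow_succ, ← vecMul_vecMul, ih, smul_vecMul, hw, smul_smul, pow_succ]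
    have h2 := h1 ℓ
    rw [hgl, vecMul_one] at h2
    obtain ⟨i, hi⟩ := Function.ne_iff.1 hw0
    have h3 := congrFun h2 i
    exact mul_right_cancel₀ hi (by simpa using h3.symm)
  have ha9 : a ^ 9 ≠ 1 := by
    intro h
    have h1 := pow_gcd_eq_one.2 ⟨h, hal⟩
    have h2 : Nat.gcd 9 ℓ = 1 := by
      have : Nat.Coprime (3 ^ 2) ℓ :=
        Nat.Coprime.pow_left 2 ((Nat.coprime_primes Nat.prime_three hℓ).2 (Ne.symm hℓ3))
      simpa using this
    rw [h2, pow_one] at h1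
    exact hanot 1 (by rw [map_one, h1])
  have ha3 : a ^ 3 ≠ 1 := fun h ↦ ha9 (by rw [show 9 = 3 * 3 by norm_num, pow_mul, h, one_pow])
  have inj3 {x : E} (h : x ^ 3 ≠ 1) : σ x ^ 3 ≠ 1 :=
    fun h' ↦ h (σ.injective (by rw [map_pow, map_one, h']))
  have cyc {x y : E} (h : x ^ 2 * y = 1) : σ x ^ 2 * σ y = 1 := by
    rw [← map_pow, ← map_mul, h, map_one]
  have cyc' {x y : E} (h : x ^ 2 * y ≠ 1) : σ x ^ 2 * σ y ≠ 1 :=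
    fun h' ↦ h (σ.injective (by rw [map_mul, map_pow, h', map_one]))
  have n1 : a ^ 2 * σ a ≠ 1 := fun h1 ↦
    ha9 (pow_nine_eq_one_of_cyclic h1 (cyc h1) (by have := cyc (cyc h1); rwa [hda] at this))
  have n2 : a ^ 2 * σ (σ a) ≠ 1 := fun h1 ↦ by
    have h2 := cyc h1
    rw [hda] at h2
    exact ha9 (pow_nine_eq_one_of_cyclic h1 (cyc h2) h2)
  obtain ⟨k, hk⟩ := eq_prodLinear_of_eigenvectors hw (hmap hw) (hmap (hmap hw))
    (isUnit_of_eigenvectors hw (hmap hw) (hmap (hmap hw)) hw0 (hne0 hw0) (hne0 (hne0 hw0))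
      hσ hbd had) (c := algebraMap K E ∘ c) (by rw [hG, subst_map, mem_substStabilizer.1 hg])
    ha3 (inj3 ha3) (inj3 (inj3 ha3)) n1 n2 (by have := cyc' n2; rwa [hda] at this) (cyc' n1)
    (by have := cyc' (cyc' n1); rwa [hda] at this)
    (by have := cyc' (cyc' n2); rwa [hda] at this)
  exact ⟨E, inferInstance, algebraMap K E, _, _, _, hk⟩

/-- An anisotropic cubic form over a finite field splits into three linear forms over some
extension. -/
theorem Anisotropic.exists_eq_prodLinear [Finite K] (hc : Anisotropic c) :
    ∃ (E : Type) (_ : Field E) (φ : K →+* E) (l m n : Fin 3 → E), φ ∘ c = prodLinear l m n := by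
  obtain ⟨F, _, _, ψ, hF, hcF⟩ := hc.exists_large_extension 1000
  have hnot := hcF.not_isPGroup hF
  obtain ⟨ℓ, hℓ, hdvd, hℓ3⟩ : ∃ ℓ : ℕ, ℓ.Prime ∧
      ℓ ∣ Nat.card (substStabilizer (ψ ∘ c)) ∧ ℓ ≠ 3 := by
    by_contra! h
    apply hnot
    rw [IsPGroup.iff_card]
    exact ⟨_, Nat.eq_prime_pow_of_unique_prime_dvd Nat.card_pos.ne' fun {d} hd hdd ↦ h d hd hdd⟩
  have : Fact ℓ.Prime := ⟨hℓ⟩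
  obtain ⟨g, hg⟩ := exists_prime_orderOf_dvd_card' ℓ hdvd
  obtain ⟨E, _, φ, l, m, n, h⟩ := exists_eq_prodLinear_of_orderOf hcF g.2 hℓ hℓ3
    (by rw [← hg, Subgroup.orderOf_coe])
  exact ⟨E, inferInstance, φ.comp ψ, l, m, n, by rw [← h]; rfl⟩

end Splitting

/-! ### Binary cubic forms and norm forms -/

section BinaryForms

open Matrix

variable {R S : Type*} [CommRing R] [CommRing S]

/-- The value at `(x, y)` of the binary cubic form `n₀ X³ + n₁ X² Y + n₂ X Y² + n₃ Y³`. -/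
def evalBin (n : Fin 4 → R) (x y : R) : R :=
  n 0 * x ^ 3 + n 1 * x ^ 2 * y + n 2 * x * y ^ 2 + n 3 * y ^ 3

/-- A binary cubic form is anisotropic if it has no nontrivial zero. -/
def BinAnisotropic (n : Fin 4 → R) : Prop :=
  ∀ x y, (x ≠ 0 ∨ y ≠ 0) → evalBin n x y ≠ 0

/-- The restriction of a ternary cubic form to the line `z = 0`. -/
def restrictLine (c : Fin 10 → R) : Fin 4 → R := ![c 0, c 1, c 3, c 6]

theorem evalAt_line (c : Fin 10 → R) (x y : R) :
    evalAt c ![x, y, 0] = evalBin (restrictLine c) x y := by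
  simp [evalAt, evalBin, restrictLine]

/-- The norm form `N(u + v θ + w θ²)`, where `θ` is a root of `T³ - e₁ T² + e₂ T - e₃`. -/
def normVec (e₁ e₂ e₃ : R) : Fin 10 → R :=
  ![1, e₁, e₁ ^ 2 - 2 * e₂, e₂, e₁ * e₂ - 3 * e₃, e₂ ^ 2 - 2 * e₁ * e₃, e₃, e₁ * e₃, e₂ * e₃,
    e₃ ^ 2]

theorem normVec_eq_prodLinear (s t r : R) :
    normVec (s + t + r) (s * t + s * r + t * r) (s * t * r) =
      prodLinear ![1, s, s ^ 2] ![1, t, t ^ 2] ![1, r, r ^ 2] := by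
  ext i
  fin_cases i <;> simp [normVec, prodLinear] <;> ring

theorem normVec_map (φ : R →+* S) (e₁ e₂ e₃ : R) :
    φ ∘ normVec e₁ e₂ e₃ = normVec (φ e₁) (φ e₂) (φ e₃) := by
  ext i
  fin_cases i <;> simp [normVec, map_ofNat φ]

/-- The substitution `(u, v, w) = (x + α z, β z - y, γ z)`. -/
def normSubst (α β γ : R) : Matrix (Fin 3) (Fin 3) R := !![1, 0, α; 0, -1, β; 0, 0, γ]

/-- The form `n₀ N(x - θ y + (α + β θ + γ θ²) z)`, where `θ` is a root of
`T³ - e₁ T² + e₂ T - e₃`. -/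
def normForm (n₀ e₁ e₂ e₃ α β γ : R) : Fin 10 → R :=
  n₀ • subst (normSubst α β γ) (normVec e₁ e₂ e₃)

theorem normForm_map (φ : R →+* S) (n₀ e₁ e₂ e₃ α β γ : R) :
    φ ∘ normForm n₀ e₁ e₂ e₃ α β γ =
      normForm (φ n₀) (φ e₁) (φ e₂) (φ e₃) (φ α) (φ β) (φ γ) := by
  have h : (normSubst α β γ).map φ = normSubst (φ α) (φ β) (φ γ) := by
    ext i j
    fin_cases i <;> fin_cases j <;> simp [normSubst]
  rw [normForm, normForm, ← h, ← normVec_map, subst_map]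
  ext i
  simp

theorem restrictLine_normForm (n₀ e₁ e₂ e₃ α β γ : R) :
    restrictLine (normForm n₀ e₁ e₂ e₃ α β γ) = ![n₀, -(n₀ * e₁), n₀ * e₂, -(n₀ * e₃)] := by
  ext i
  fin_cases i <;>
    simp [restrictLine, normForm, subst, normSubst, normVec, evalAt, dirDeriv]
  ring

theorem evalAt_normForm (n₀ e₁ e₂ e₃ α β γ : R) (x : Fin 3 → R) :
    evalAt (normForm n₀ e₁ e₂ e₃ α β γ) x =
      n₀ * evalAt (normVec e₁ e₂ e₃) ![x 0 + α * x 2, β * x 2 - x 1, γ * x 2] := by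
  rw [normForm, evalAt_smul_left, evalAt_subst]
  congr 2
  ext i
  fin_cases i <;> simp [normSubst, Matrix.mulVec, dotProduct, Fin.sum_univ_three]
  ring

/-- The tangent to the form at the point `(θ : 1 : 0)` recovers `α + β θ + γ θ²`. -/
theorem dirDeriv_normForm (n₀ e₁ e₂ e₃ α β γ θ : R)
    (hθ : θ ^ 3 - e₁ * θ ^ 2 + e₂ * θ - e₃ = 0) :
    dirDeriv (normForm n₀ e₁ e₂ e₃ α β γ) (![θ, 1, 0]) ![0, 0, 1] =
      (α + β * θ + γ * θ ^ 2) * dirDeriv (normForm n₀ e₁ e₂ e₃ α β γ) (![θ, 1, 0]) ![1, 0, 0] := by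
  have hsmul (v w : Fin 3 → R) : dirDeriv (normForm n₀ e₁ e₂ e₃ α β γ) v w =
      n₀ * dirDeriv (normVec e₁ e₂ e₃) ((normSubst α β γ).mulVec v)
        ((normSubst α β γ).mulVec w) := by
    rw [← dirDeriv_subst, normForm]
    simp only [dirDeriv, Pi.smul_apply, smul_eq_mul]
    ring
  have hv : (normSubst α β γ).mulVec ![θ, 1, 0] = ![θ, -1, 0] := by
    ext i
    fin_cases i <;> simp [normSubst]
  have hz : (normSubst α β γ).mulVec ![0, 0, 1] = ![α, β, γ] := by
    ext i
    fin_cases i <;> simp [normSubst]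
  have hx : (normSubst α β γ).mulVec ![1, 0, 0] = ![1, 0, 0] := by
    ext i
    fin_cases i <;> simp [normSubst]
  rw [hsmul, hsmul, hv, hz, hx]
  simp [dirDeriv, normVec]
  linear_combination n₀ * (-3 * β - (3 * θ + e₁) * γ) * hθ

theorem subst_prodLinear (g : Matrix (Fin 3) (Fin 3) R) (l m n : Fin 3 → R) :
    subst g (prodLinear l m n) = prodLinear (l ᵥ* g) (m ᵥ* g) (n ᵥ* g) := by
  refine ext_of_evalAt_polynomial fun x ↦ ?_
  have h (l m n : Fin 3 → R) : (Polynomial.C ∘ prodLinear l m n : Fin 10 → Polynomial R) =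
      prodLinear (Polynomial.C ∘ l) (Polynomial.C ∘ m) (Polynomial.C ∘ n) := by
    ext1 i
    fin_cases i <;> simp [prodLinear]
  have h' (l : Fin 3 → R) : (Polynomial.C ∘ (l ᵥ* g) : Fin 3 → Polynomial R) =
      (Polynomial.C ∘ l) ᵥ* (g.map Polynomial.C) := by
    ext1 i
    simp [Matrix.vecMul, dotProduct, Fin.sum_univ_three]
  rw [← subst_map, evalAt_subst, h, h, evalAt_prodLinear, evalAt_prodLinear, h', h', h',
    Matrix.dotProduct_mulVec, Matrix.dotProduct_mulVec, Matrix.dotProduct_mulVec]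

theorem normForm_eq_prodLinear (n₀ s t r α β γ : R) :
    normForm n₀ (s + t + r) (s * t + s * r + t * r) (s * t * r) α β γ =
      n₀ • prodLinear ![1, -s, α + β * s + γ * s ^ 2] ![1, -t, α + β * t + γ * t ^ 2]
        ![1, -r, α + β * r + γ * r ^ 2] := by
  have h (y : R) : ![1, y, y ^ 2] ᵥ* normSubst α β γ = ![1, -y, α + β * y + γ * y ^ 2] := by
    ext i
    fin_cases i <;> simp [normSubst, Matrix.vecMul, dotProduct, Fin.sum_univ_three]
    ring
  rw [normForm, normVec_eq_prodLinear, subst_prodLinear, h, h, h]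

/-- The slope of the tangent to a product of linear forms at one of its zeros on `z = 0`. -/
theorem dirDeriv_smul_prodLinear (n₀ s t r a b d : R) :
    dirDeriv (n₀ • prodLinear ![1, -s, a] ![1, -t, b] ![1, -r, d]) ![s, 1, 0] ![1, 0, 0] =
        n₀ * ((s - t) * (s - r)) ∧
      dirDeriv (n₀ • prodLinear ![1, -s, a] ![1, -t, b] ![1, -r, d]) ![s, 1, 0] ![0, 0, 1] =
        a * (n₀ * ((s - t) * (s - r))) := by
  constructor <;> simp [dirDeriv, prodLinear] <;> ring

theorem prodLinear_swap (l m n : Fin 3 → R) : prodLinear l m n = prodLinear m l n := by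
  ext i
  fin_cases i <;> simp [prodLinear] <;> ring

theorem prodLinear_rotate (l m n : Fin 3 → R) : prodLinear l m n = prodLinear n l m := by
  ext i
  fin_cases i <;> simp [prodLinear] <;> ring

end BinaryForms

section NormForms

open Polynomial

/-- A monic cubic polynomial over an algebraically closed field has three roots. -/
theorem exists_three_roots {F : Type*} [Field F] [IsAlgClosed F] (e₁ e₂ e₃ : F) :
    ∃ s t r : F, e₁ = s + t + r ∧ e₂ = s * t + s * r + t * r ∧ e₃ = s * t * r := by
  obtain ⟨s, hs⟩ := IsAlgClosed.exists_root (X ^ 3 + C (-e₁) * X ^ 2 + C e₂ * X + C (-e₃))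
    (by
      have : (X ^ 3 + C (-e₁) * X ^ 2 + C e₂ * X + C (-e₃)).degree = 3 := by compute_degree!
      rw [this]
      norm_num)
  obtain ⟨t, ht⟩ := IsAlgClosed.exists_root (X ^ 2 + C (s - e₁) * X + C (s ^ 2 - e₁ * s + e₂))
    (by
      have : (X ^ 2 + C (s - e₁) * X + C (s ^ 2 - e₁ * s + e₂)).degree = 2 := by compute_degree!
      rw [this]
      norm_num)
  simp only [IsRoot.def, eval_add, eval_mul, eval_pow, eval_X, eval_C] at hs ht
  refine ⟨s, t, e₁ - s - t, by ring, ?_, ?_⟩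
  · linear_combination ht
  · linear_combination s * ht - hs

variable {K : Type} [Field K]

theorem anisotropic_normForm [Finite K] {n₀ e₁ e₂ e₃ α β γ : K} (hn : n₀ ≠ 0)
    (hroot : ∀ x, x ^ 3 - e₁ * x ^ 2 + e₂ * x - e₃ ≠ 0) (hγ : γ ≠ 0) :
    Anisotropic (normForm n₀ e₁ e₂ e₃ α β γ) := by
  set P : K[X] := X ^ 3 + C (-e₁) * X ^ 2 + C e₂ * X + C (-e₃) with hP
  obtain ⟨E, _, _, _, _, θ, -, -, hind, -, -, hlift⟩ := exists_cubic_extension (P := P)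
    (by rw [hP]; compute_degree!) (by
      intro x
      simpa [hP, sub_eq_add_neg] using hroot x)
  set φ := algebraMap K (AlgebraicClosure K) with hφ
  obtain ⟨s, t, r, h1, h2, h3⟩ := exists_three_roots (φ e₁) (φ e₂) (φ e₃)
  have hfac (y : AlgebraicClosure K) (hy : (y - s) * (y - t) * (y - r) = 0) (u v w : K)
      (h : φ u + φ v * y + φ w * y ^ 2 = 0) : u = 0 ∧ v = 0 ∧ w = 0 := by
    obtain ⟨χ, hχ, hχ'⟩ := hlift _ _ φ y (by
      simp [hP, h1, h2, h3]
      linear_combination hy)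
    refine hind u v w (χ.injective ?_)
    simpa [hχ, hχ'] using h
  intro x hx h0
  rw [evalAt_normForm, mul_eq_zero] at h0
  have h4 := congrArg φ (h0.resolve_left hn)
  rw [← evalAt_map, normVec_map, h1, h2, h3, normVec_eq_prodLinear, evalAt_prodLinear, map_zero]
    at h4
  have h5 : x 0 + α * x 2 = 0 ∧ β * x 2 - x 1 = 0 ∧ γ * x 2 = 0 := by
    rcases mul_eq_zero.1 h4 with h4 | h4
    · rcases mul_eq_zero.1 h4 with h4 | h4
      · refine hfac s (by ring) _ _ _ ?_
        simp [dotProduct, Fin.sum_univ_three] at h4 ⊢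
        linear_combination h4
      · refine hfac t (by ring) _ _ _ ?_
        simp [dotProduct, Fin.sum_univ_three] at h4 ⊢
        linear_combination h4
    · refine hfac r (by ring) _ _ _ ?_
      simp [dotProduct, Fin.sum_univ_three] at h4 ⊢
      linear_combination h4
  have hx2 : x 2 = 0 := (mul_eq_zero.1 h5.2.2).resolve_left hγ
  apply hx
  ext i
  fin_cases i
  · simpa [hx2] using h5.1
  · simpa [hx2] using h5.2.1
  · exact hx2

theorem not_anisotropic_normForm {n₀ e₁ e₂ e₃ α β : K} :
    ¬ Anisotropic (normForm n₀ e₁ e₂ e₃ α β 0) := by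
  intro h
  refine h ![-α, β, 1] (fun h0 ↦ by simpa using congrFun h0 2) ?_
  rw [evalAt_normForm]
  simp [evalAt]

end NormForms

/-! ### Counting anisotropic ternary forms -/

section NormForms

open Polynomial

variable {K : Type} [Field K]

theorem Anisotropic.restrictLine {F : Fin 10 → K} (h : Anisotropic F) :
    BinAnisotropic (restrictLine F) := by
  intro x y hxy
  rw [← evalAt_line]
  refine h _ fun h0 ↦ ?_
  have hx := congrFun h0 0
  have hy := congrFun h0 1
  simp at hx hy
  tauto

theorem BinAnisotropic.ne_zero {n : Fin 4 → K} (h : BinAnisotropic n) : n 0 ≠ 0 := by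
  simpa [evalBin] using h 1 0 (by simp)

variable [Finite K]

/-- The cubic extension generated by a zero `(θ : 1 : 0)` of a form which is anisotropic on the
line `z = 0`. The second conjunct says that this zero is simple. -/
theorem exists_cubic_splitting {F : Fin 10 → K} (h : BinAnisotropic (restrictLine F)) :
    ∃ (E : Type) (_ : Field E) (_ : Algebra K E) (θ : E),
      evalAt (algebraMap K E ∘ F) ![θ, 1, 0] = 0 ∧
      dirDeriv (algebraMap K E ∘ F) ![θ, 1, 0] ![1, 0, 0] ≠ 0 ∧
      (∀ a b d : K, algebraMap K E a + algebraMap K E b * θ + algebraMap K E d * θ ^ 2 = 0 →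
        a = 0 ∧ b = 0 ∧ d = 0) ∧
      (∀ y : E, ∃ a b d : K,
        y = algebraMap K E a + algebraMap K E b * θ + algebraMap K E d * θ ^ 2) ∧
      ∀ (L : Type) [Field L] (φ : K →+* L) (t : L), evalAt (φ ∘ F) ![t, 1, 0] = 0 →
        ∃ χ : E →+* L, χ θ = t ∧ ∀ a, χ (algebraMap K E a) = φ a := by
  have h0 : F 0 ≠ 0 := h.ne_zero
  have h1 (x : K) : F 0 * x ^ 3 + F 1 * x ^ 2 + F 3 * x + F 6 ≠ 0 := by
    simpa [evalBin, TernaryCubic.restrictLine] using h x 1 (by simp)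
  obtain ⟨E, i1, i2, -, -, θ, -, hroot, hind, -, hspan, hlift⟩ := exists_cubic_extension
    (P := C (F 0) * X ^ 3 + C (F 1) * X ^ 2 + C (F 3) * X + C (F 6))
    (by compute_degree!) (by
      intro x
      simpa using h1 x)
  refine ⟨E, i1, i2, θ, ?_, ?_, hind, hspan, fun L _ φ t ht ↦ hlift L _ φ t ?_⟩
  · simpa [evalAt] using hroot
  · intro hd
    obtain ⟨h3, h2, h30⟩ := hind (F 3) (2 * F 1) (3 * F 0) (by
      simp [dirDeriv, map_ofNat] at hd ⊢
      linear_combination hd)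
    have h3' : (3 : K) = 0 := (mul_eq_zero.1 h30).resolve_right h0
    have h1' : F 1 = 0 := by linear_combination F 1 * h3' - h2
    obtain ⟨t, ht⟩ := exists_pow_three_eq h3' (-F 6 / F 0)
    apply h1 t
    rw [ht, h1', h3]
    field_simp
    ring
  · simpa [evalAt] using ht

/-- An anisotropic form is determined by its restriction to `z = 0` and by the tangent at one of
its (conjugate) zeros there. -/
theorem Anisotropic.exists_eq_normForm {F : Fin 10 → K} (h : Anisotropic F) :
    ∃ α β γ : K, γ ≠ 0 ∧
      F = normForm (F 0) (-(F 1 / F 0)) (F 3 / F 0) (-(F 6 / F 0)) α β γ := by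
  have h0 : F 0 ≠ 0 := h.restrictLine.ne_zero
  obtain ⟨E, _, _, θ, hroot, hne, hind, hspan, hlift⟩ := exists_cubic_splitting h.restrictLine
  obtain ⟨α, β, γ, hz⟩ := hspan (dirDeriv (algebraMap K E ∘ F) ![θ, 1, 0] ![0, 0, 1] /
    dirDeriv (algebraMap K E ∘ F) ![θ, 1, 0] ![1, 0, 0])
  rw [div_eq_iff hne] at hz
  obtain ⟨L, _, φ, l, m, n, hF⟩ := h.exists_eq_prodLinear
  have hF0 : l 0 * m 0 * n 0 = φ (F 0) := by
    simpa [prodLinear] using (congrFun hF 0).symm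
  have hF0' : φ (F 0) ≠ 0 := by simpa using h0
  have hl : l 0 ≠ 0 := by rintro h; simp [h] at hF0; exact hF0' hF0.symm
  have hm : m 0 ≠ 0 := by rintro h; simp [h] at hF0; exact hF0' hF0.symm
  have hn : n 0 ≠ 0 := by rintro h; simp [h] at hF0; exact hF0' hF0.symm
  obtain ⟨s, a, hs⟩ : ∃ s a, l = l 0 • ![1, -s, a] := ⟨-(l 1 / l 0), l 2 / l 0, by
    ext i; fin_cases i <;> simp <;> field_simp⟩
  obtain ⟨t, b, ht⟩ : ∃ s a, m = m 0 • ![1, -s, a] := ⟨-(m 1 / m 0), m 2 / m 0, by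
    ext i; fin_cases i <;> simp <;> field_simp⟩
  obtain ⟨r, d, hr⟩ : ∃ s a, n = n 0 • ![1, -s, a] := ⟨-(n 1 / n 0), n 2 / n 0, by
    ext i; fin_cases i <;> simp <;> field_simp⟩
  have hsmul (x y z : L) (u v w : Fin 3 → L) :
      prodLinear (x • u) (y • v) (z • w) = (x * y * z) • prodLinear u v w := by
    ext i
    fin_cases i <;> simp [prodLinear] <;> ring
  rw [hs, ht, hr, hsmul, hF0] at hF
  have key (s t r a b d : L)
      (hF : φ ∘ F = φ (F 0) • prodLinear ![1, -s, a] ![1, -t, b] ![1, -r, d]) :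
      a = φ α + φ β * s + φ γ * s ^ 2 := by
    obtain ⟨χ, hχ, hχ'⟩ := hlift L φ s (by
      rw [hF, evalAt_smul_left, evalAt_prodLinear]
      simp)
    have hd (v : Fin 3 → K) : χ (dirDeriv (algebraMap K E ∘ F) ![θ, 1, 0] (algebraMap K E ∘ v)) =
        dirDeriv (φ ∘ F) ![s, 1, 0] (φ ∘ v) := by
      rw [← dirDeriv_map]
      congr 1
      · ext i
        simp [hχ']
      · ext i
        fin_cases i <;> simp [hχ]
      · ext i
        simp [hχ']
    have hx : ![1, 0, 0] = algebraMap K E ∘ ![1, 0, 0] := by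
      ext i
      fin_cases i <;> simp
    have hy : ![0, 0, 1] = algebraMap K E ∘ ![0, 0, 1] := by
      ext i
      fin_cases i <;> simp
    have hx' : φ ∘ ![1, 0, 0] = ![1, 0, 0] := by
      ext i
      fin_cases i <;> simp
    have hy' : φ ∘ ![0, 0, 1] = ![0, 0, 1] := by
      ext i
      fin_cases i <;> simp
    have hne' := χ.injective.ne hne
    have hz' := congrArg χ hz
    rw [map_zero, hx, hd] at hne'
    rw [map_mul, hx, hy, hd, hd] at hz'
    rw [hx', hF, (dirDeriv_smul_prodLinear _ _ _ _ _ _ _).1] at hne'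
    rw [hx', hy', hF, (dirDeriv_smul_prodLinear _ _ _ _ _ _ _).1,
      (dirDeriv_smul_prodLinear _ _ _ _ _ _ _).2] at hz'
    have := mul_right_cancel₀ hne' hz'
    simpa [hχ, hχ'] using this
  have ha := key s t r a b d hF
  have hb := key t s r b a d (by rw [hF, prodLinear_swap])
  have hd := key r s t d a b (by rw [hF, prodLinear_rotate])
  have hFn : F = normForm (F 0) (-(F 1 / F 0)) (F 3 / F 0) (-(F 6 / F 0)) α β γ := by
    refine funext fun i ↦ φ.injective ?_
    refine congrFun (f := φ ∘ F) (g := φ ∘ _) ?_ i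
    have e1 := congrFun hF 1
    have e2 := congrFun hF 3
    have e3 := congrFun hF 6
    simp [prodLinear] at e1 e2 e3
    rw [normForm_map, show φ (-(F 1 / F 0)) = s + t + r by
        rw [map_neg, map_div₀, e1]; field_simp; ring,
      show φ (F 3 / F 0) = s * t + s * r + t * r by
        rw [map_div₀, e2]; field_simp; ring,
      show φ (-(F 6 / F 0)) = s * t * r by
        rw [map_neg, map_div₀, e3]; field_simp,
      normForm_eq_prodLinear, ← ha, ← hb, ← hd]
    exact hF
  refine ⟨α, β, γ, ?_, hFn⟩
  rintro rfl
  rw [hFn] at h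
  exact not_anisotropic_normForm h

theorem normForm_injective {n₀ e₁ e₂ e₃ α β γ α' β' γ' : K}
    (h : BinAnisotropic ![n₀, -(n₀ * e₁), n₀ * e₂, -(n₀ * e₃)])
    (heq : normForm n₀ e₁ e₂ e₃ α β γ = normForm n₀ e₁ e₂ e₃ α' β' γ') :
    α = α' ∧ β = β' ∧ γ = γ' := by
  obtain ⟨E, _, _, θ, hroot, hne, hind, -, -⟩ :=
    exists_cubic_splitting (F := normForm n₀ e₁ e₂ e₃ α β γ) (by rwa [restrictLine_normForm])
  set φ := algebraMap K E with hφ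
  have h0 : φ n₀ ≠ 0 := by simpa using h.ne_zero
  have hroot' : θ ^ 3 - φ e₁ * θ ^ 2 + φ e₂ * θ - φ e₃ = 0 := by
    rw [evalAt_line, show TernaryCubic.restrictLine (φ ∘ normForm n₀ e₁ e₂ e₃ α β γ) =
      φ ∘ TernaryCubic.restrictLine (normForm n₀ e₁ e₂ e₃ α β γ) by
        ext i; fin_cases i <;> rfl, restrictLine_normForm] at hroot
    simp [evalBin] at hroot
    refine (mul_eq_zero.1 ?_).resolve_left h0
    linear_combination hroot
  rw [normForm_map] at hne
  have h1 := dirDeriv_normForm (φ n₀) (φ e₁) (φ e₂) (φ e₃) (φ α) (φ β) (φ γ) θ hroot'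
  have h2 := dirDeriv_normForm (φ n₀) (φ e₁) (φ e₂) (φ e₃) (φ α') (φ β') (φ γ') θ hroot'
  have heq' := congrArg (φ ∘ ·) heq
  simp only [normForm_map] at heq'
  rw [← heq', h1] at h2
  have h3 := mul_right_cancel₀ hne h2
  obtain ⟨h4, h5, h6⟩ := hind (α - α') (β - β') (γ - γ') (by
    rw [map_sub, map_sub, map_sub]
    linear_combination h3)
  exact ⟨sub_eq_zero.1 h4, sub_eq_zero.1 h5, sub_eq_zero.1 h6⟩

/-- Each anisotropic binary cubic form over a field with `q` elements is the restriction of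
exactly `q² (q - 1)` anisotropic ternary cubic forms. -/
theorem natCard_anisotropic_restrictLine {n : Fin 4 → K} (h : BinAnisotropic n) :
    Nat.card {F : Fin 10 → K // Anisotropic F ∧ restrictLine F = n} =
      Nat.card K ^ 2 * (Nat.card K - 1) := by
  have h0 := h.ne_zero
  have hn : n = ![n 0, -(n 0 * (-(n 1 / n 0))), n 0 * (n 2 / n 0), -(n 0 * (-(n 3 / n 0)))] := by
    ext i
    fin_cases i <;> simp <;> field_simp
  have hroot (x : K) : x ^ 3 - -(n 1 / n 0) * x ^ 2 + n 2 / n 0 * x - -(n 3 / n 0) ≠ 0 := by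
    intro hx
    apply h x 1 (by simp)
    simp only [evalBin]
    field_simp at hx
    linear_combination hx
  have e : K × K × Kˣ ≃ {F : Fin 10 → K // Anisotropic F ∧ restrictLine F = n} := by
    refine Equiv.ofBijective (fun t ↦
      ⟨normForm (n 0) (-(n 1 / n 0)) (n 2 / n 0) (-(n 3 / n 0)) t.1 t.2.1 t.2.2.1,
        anisotropic_normForm h0 hroot t.2.2.ne_zero, ?_⟩) ⟨?_, ?_⟩
    · rw [restrictLine_normForm, ← hn]
    · rintro ⟨α, β, γ⟩ ⟨α', β', γ'⟩ heq
      obtain ⟨h1, h2, h3⟩ := normForm_injective (hn ▸ h) (congrArg Subtype.val heq)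
      simp only at h1 h2 h3
      rw [h1, h2, Units.ext h3]
    · rintro ⟨F, hF, hFn⟩
      obtain ⟨α, β, γ, hγ, hF'⟩ := hF.exists_eq_normForm
      refine ⟨(α, β, Units.mk0 γ hγ), Subtype.ext ?_⟩
      have e0 : n 0 = F 0 := congrFun hFn.symm 0
      have e1 : n 1 = F 1 := congrFun hFn.symm 1
      have e2 : n 2 = F 3 := congrFun hFn.symm 2
      have e3 : n 3 = F 6 := congrFun hFn.symm 3
      simp only [e0, e1, e2, e3, Units.val_mk0]
      exact hF'.symm
  rw [← Nat.card_congr e, Nat.card_prod, Nat.card_prod, Nat.card_units]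
  ring

/-- The number of anisotropic ternary cubic forms in terms of that of binary ones. -/
theorem natCard_anisotropic :
    Nat.card {F : Fin 10 → K // Anisotropic F} =
      Nat.card {n : Fin 4 → K // BinAnisotropic n} * (Nat.card K ^ 2 * (Nat.card K - 1)) := by
  have := Fintype.ofFinite K
  have := Fintype.ofFinite {n : Fin 4 → K // BinAnisotropic n}
  rw [← Nat.card_congr (Equiv.sigmaFiberEquiv fun F : {F : Fin 10 → K // Anisotropic F} ↦
    (⟨restrictLine F.1, F.2.restrictLine⟩ : {n : Fin 4 → K // BinAnisotropic n})), Nat.card_sigma]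
  have key (n : {n : Fin 4 → K // BinAnisotropic n}) :
      Nat.card {F : {F : Fin 10 → K // Anisotropic F} //
        (⟨restrictLine F.1, F.2.restrictLine⟩ : {n : Fin 4 → K // BinAnisotropic n}) = n} =
      Nat.card K ^ 2 * (Nat.card K - 1) := by
    rw [← natCard_anisotropic_restrictLine n.2]
    exact Nat.card_congr ((Equiv.subtypeEquivRight fun F ↦ Subtype.ext_iff).trans
      (Equiv.subtypeSubtypeEquivSubtypeInter Anisotropic fun F ↦ restrictLine F = n.1))
  rw [Finset.sum_congr rfl fun n _ ↦ key n, Finset.sum_const, Finset.card_univ, smul_eq_mul,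
    ← Nat.card_eq_fintype_card]

end NormForms

/-! ### Counting anisotropic binary forms -/

section BinaryCount

open Finset

variable {K : Type} [Field K]

/-- The value at `x` of the monic cubic polynomial `X³ + v₀ X² + v₁ X + v₂`. -/
def evalMonic (v : Fin 3 → K) (x : K) : K := x ^ 3 + v 0 * x ^ 2 + v 1 * x + v 2

/-- The number of roots of a monic cubic polynomial. -/
noncomputable def numRoots (v : Fin 3 → K) : ℕ := Nat.card {x : K // evalMonic v x = 0}

theorem numRoots_le (v : Fin 3 → K) : numRoots v ≤ 3 := by
  open Polynomial in
  classical
  set P : K[X] := X ^ 3 + C (v 0) * X ^ 2 + C (v 1) * X + C (v 2) with hP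
  have hdeg : P.natDegree = 3 := by rw [hP]; compute_degree!
  have h0 : P ≠ 0 := by rintro h; simp [h] at hdeg
  have hroots : {x | evalMonic v x = 0} = (P.roots.toFinset : Set K) := by
    ext x
    rw [Finset.mem_coe, Multiset.mem_toFinset, Polynomial.mem_roots h0]
    simp [evalMonic, hP]
  calc numRoots v = Set.ncard {x | evalMonic v x = 0} := rfl
    _ = #P.roots.toFinset := by rw [hroots, Set.ncard_coe_finset]
    _ ≤ P.roots.card := Multiset.toFinset_card_le _
    _ ≤ 3 := hdeg ▸ P.card_roots'

/-- Vanishing at `j ≤ 3` distinct points imposes independent conditions on monic cubics. -/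
theorem natCard_evalMonic_eq_zero [Finite K] {j : ℕ} (hj : j ≤ 3) (P : Fin j ↪ K) :
    Nat.card {v : Fin 3 → K // ∀ i, evalMonic v (P i) = 0} = Nat.card K ^ (3 - j) := by
  classical
  let L : (Fin 3 → K) →ₗ[K] (Fin j → K) :=
    { toFun v i := v 0 * P i ^ 2 + v 1 * P i + v 2
      map_add' v w := by ext i; simp only [Pi.add_apply]; ring
      map_smul' a v := by
        ext i
        simp only [Pi.smul_apply, smul_eq_mul, RingHom.id_apply]
        ring }
  have hsurj : Function.Surjective L := by
    intro b
    set Q := Lagrange.interpolate univ P b with hQ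
    have hQd : Q.degree < 3 := (Lagrange.degree_interpolate_lt b P.injective.injOn).trans_le (by
      simpa using hj)
    have hQn : Q.natDegree < 3 := by
      rcases eq_or_ne Q 0 with h | h
      · simp [h]
      · exact (Polynomial.natDegree_lt_iff_degree_lt h).2 hQd
    refine ⟨![Q.coeff 2, Q.coeff 1, Q.coeff 0], funext fun i ↦ ?_⟩
    have h := Lagrange.eval_interpolate_at_node b P.injective.injOn (mem_univ i)
    rw [← hQ, Polynomial.eval_eq_sum_range' hQn] at h
    simp [Finset.sum_range_succ] at h
    simp [L]
    linear_combination h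
  obtain ⟨v₀, hv₀⟩ := hsurj fun i ↦ -P i ^ 3
  have hker : Module.finrank K (LinearMap.ker L) = 3 - j := by
    have := LinearMap.finrank_range_add_finrank_ker L
    rw [LinearMap.range_eq_top.2 hsurj, finrank_top, Module.finrank_fin_fun,
      Module.finrank_fin_fun] at this
    omega
  have h1 := Module.natCard_eq_pow_finrank (K := K) (V := LinearMap.ker L)
  rw [hker] at h1
  rw [← h1]
  refine Nat.card_congr (Equiv.subtypeEquiv (Equiv.subRight v₀) fun v ↦ ?_)
  rw [LinearMap.mem_ker, Equiv.subRight_apply, map_sub, hv₀, funext_iff]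
  refine forall_congr' fun i ↦ ?_
  simp [L, evalMonic]
  constructor <;> intro h <;> linear_combination h

/-- The factorial moments, up to the third, of the number of roots of a monic cubic. -/
theorem sum_descFactorial_numRoots [Fintype K] {j : ℕ} (hj : j ≤ 3) :
    ∑ v : Fin 3 → K, (numRoots v).descFactorial j =
      (Fintype.card K).descFactorial j * Fintype.card K ^ (3 - j) := by
  classical
  have h1 (v : Fin 3 → K) : (numRoots v).descFactorial j =
      #{P : Fin j ↪ K | ∀ i, evalMonic v (P i) = 0} := by
    have e : {P : Fin j ↪ K // ∀ i, evalMonic v (P i) = 0} ≃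
        (Fin j ↪ {x : K // evalMonic v x = 0}) :=
      { toFun P := ⟨fun i ↦ ⟨P.1 i, P.2 i⟩, fun a b h ↦ P.1.injective (congrArg Subtype.val h)⟩
        invFun P := ⟨P.trans (Function.Embedding.subtype _), fun i ↦ (P i).2⟩
        left_inv P := rfl
        right_inv P := rfl }
    rw [← Fintype.card_subtype, Fintype.card_congr e, Fintype.card_embedding_eq, numRoots,
      Nat.card_eq_fintype_card, Fintype.card_fin]
  have h2 (P : Fin j ↪ K) :
      #{v : Fin 3 → K | ∀ i, evalMonic v (P i) = 0} = Fintype.card K ^ (3 - j) := by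
    have := natCard_evalMonic_eq_zero hj P
    rwa [Nat.card_eq_fintype_card, Nat.card_eq_fintype_card, Fintype.card_subtype] at this
  simp_rw [h1]
  have h3 := Finset.sum_card_bipartiteAbove_eq_sum_card_bipartiteBelow
    (s := (univ : Finset (Fin 3 → K))) (t := (univ : Finset (Fin j ↪ K)))
    (fun v P ↦ ∀ i, evalMonic v (P i) = 0)
  simp only [bipartiteAbove, bipartiteBelow] at h3
  rw [h3, Finset.sum_congr rfl fun P _ ↦ h2 P, Finset.sum_const, Finset.card_univ,
    Fintype.card_embedding_eq, Fintype.card_fin, smul_eq_mul]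

/-- The number of irreducible monic cubic polynomials is `(q³ - q) / 3`. -/
theorem three_mul_natCard_evalMonic_ne_zero [Finite K] :
    3 * (Nat.card {v : Fin 3 → K // ∀ x, evalMonic v x ≠ 0} : ℤ) =
      (Nat.card K : ℤ) ^ 3 - Nat.card K := by
  classical
  have := Fintype.ofFinite K
  rw [Nat.card_eq_fintype_card (α := K)]
  set q := Fintype.card K with hqdef
  have h (j : ℕ) (hj : j ≤ 3) := congrArg (Nat.cast : ℕ → ℤ)
    (sum_descFactorial_numRoots (K := K) hj)
  have h0 := h 0 (by norm_num)
  have h1 := h 1 (by norm_num)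
  have h2 := h 2 (by norm_num)
  have h3 := h 3 (by norm_num)
  rw [← hqdef] at h0 h1 h2 h3
  push_cast [cast_descFactorial_two_int, cast_descFactorial_three_int,
    Nat.descFactorial_zero, Nat.descFactorial_one] at h0 h1 h2 h3
  -- For `R ≤ 3`, the polynomial `6 - 6 R + 3 (R)₂ - (R)₃` is six times the indicator of `R = 0`.
  have hcard : 6 * (Nat.card {v : Fin 3 → K // ∀ x, evalMonic v x ≠ 0} : ℤ) =
      ∑ v : Fin 3 → K, (6 - 6 * (numRoots v : ℤ) + 3 * (numRoots v * (numRoots v - 1)) -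
        numRoots v * (numRoots v - 1) * (numRoots v - 2)) := by
    rw [Nat.card_eq_fintype_card, Fintype.card_subtype, Finset.card_filter]
    push_cast
    rw [Finset.mul_sum]
    refine Finset.sum_congr rfl fun v _ ↦ ?_
    have hzero : (∀ x, evalMonic v x ≠ 0) ↔ numRoots v = 0 := by
      rw [numRoots, Nat.card_eq_fintype_card, Fintype.card_eq_zero_iff, isEmpty_subtype]
    rw [if_congr hzero rfl rfl]
    have := numRoots_le v
    interval_cases numRoots v <;> simp
  have hsplit : ∑ v : Fin 3 → K, (6 - 6 * (numRoots v : ℤ) + 3 * (numRoots v * (numRoots v - 1)) -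
        numRoots v * (numRoots v - 1) * (numRoots v - 2)) =
      6 * (∑ v : Fin 3 → K, (1 : ℤ)) - 6 * (∑ v : Fin 3 → K, (numRoots v : ℤ)) +
      3 * (∑ v : Fin 3 → K, (numRoots v : ℤ) * (numRoots v - 1)) -
      ∑ v : Fin 3 → K, (numRoots v : ℤ) * (numRoots v - 1) * (numRoots v - 2) := by
    simp only [Finset.mul_sum, ← Finset.sum_add_distrib, ← Finset.sum_sub_distrib]
    simp
  rw [hsplit, h0, h1, h2, h3] at hcard
  refine mul_left_cancel₀ (two_ne_zero (α := ℤ)) ?_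
  linear_combination hcard

theorem three_mul_natCard_binAnisotropic [Finite K] :
    3 * (Nat.card {n : Fin 4 → K // BinAnisotropic n} : ℤ) =
      (Nat.card K - 1) * ((Nat.card K : ℤ) ^ 3 - Nat.card K) := by
  have e : Kˣ × {v : Fin 3 → K // ∀ x, evalMonic v x ≠ 0} ≃
      {n : Fin 4 → K // BinAnisotropic n} :=
    { toFun t := ⟨![t.1, t.1 * t.2.1 0, t.1 * t.2.1 1, t.1 * t.2.1 2], by
        intro x y hxy h
        have h' : x ^ 3 + t.2.1 0 * x ^ 2 * y + t.2.1 1 * x * y ^ 2 + t.2.1 2 * y ^ 3 = 0 := by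
          refine (mul_eq_zero.1 ?_).resolve_left t.1.ne_zero
          simp [evalBin] at h
          linear_combination h
        rcases eq_or_ne y 0 with rfl | hy
        · simp at h' hxy
          exact hxy h'
        · apply t.2.2 (x / y)
          simp only [evalMonic]
          field_simp
          linear_combination h'⟩
      invFun n := (Units.mk0 (n.1 0) n.2.ne_zero,
        ⟨![n.1 1 / n.1 0, n.1 2 / n.1 0, n.1 3 / n.1 0], by
          intro x hx
          apply n.2 x 1 (by simp)
          have h0 := n.2.ne_zero
          simp [evalMonic] at hx
          field_simp at hx
          simp only [evalBin]
          linear_combination hx⟩)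
      left_inv t := by
        refine Prod.ext (by ext; simp) (Subtype.ext (funext fun i ↦ ?_))
        fin_cases i <;> simp
      right_inv n := by
        have h0 := n.2.ne_zero
        refine Subtype.ext (funext fun i ↦ ?_)
        fin_cases i <;> simp <;> field_simp }
  rw [← Nat.card_congr e, Nat.card_prod, Nat.card_units]
  have hq : 1 ≤ Nat.card K := Nat.card_pos
  push_cast [hq]
  linear_combination (Nat.card K - 1 : ℤ) * three_mul_natCard_evalMonic_ne_zero (K := K)

end BinaryCount

/-! ### Solubility over the `p`-adic numbers -/

section Solubility

variable {p : ℕ} [Fact p.Prime]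

/-- The cubic form over `ℤ_p` with coefficient vector `c` has a nontrivial integral zero. -/
def Soluble (c : Fin 10 → ℤ_[p]) : Prop := ∃ x : Fin 3 → ℤ_[p], x ≠ 0 ∧ evalAt c x = 0

theorem aeval_form (c : Fin 10 → ℤ_[p]) (x : Fin 3 → ℚ_[p]) :
    MvPolynomial.aeval x (form c) = evalAt (fun i ↦ (c i : ℚ_[p])) x := by
  simp [form, evalAt]

/-- Clearing denominators. -/
theorem exists_padicInt_eq_pow_mul (x : Fin 3 → ℚ_[p]) :
    ∃ (n : ℕ) (y : Fin 3 → ℤ_[p]), ∀ i, (y i : ℚ_[p]) = (p : ℚ_[p]) ^ n * x i := by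
  have h (y : ℚ_[p]) : ∃ n : ℕ, ∀ m, n ≤ m → ‖(p : ℚ_[p]) ^ m * y‖ ≤ 1 := by
    have hp : (1 : ℝ) < p := by exact_mod_cast (Fact.out : p.Prime).one_lt
    obtain ⟨n, hn⟩ := pow_unbounded_of_one_lt ‖y‖ hp
    refine ⟨n, fun m hm ↦ ?_⟩
    rw [norm_mul, norm_pow, Padic.norm_p, inv_pow, inv_mul_le_one₀ (by positivity)]
    exact hn.le.trans (pow_le_pow_right₀ hp.le hm)
  choose n hn using fun i ↦ h (x i)
  refine ⟨n 0 + n 1 + n 2, fun i ↦ ⟨_, hn i _ ?_⟩, fun i ↦ rfl⟩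
  fin_cases i <;> simp <;> omega

theorem mem_solubleSet_iff (c : Fin 10 → ℤ_[p]) : c ∈ solubleSet p ↔ Soluble c := by
  have hcast (y : Fin 3 → ℤ_[p]) : evalAt (fun i ↦ (c i : ℚ_[p])) (fun i ↦ (y i : ℚ_[p])) =
      ((evalAt c y : ℤ_[p]) : ℚ_[p]) := evalAt_map PadicInt.Coe.ringHom c y
  constructor
  · rintro ⟨x, hx, h⟩
    rw [aeval_form] at h
    obtain ⟨n, y, hy⟩ := exists_padicInt_eq_pow_mul x
    have hy' : (fun i ↦ (y i : ℚ_[p])) = (p : ℚ_[p]) ^ n • x := funext hy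
    have hp0 : (p : ℚ_[p]) ^ n ≠ 0 := pow_ne_zero _ (by
      exact_mod_cast (Fact.out : p.Prime).ne_zero)
    refine ⟨y, ?_, ?_⟩
    · rintro rfl
      apply hx
      have : (p : ℚ_[p]) ^ n • x = 0 := by
        rw [← hy']
        ext i
        simp
      exact (smul_eq_zero.1 this).resolve_left hp0
    · have h2 := hcast y
      rw [hy', evalAt_smul, h, mul_zero] at h2
      exact PadicInt.ext (h2.symm.trans PadicInt.coe_zero.symm)
  · rintro ⟨y, hy, h⟩
    refine ⟨fun i ↦ (y i : ℚ_[p]), ?_, ?_⟩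
    · intro h0
      apply hy
      exact funext fun i ↦ PadicInt.ext (congrFun h0 i)
    · rw [aeval_form, hcast, h]
      simp

/-- Reduction modulo `p` of a vector. -/
noncomputable def reduce {k : ℕ} (c : Fin k → ℤ_[p]) : Fin k → ZMod p := PadicInt.toZMod ∘ c

theorem toZMod_eq_zero_iff {a : ℤ_[p]} : PadicInt.toZMod a = 0 ↔ (p : ℤ_[p]) ∣ a := by
  rw [← RingHom.mem_ker, PadicInt.ker_toZMod, PadicInt.maximalIdeal_eq_span_p,
    Ideal.mem_span_singleton]

theorem toZMod_ne_zero_iff {a : ℤ_[p]} : PadicInt.toZMod a ≠ 0 ↔ ‖a‖ = 1 := by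
  rw [ne_eq, toZMod_eq_zero_iff, ← PadicInt.norm_lt_one_iff_dvd, not_lt]
  exact ⟨fun h ↦ le_antisymm (PadicInt.norm_le_one a) h, fun h ↦ h.ge⟩

/-- A vector lifting a given vector modulo `p`, with `0` and `1` lifting `0` and `1`. -/
noncomputable def lift {k : ℕ} (r : Fin k → ZMod p) : Fin k → ℤ_[p] := fun i ↦ ((r i).val : ℤ_[p])

theorem reduce_lift {k : ℕ} (r : Fin k → ZMod p) : reduce (lift r) = r := by
  ext i
  simp [reduce, lift]

/-- Dividing by powers of `p`, a nontrivial zero becomes primitive. -/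
theorem Soluble.exists_primitive {c : Fin 10 → ℤ_[p]} (h : Soluble c) :
    ∃ x : Fin 3 → ℤ_[p], (∃ i, ‖x i‖ = 1) ∧ evalAt c x = 0 := by
  obtain ⟨x, hx, h0⟩ := h
  have hp0 : (p : ℤ_[p]) ≠ 0 := by exact_mod_cast (Fact.out : p.Prime).ne_zero
  obtain ⟨j, hj⟩ : ∃ j, x j ≠ 0 := by
    by_contra! hall
    exact hx (funext hall)
  have key (n : ℕ) : ∀ x : Fin 3 → ℤ_[p], x j ≠ 0 → evalAt c x = 0 → (x j).valuation ≤ n →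
      ∃ x : Fin 3 → ℤ_[p], (∃ i, ‖x i‖ = 1) ∧ evalAt c x = 0 := by
    induction n with
    | zero =>
      intro x hxj h0 hv
      refine ⟨x, ⟨j, ?_⟩, h0⟩
      rw [PadicInt.norm_eq_zpow_neg_valuation hxj, Nat.le_zero.1 hv]
      simp
    | succ n ih =>
      intro x hxj h0 hv
      by_cases hprim : ∃ i, ‖x i‖ = 1
      · exact ⟨x, hprim, h0⟩
      · push Not at hprim
        have hdvd (i) : (p : ℤ_[p]) ∣ x i := by
          rw [← PadicInt.norm_lt_one_iff_dvd]
          exact lt_of_le_of_ne (PadicInt.norm_le_one _) (hprim i)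
        choose y hy using hdvd
        have hxy : x = (p : ℤ_[p]) • y := funext hy
        have hyj : y j ≠ 0 := by
          intro h
          exact hxj (by rw [hy, h, mul_zero])
        refine ih y hyj ?_ ?_
        · rw [hxy, evalAt_smul] at h0
          exact (mul_eq_zero.1 h0).resolve_left (pow_ne_zero _ hp0)
        · rw [hy, PadicInt.valuation_mul hp0 hyj, PadicInt.valuation_p] at hv
          omega
  exact key _ x hj h0 le_rfl

/-- A form all of whose integral zeros are divisible by `p` is insoluble, by descent. -/
theorem not_soluble_of_dvd {c : Fin 10 → ℤ_[p]}
    (h : ∀ x : Fin 3 → ℤ_[p], evalAt c x = 0 → ∀ i, (p : ℤ_[p]) ∣ x i) : ¬ Soluble c := by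
  intro hs
  obtain ⟨x, ⟨i, hi⟩, h0⟩ := hs.exists_primitive
  exact (PadicInt.norm_lt_one_iff_dvd _).2 (h x h0 i) |>.ne hi

/-- Hensel's lemma: a smooth zero of the reduction lifts. -/
theorem soluble_of_smooth {c : Fin 10 → ℤ_[p]} (x w : Fin 3 → ZMod p)
    (h0 : evalAt (reduce c) x = 0) (h1 : dirDeriv (reduce c) x w ≠ 0) : Soluble c := by
  open Polynomial in
  set X' := lift x
  set W := lift w
  set F : ℤ_[p][X] := C (evalAt c X') + C (dirDeriv c X' W) * X + C (dirDeriv c W X') * X ^ 2 +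
    C (evalAt c W) * X ^ 3 with hF
  have hFe (t : ℤ_[p]) : aeval t F = evalAt c (X' + t • W) := by
    have := evalAt_add_smul c X' W 1 t
    rw [one_smul] at this
    rw [this]
    simp [hF]
    ring
  have hd : aeval (0 : ℤ_[p]) (derivative F) = dirDeriv c X' W := by
    simp [hF]
  have hev : PadicInt.toZMod (evalAt c X') = 0 := by
    rw [← evalAt_map]
    exact (congrArg (evalAt (reduce c)) (reduce_lift x)).trans h0
  have hdv : PadicInt.toZMod (dirDeriv c X' W) ≠ 0 := by
    rw [← dirDeriv_map]
    exact ((congrArg₂ (dirDeriv (reduce c)) (reduce_lift x) (reduce_lift w))).trans_ne h1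
  rw [toZMod_ne_zero_iff] at hdv
  rw [toZMod_eq_zero_iff, ← PadicInt.norm_lt_one_iff_dvd] at hev
  obtain ⟨z, hz, hz', -⟩ := hensels_lemma (F := F) (a := 0) (by
    rw [hd, hdv, hFe]
    simpa using hev)
  rw [hd, hdv, sub_zero] at hz'
  refine ⟨X' + z • W, ?_, by rwa [← hFe]⟩
  intro hzero
  apply h1
  have hx : x = 0 := by
    have h2 := congrArg reduce hzero
    have hz0 : PadicInt.toZMod z = 0 := by
      rwa [toZMod_eq_zero_iff, ← PadicInt.norm_lt_one_iff_dvd]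
    rw [← reduce_lift x]
    ext i
    have := congrFun h2 i
    simpa [reduce, hz0] using this
  rw [hx]
  simp [dirDeriv]

theorem continuous_evalAt :
    Continuous fun t : (Fin 10 → ℤ_[p]) × (Fin 3 → ℤ_[p]) ↦ evalAt t.1 t.2 := by
  unfold evalAt
  fun_prop

/-- Solubility is a closed condition, since it suffices to look for primitive zeros, which form a
compact set. -/
theorem isClosed_solubleSet : IsClosed (solubleSet p) := by
  have h : solubleSet p = Prod.fst '' {t : (Fin 10 → ℤ_[p]) × (Fin 3 → ℤ_[p]) |
      (∃ i, ‖t.2 i‖ = 1) ∧ evalAt t.1 t.2 = 0} := by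
    ext c
    rw [mem_solubleSet_iff]
    constructor
    · intro hc
      obtain ⟨x, hx, h0⟩ := hc.exists_primitive
      exact ⟨(c, x), ⟨hx, h0⟩, rfl⟩
    · rintro ⟨⟨c, x⟩, ⟨⟨i, hi⟩, h0⟩, rfl⟩
      refine ⟨x, ?_, h0⟩
      rintro rfl
      simp at hi
  rw [h]
  apply isClosedMap_fst_of_compactSpace
  have hprim : IsClosed {t : (Fin 10 → ℤ_[p]) × (Fin 3 → ℤ_[p]) | ∃ i, ‖t.2 i‖ = 1} := by
    rw [Set.ofPred_exists]
    exact isClosed_iUnion_of_finite fun i ↦ isClosed_eq (by fun_prop) continuous_const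
  exact hprim.inter (isClosed_eq continuous_evalAt continuous_const)

theorem measurableSet_solubleSet : MeasurableSet (solubleSet p) :=
  isClosed_solubleSet.measurableSet

end Solubility

/-! ### The mass of insoluble forms -/

section Mass

variable {p : ℕ} [Fact p.Prime]

instance isAddHaarMeasure_coeffMeasure : (coeffMeasure p).IsAddHaarMeasure := by
  unfold coeffMeasure padicHaar
  infer_instance

instance isProbabilityMeasure_coeffMeasure : IsProbabilityMeasure (coeffMeasure p) := by
  unfold coeffMeasure
  infer_instance

/-- Multiply the `i`-th coefficient by `p ^ e i`. -/
noncomputable def scale (e : Fin 10 → ℕ) (c : Fin 10 → ℤ_[p]) : Fin 10 → ℤ_[p] :=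
  fun i ↦ (p : ℤ_[p]) ^ e i * c i

/-- The measure of the set of those `c`, with reduction modulo `p` in `K`, for which the cubic form
with coefficients `p ^ e i * c i` is insoluble. -/
noncomputable def insolMass (e : Fin 10 → ℕ) (K : Set (Fin 10 → ZMod p)) : ℝ :=
  (coeffMeasure p).real {c | reduce c ∈ K ∧ ¬ Soluble (scale e c)}

theorem isOpen_reduce_eq (r : Fin 10 → ZMod p) :
    IsOpen {c : Fin 10 → ℤ_[p] | reduce c = r} := by
  have h : {c : Fin 10 → ℤ_[p] | reduce c = r} = ⋂ i, {c | ‖c i - lift r i‖ < 1} := by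
    ext c
    simp only [Set.mem_ofPred_eq, Set.mem_iInter, funext_iff]
    refine forall_congr' fun i ↦ ?_
    rw [PadicInt.norm_lt_one_iff_dvd, ← toZMod_eq_zero_iff, map_sub, sub_eq_zero]
    have := congrFun (reduce_lift r) i
    simp only [reduce, Function.comp_apply] at this ⊢
    rw [this]
  rw [h]
  exact isOpen_iInter_of_finite fun i ↦ isOpen_lt (by fun_prop) continuous_const

theorem measurableSet_reduce_mem (K : Set (Fin 10 → ZMod p)) :
    MeasurableSet {c : Fin 10 → ℤ_[p] | reduce c ∈ K} := by
  have h : {c : Fin 10 → ℤ_[p] | reduce c ∈ K} = ⋃ r ∈ K, {c | reduce c = r} := by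
    ext c
    simp
  rw [h]
  exact MeasurableSet.biUnion (Set.to_countable K) fun r _ ↦ (isOpen_reduce_eq r).measurableSet

theorem measureReal_reduce_eq (r : Fin 10 → ZMod p) :
    (coeffMeasure p).real {c | reduce c = r} = ((p : ℝ) ^ 10)⁻¹ := by
  have h (r s : Fin 10 → ZMod p) : (coeffMeasure p).real {c | reduce c = r} =
      (coeffMeasure p).real {c | reduce c = s} := by
    rw [measureReal_def, measureReal_def,
      ← measure_preimage_add (coeffMeasure p) (lift (r - s)) {c | reduce c = r}]
    congr 2
    ext c
    have h1 : reduce (lift (r - s) + c) = (r - s) + reduce c := by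
      conv_rhs => rw [← reduce_lift (r - s)]
      ext i
      simp [reduce]
    simp only [Set.mem_preimage, Set.mem_ofPred_eq, h1]
    constructor
    · intro h
      linear_combination h
    · intro h
      linear_combination h
  have h1 : (coeffMeasure p).real (⋃ s ∈ (Finset.univ : Finset (Fin 10 → ZMod p)),
      {c | reduce c = s}) = 1 := by
    rw [show (⋃ s ∈ (Finset.univ : Finset (Fin 10 → ZMod p)), {c : Fin 10 → ℤ_[p] | reduce c = s}) =
      Set.univ by ext; simp]
    exact probReal_univ
  rw [measureReal_biUnion_finset
    (by
      intro a _ b _ hab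
      exact Set.disjoint_left.2 fun c hc hc' ↦ hab (hc.symm.trans hc'))
    (fun s _ ↦ (isOpen_reduce_eq s).measurableSet),
    Finset.sum_congr rfl fun s _ ↦ h s r, Finset.sum_const, Finset.card_univ] at h1
  simp at h1
  exact eq_inv_of_mul_eq_one_right h1

theorem insolMass_split (e : Fin 10 → ℕ) (K L : Set (Fin 10 → ZMod p)) :
    insolMass e K = insolMass e (K ∩ L) + insolMass e (K \ L) := by
  have h := measureReal_inter_add_sdiff (μ := coeffMeasure p)
    (s := {c : Fin 10 → ℤ_[p] | reduce c ∈ K ∧ ¬ Soluble (scale e c)}) (measurableSet_reduce_mem L)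
  rw [insolMass, ← h]
  congr 2
  · ext c
    simp only [Set.mem_inter_iff, Set.mem_ofPred_eq]
    tauto
  · ext c
    simp only [Set.mem_sdiff, Set.mem_ofPred_eq]
    tauto

theorem insolMass_union (e : Fin 10 → ℕ) {K L : Set (Fin 10 → ZMod p)} (h : Disjoint K L) :
    insolMass e (K ∪ L) = insolMass e K + insolMass e L := by
  rw [insolMass_split e (K ∪ L) K, Set.union_inter_cancel_left, Set.union_sdiff_left,
    h.symm.sdiff_eq_left]

theorem insolMass_empty (e : Fin 10 → ℕ) : insolMass e (∅ : Set (Fin 10 → ZMod p)) = 0 := by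
  simp [insolMass]

theorem insolMass_finset (e : Fin 10 → ℕ) (K : Finset (Fin 10 → ZMod p)) :
    insolMass e (K : Set (Fin 10 → ZMod p)) = ∑ r ∈ K, insolMass e {r} := by
  classical
  induction K using Finset.induction_on with
  | empty => simp [insolMass_empty]
  | insert r K hr ih =>
    rw [Finset.sum_insert hr, Finset.coe_insert, Set.insert_eq, insolMass_union, ih]
    simpa using hr

open scoped Classical in
theorem insolMass_eq_sum (e : Fin 10 → ℕ) (K : Set (Fin 10 → ZMod p)) :
    insolMass e K = ∑ r, if r ∈ K then insolMass e {r} else 0 := by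
  rw [← Finset.sum_filter, ← insolMass_finset]
  simp

theorem insolMass_of_soluble {e : Fin 10 → ℕ} {K : Set (Fin 10 → ZMod p)}
    (h : ∀ c, reduce c ∈ K → Soluble (scale e c)) : insolMass e K = 0 := by
  rw [insolMass, show {c : Fin 10 → ℤ_[p] | reduce c ∈ K ∧ ¬ Soluble (scale e c)} = ∅ by
    ext c; simpa using h c]
  simp

theorem measureReal_reduce_mem (K : Set (Fin 10 → ZMod p)) :
    (coeffMeasure p).real {c | reduce c ∈ K} = Nat.card K / (p : ℝ) ^ 10 := by
  classical
  rw [show {c : Fin 10 → ℤ_[p] | reduce c ∈ K} = ⋃ r ∈ K.toFinset, {c | reduce c = r} by ext; simp,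
    measureReal_biUnion_finset
      (by
        intro a _ b _ hab
        exact Set.disjoint_left.2 fun c hc hc' ↦ hab (hc.symm.trans hc'))
      (fun s _ ↦ (isOpen_reduce_eq s).measurableSet),
    Finset.sum_congr rfl fun r _ ↦ measureReal_reduce_eq r, Finset.sum_const, nsmul_eq_mul,
    Nat.card_eq_fintype_card, ← Set.toFinset_card, div_eq_mul_inv]

theorem insolMass_of_not_soluble {e : Fin 10 → ℕ} {K : Set (Fin 10 → ZMod p)}
    (h : ∀ c, reduce c ∈ K → ¬ Soluble (scale e c)) :
    insolMass e K = Nat.card K / (p : ℝ) ^ 10 := by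
  rw [← measureReal_reduce_mem, insolMass]
  congr 2
  ext c
  exact ⟨fun hc ↦ hc.1, fun hc ↦ ⟨hc, h c hc⟩⟩

/-- The image of a measurable set under an injective endomorphism of `ℤ_p ^ 10`. -/
theorem measureReal_image (T : (Fin 10 → ℤ_[p]) →+ (Fin 10 → ℤ_[p])) (hT : Continuous T)
    (hinj : Function.Injective T) (X : Set (Fin 10 → ℤ_[p])) :
    (coeffMeasure p).real (T '' X) =
      (coeffMeasure p).real (Set.range T) * (coeffMeasure p).real X := by
  have hemb : MeasurableEmbedding T := (hT.isClosedEmbedding hinj).measurableEmbedding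
  set ν := (coeffMeasure p).comap T with hν
  have hνi : ν.IsAddLeftInvariant := Measure.IsAddLeftInvariant.comap _ hemb
  have hνa (X) : ν X = coeffMeasure p (T '' X) := hemb.comap_apply _ _
  have hνf : IsFiniteMeasure ν := ⟨by rw [hνa]; exact measure_lt_top _ _⟩
  have heq := Measure.isAddInvariant_eq_smul_of_compactSpace ν (coeffMeasure p)
  have h1 (X) : (coeffMeasure p).real (T '' X) =
      (ν.addHaarScalarFactor (coeffMeasure p) : ℝ) * (coeffMeasure p).real X := by
    rw [measureReal_def, ← hνa]
    conv_lhs => rw [heq]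
    rw [Measure.smul_apply, measureReal_def]
    simp [ENNReal.smul_def]
  rw [h1, ← Set.image_univ, h1, probReal_univ, mul_one]

theorem natCard_eq_zero_on {K : Type*} [Field K] [Finite K] {m : ℕ} (I : Finset (Fin m)) :
    Nat.card {r : Fin m → K | ∀ i ∈ I, r i = 0} = Nat.card K ^ (m - I.card) := by
  classical
  have := Fintype.ofFinite K
  have h : {r : Fin m → K | ∀ i ∈ I, r i = 0} =
      (Fintype.piFinset fun i ↦ if i ∈ I then {0} else Finset.univ : Finset (Fin m → K)) := by
    ext r
    simp only [Set.mem_ofPred_eq, Finset.mem_coe, Fintype.mem_piFinset]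
    refine forall_congr' fun i ↦ ?_
    by_cases hi : i ∈ I <;> simp [hi]
  rw [h, Nat.card_coe_set_eq, Set.ncard_coe_finset, Fintype.card_piFinset]
  have h1 (i : Fin m) : (if i ∈ I then {0} else Finset.univ : Finset K).card =
      if i ∈ Iᶜ then Nat.card K else 1 := by
    by_cases hi : i ∈ I <;> simp [hi]
  rw [Finset.prod_congr rfl fun i _ ↦ h1 i, Finset.prod_ite_mem, Finset.univ_inter,
    Finset.prod_const, Finset.card_compl, Fintype.card_fin]

theorem scale_scale (e d : Fin 10 → ℕ) (c : Fin 10 → ℤ_[p]) :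
    scale e (scale d c) = scale (fun i ↦ e i + d i) c := by
  ext1 i
  simp only [scale, pow_add]
  ring

theorem ne_zero_of_prime : (p : ℤ_[p]) ≠ 0 := by
  exact_mod_cast (Fact.out : p.Prime).ne_zero

/-- Reparametrising the forms with residue in `K`, whose coefficients with index in `I` are
divisible by `p`. -/
theorem insolMass_scale {e e' : Fin 10 → ℕ} (I : Finset (Fin 10))
    (he : ∀ i, e' i = e i + if i ∈ I then 1 else 0) {K K' : Set (Fin 10 → ZMod p)}
    (hK : ∀ r ∈ K, ∀ i ∈ I, r i = 0)
    (hK' : ∀ r, r ∈ K' ↔ (fun i ↦ if i ∈ I then 0 else r i) ∈ K) :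
    insolMass e K = ((p : ℝ) ^ I.card)⁻¹ * insolMass e' K' := by
  set d : Fin 10 → ℕ := fun i ↦ if i ∈ I then 1 else 0 with hd
  let T : (Fin 10 → ℤ_[p]) →+ (Fin 10 → ℤ_[p]) :=
    { toFun := scale d
      map_zero' := by ext1 i; simp [scale]
      map_add' := fun a b ↦ by ext1 i; simp only [scale, Pi.add_apply]; ring }
  have hTc : Continuous T := by
    change Continuous (scale d)
    unfold scale
    fun_prop
  have hTi : Function.Injective T := by
    intro a b hab
    ext1 i
    exact mul_left_cancel₀ (pow_ne_zero _ ne_zero_of_prime) (congrFun hab i)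
  have hred (c : Fin 10 → ℤ_[p]) : reduce (T c) = fun i ↦ if i ∈ I then 0 else reduce c i := by
    ext1 i
    by_cases hi : i ∈ I <;> simp [T, scale, reduce, hd, hi]
  have hrange : Set.range T = {c | reduce c ∈ {r : Fin 10 → ZMod p | ∀ i ∈ I, r i = 0}} := by
    ext c
    constructor
    · rintro ⟨c, rfl⟩ i hi
      rw [hred]
      simp [hi]
    · intro hc
      have h (i) : ∃ y, c i = (p : ℤ_[p]) ^ d i * y := by
        by_cases hi : i ∈ I
        · obtain ⟨y, hy⟩ := toZMod_eq_zero_iff.1 (hc i hi)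
          exact ⟨y, by simpa [hd, hi] using hy⟩
        · exact ⟨c i, by simp [hd, hi]⟩
      choose y hy using h
      exact ⟨y, (funext hy).symm⟩
  have himage : {c | reduce c ∈ K ∧ ¬ Soluble (scale e c)} =
      T '' {c | reduce c ∈ K' ∧ ¬ Soluble (scale e' c)} := by
    have hscale (c : Fin 10 → ℤ_[p]) : scale e (T c) = scale e' c := by
      rw [show e' = fun i ↦ e i + d i from funext he, ← scale_scale]
      rfl
    ext c
    constructor
    · rintro ⟨hc, hs⟩
      have hc' : c ∈ Set.range T := by
        rw [hrange]
        exact hK _ hc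
      obtain ⟨c, rfl⟩ := hc'
      refine ⟨c, ⟨?_, ?_⟩, rfl⟩
      · rw [hK', ← hred]
        exact hc
      · rwa [← hscale]
    · rintro ⟨c, ⟨hc, hs⟩, rfl⟩
      refine ⟨?_, ?_⟩
      · rwa [hred, ← hK']
      · rwa [hscale]
  have hp : (p : ℝ) ≠ 0 := by exact_mod_cast (Fact.out : p.Prime).ne_zero
  have hcard : (Nat.card {r : Fin 10 → ZMod p | ∀ i ∈ I, r i = 0} : ℝ) * p ^ I.card = p ^ 10 := by
    rw [natCard_eq_zero_on, Nat.card_zmod, Nat.cast_pow, ← pow_add, Nat.sub_add_cancel]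
    exact (Finset.card_le_univ I).trans_eq (Fintype.card_fin 10)
  rw [insolMass, himage, measureReal_image T hTc hTi, hrange, measureReal_reduce_mem, insolMass]
  congr 1
  field_simp
  exact hcard

/-- The exponents of `X` in the ten cubic monomials. -/
def degX : Fin 10 → ℕ := ![3, 2, 2, 1, 1, 1, 0, 0, 0, 0]

/-- The exponents of `Y` in the ten cubic monomials. -/
def degY : Fin 10 → ℕ := ![0, 1, 0, 2, 1, 0, 3, 2, 1, 0]

/-- The exponents of `Z` in the ten cubic monomials. -/
def degZ : Fin 10 → ℕ := ![0, 0, 1, 0, 1, 2, 0, 1, 2, 3]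

theorem Soluble.of_scale {e e' : Fin 10 → ℕ} {c : Fin 10 → ℤ_[p]} (a b d k k' : ℕ)
    (h : ∀ i, e i + (a * degX i + b * degY i + d * degZ i) + k' = e' i + k)
    (hs : Soluble (scale e' c)) : Soluble (scale e c) := by
  obtain ⟨x, hx, h0⟩ := hs
  have hp0 : (p : ℤ_[p]) ≠ 0 := ne_zero_of_prime
  refine ⟨![(p : ℤ_[p]) ^ a * x 0, (p : ℤ_[p]) ^ b * x 1, (p : ℤ_[p]) ^ d * x 2], ?_, ?_⟩
  · intro hzero
    apply hx
    have h1 := congrFun hzero 0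
    have h2 := congrFun hzero 1
    have h3 := congrFun hzero 2
    simp [hp0] at h1 h2 h3
    ext i
    fin_cases i <;> assumption
  · have H (i) : (p : ℤ_[p]) ^ e i * ((p : ℤ_[p]) ^ a) ^ degX i * ((p : ℤ_[p]) ^ b) ^ degY i *
        ((p : ℤ_[p]) ^ d) ^ degZ i * (p : ℤ_[p]) ^ k' = (p : ℤ_[p]) ^ e' i * (p : ℤ_[p]) ^ k := by
      rw [← pow_add _ (e' i), ← h i]
      ring
    refine (mul_eq_zero.1 ?_).resolve_right (pow_ne_zero k' hp0)
    have h1 : evalAt (scale e' c) x * (p : ℤ_[p]) ^ k = 0 := by rw [h0, zero_mul]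
    have H0 := H 0
    have H1 := H 1
    have H2 := H 2
    have H3 := H 3
    have H4 := H 4
    have H5 := H 5
    have H6 := H 6
    have H7 := H 7
    have H8 := H 8
    have H9 := H 9
    simp only [degX, degY, degZ, Matrix.cons_val] at H0 H1 H2 H3 H4 H5 H6 H7 H8 H9
    simp only [evalAt, scale, Matrix.cons_val] at h1 ⊢
    linear_combination h1 + c 0 * x 0 ^ 3 * H0 + c 1 * x 0 ^ 2 * x 1 * H1 +
      c 2 * x 0 ^ 2 * x 2 * H2 +
      c 3 * x 0 * x 1 ^ 2 * H3 + c 4 * x 0 * x 1 * x 2 * H4 + c 5 * x 0 * x 2 ^ 2 * H5 +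
      c 6 * x 1 ^ 3 * H6 + c 7 * x 1 ^ 2 * x 2 * H7 + c 8 * x 1 * x 2 ^ 2 * H8 +
      c 9 * x 2 ^ 3 * H9

theorem degX_add_degY_add_degZ (i : Fin 10) : degX i + degY i + degZ i = 3 := by
  revert i
  decide

/-- Scaling the variables and dividing by a power of `p` does not affect solubility, so exponents
matter only up to affine functions of the exponents of the monomials. -/
theorem insolMass_congr {e e' : Fin 10 → ℕ} (a b d k k' : ℕ)
    (h : ∀ i, e i + (a * degX i + b * degY i + d * degZ i) + k' = e' i + k)
    (K : Set (Fin 10 → ZMod p)) : insolMass e K = insolMass e' K := by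
  have h' (i : Fin 10) : e' i + ((b + d) * degX i + (a + d) * degY i + (a + b) * degZ i) + k =
      e i + (3 * (a + b + d) + k') := by
    have hsum := degX_add_degY_add_degZ i
    have hi := h i
    zify at hsum hi ⊢
    linear_combination (a + b + d : ℤ) * hsum - hi
  have hiff (c : Fin 10 → ℤ_[p]) : Soluble (scale e c) ↔ Soluble (scale e' c) :=
    ⟨Soluble.of_scale (b + d) (a + d) (a + b) _ k h', Soluble.of_scale a b d k k' h⟩
  simp only [insolMass, hiff]

theorem Soluble.of_subst {c : Fin 10 → ℤ_[p]} {g : Matrix (Fin 3) (Fin 3) ℤ_[p]} (hg : IsUnit g)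
    (hs : Soluble (subst g c)) : Soluble c := by
  obtain ⟨x, hx, h0⟩ := hs
  rw [evalAt_subst] at h0
  refine ⟨_, fun h ↦ hx ?_, h0⟩
  exact Matrix.mulVec_injective_of_isUnit hg (h.trans (Matrix.mulVec_zero g).symm)

theorem soluble_subst_iff {c : Fin 10 → ℤ_[p]} {g : Matrix (Fin 3) (Fin 3) ℤ_[p]} (hg : IsUnit g) :
    Soluble (subst g c) ↔ Soluble c := by
  refine ⟨fun h ↦ h.of_subst hg, fun h ↦ ?_⟩
  obtain ⟨g, rfl⟩ := hg
  refine Soluble.of_subst (g := (g⁻¹ : GL (Fin 3) ℤ_[p]).1) (Units.isUnit _) ?_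
  rw [← subst_mul]
  simpa [subst_one] using h

/-- A matrix lifting a given matrix modulo `p`, with entries `0` and `1` lifting `0` and `1`. -/
noncomputable def liftMatrix (g : Matrix (Fin 3) (Fin 3) (ZMod p)) :
    Matrix (Fin 3) (Fin 3) ℤ_[p] := g.map fun a ↦ (a.val : ℤ_[p])

theorem map_liftMatrix (g : Matrix (Fin 3) (Fin 3) (ZMod p)) :
    (liftMatrix g).map PadicInt.toZMod = g := by
  ext i j
  simp [liftMatrix]

theorem isUnit_liftMatrix (g : GL (Fin 3) (ZMod p)) : IsUnit (liftMatrix g.1) := by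
  rw [Matrix.isUnit_iff_isUnit_det, PadicInt.isUnit_iff, ← toZMod_ne_zero_iff, RingHom.map_det,
    RingHom.mapMatrix_apply, map_liftMatrix]
  exact ((Matrix.isUnit_iff_isUnit_det _).1 g.isUnit).ne_zero

theorem reduce_subst (g : Matrix (Fin 3) (Fin 3) ℤ_[p]) (c : Fin 10 → ℤ_[p]) :
    reduce (subst g c) = subst (g.map PadicInt.toZMod) (reduce c) :=
  (subst_map PadicInt.toZMod g c).symm

/-- Invariance of the measure under linear substitutions. -/
theorem insolMass_subst {e e' : Fin 10 → ℕ} (g : GL (Fin 3) (ZMod p))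
    (h : ∀ c : Fin 10 → ℤ_[p],
      scale e' (subst (liftMatrix g.1) c) = subst (liftMatrix g.1) (scale e c))
    (K : Set (Fin 10 → ZMod p)) :
    insolMass e' K = insolMass e {r | subst g.1 r ∈ K} := by
  set G := liftMatrix g.1 with hG
  have hunit : IsUnit G := isUnit_liftMatrix g
  let L : (Fin 10 → ℤ_[p]) →ₗ[ℤ_[p]] (Fin 10 → ℤ_[p]) :=
    { toFun := subst G
      map_add' := subst_add G
      map_smul' := subst_smul G }
  let T : (Fin 10 → ℤ_[p]) →+ (Fin 10 → ℤ_[p]) := L.toAddMonoidHom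
  have hTc : Continuous T := L.continuous_on_pi
  have hTs : Function.Surjective T := by
    intro c
    obtain ⟨u, hu⟩ := hunit
    refine ⟨subst (u⁻¹ : GL (Fin 3) ℤ_[p]).1 c, ?_⟩
    change subst G _ = c
    rw [← subst_mul, ← hu]
    simp [subst_one]
  have hmp := AddMonoidHom.measurePreserving (μ := coeffMeasure p) (ν := coeffMeasure p) hTc hTs rfl
  have hemb : MeasurableEmbedding T := by
    refine (hTc.isClosedEmbedding ?_).measurableEmbedding
    intro a b hab
    obtain ⟨u, hu⟩ := hunit
    have := congrArg (subst (u⁻¹ : GL (Fin 3) ℤ_[p]).1) hab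
    change subst _ (subst G a) = subst _ (subst G b) at this
    rw [← subst_mul, ← subst_mul, ← hu] at this
    simpa [subst_one] using this
  rw [insolMass, insolMass, measureReal_def, measureReal_def, ← hmp.measure_preimage_emb hemb]
  congr 2
  ext c
  change reduce (subst G c) ∈ K ∧ ¬ Soluble (scale e' (subst G c)) ↔ _
  rw [h, soluble_subst_iff hunit, reduce_subst, hG, map_liftMatrix]
  rfl

end Mass

/-! ### Cubic curves without smooth rational points -/

section Counting

variable {p : ℕ} [Fact p.Prime]

theorem natCard_comp_mem {K : Type*} [Finite K] {k m : ℕ} (σ : Fin k ↪ Fin m)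
    (S : Set (Fin k → K)) :
    Nat.card {r : Fin m → K | r ∘ σ ∈ S} = Nat.card S * Nat.card K ^ (m - k) := by
  classical
  let e : Fin k ⊕ {i // i ∉ Set.range σ} ≃ Fin m :=
    ((Equiv.ofInjective σ σ.injective).sumCongr (Equiv.refl _)).trans
      (Equiv.Set.sumCompl (Set.range σ))
  let e' : (Fin m → K) ≃ (Fin k → K) × ({i // i ∉ Set.range σ} → K) :=
    (e.symm.arrowCongr (Equiv.refl K)).trans (Equiv.sumArrowEquivProdArrow _ _ _)
  have h1 : {r : Fin m → K | r ∘ σ ∈ S} ≃ S × ({i // i ∉ Set.range σ} → K) :=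
    (e'.subtypeEquiv (q := fun t ↦ t.1 ∈ S ∧ True) (fun r ↦ by simp; rfl)).trans
      ((Equiv.subtypeProdEquivProd (p := (· ∈ S)) (q := fun _ ↦ True)).trans
        ((Equiv.refl _).prodCongr (Equiv.subtypeUnivEquiv fun _ ↦ trivial)))
  rw [Nat.card_congr h1, Nat.card_prod, Nat.card_fun]
  congr 2
  have h2 := Fintype.card_congr e
  rw [Fintype.card_sum, Fintype.card_fin, Fintype.card_fin] at h2
  rw [Nat.card_eq_fintype_card]
  omega

/-- Double counting: each residue in `K` lies in exactly `n` of the sets `S i`, which all have the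
same mass. -/
theorem mul_insolMass_eq {ι : Type*} [Finite ι] {e : Fin 10 → ℕ} {K : Set (Fin 10 → ZMod p)}
    (S : ι → Set (Fin 10 → ZMod p)) {n : ℕ} {C : ℝ} (hS : ∀ i, S i ⊆ K)
    (hn : ∀ r ∈ K, Nat.card {i // r ∈ S i} = n) (hC : ∀ i, insolMass e (S i) = C) :
    n * insolMass e K = Nat.card ι * C := by
  classical
  have := Fintype.ofFinite ι
  have h1 : ∑ i, insolMass e (S i) = Nat.card ι * C := by
    rw [Finset.sum_congr rfl fun i _ ↦ hC i, Finset.sum_const, Finset.card_univ, nsmul_eq_mul,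
      Nat.card_eq_fintype_card]
  rw [← h1, insolMass_eq_sum, Finset.mul_sum,
    Finset.sum_congr rfl fun i _ ↦ insolMass_eq_sum e (S i), Finset.sum_comm]
  refine Finset.sum_congr rfl fun r _ ↦ ?_
  by_cases hr : r ∈ K
  · rw [if_pos hr, ← Finset.sum_filter, Finset.sum_const, nsmul_eq_mul, ← hn r hr,
      Nat.card_eq_fintype_card, Fintype.card_subtype]
  · rw [if_neg hr, mul_zero]
    exact (Finset.sum_eq_zero fun i _ ↦ if_neg fun h ↦ hr (hS i h)).symm

end Counting

section Classification

variable {K : Type*} [Field K]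

/-- The cubic curve has a smooth rational point. -/
def HasSmoothZero (r : Fin 10 → K) : Prop :=
  ∃ x w : Fin 3 → K, evalAt r x = 0 ∧ dirDeriv r x w ≠ 0

/-- The only rational point of the cubic curve is the point `v`, which is singular. Over a finite
field, such a curve consists of three conjugate lines through `v`. -/
def IsConcurrent (r : Fin 10 → K) (v : Fin 3 → K) : Prop :=
  v ≠ 0 ∧ (∀ x, evalAt r x = 0 → ∃ t : K, x = t • v) ∧ evalAt r v = 0 ∧ ∀ w, dirDeriv r v w = 0

/-- The cubic curve is the triple line `l = 0`. -/
def IsTripleLine (r : Fin 10 → K) (l : Fin 3 → K) : Prop :=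
  l ≠ 0 ∧ ∃ a : K, a ≠ 0 ∧ r = a • prodLinear l l l

open Matrix

theorem subst_inv_subst (g : GL (Fin 3) K) (r : Fin 10 → K) :
    subst (g⁻¹ : GL (Fin 3) K).1 (subst g.1 r) = r := by
  rw [← subst_mul]
  simp [subst_one]

theorem inv_mulVec_mulVec (g : GL (Fin 3) K) (x : Fin 3 → K) :
    (g⁻¹ : GL (Fin 3) K).1 *ᵥ (g.1 *ᵥ x) = x := by
  rw [mulVec_mulVec]
  simp

theorem mulVec_inv_mulVec (g : GL (Fin 3) K) (x : Fin 3 → K) :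
    g.1 *ᵥ ((g⁻¹ : GL (Fin 3) K).1 *ᵥ x) = x := by
  rw [mulVec_mulVec]
  simp

theorem vecMul_vecMul_inv (g : GL (Fin 3) K) (x : Fin 3 → K) :
    (x ᵥ* g.1) ᵥ* (g⁻¹ : GL (Fin 3) K).1 = x := by
  rw [vecMul_vecMul]
  simp

theorem IsConcurrent.subst {r : Fin 10 → K} {v : Fin 3 → K} (g : GL (Fin 3) K)
    (h : IsConcurrent r (g.1 *ᵥ v)) : IsConcurrent (subst g.1 r) v := by
  obtain ⟨h1, h2, h3, h4⟩ := h
  refine ⟨?_, fun x hx ↦ ?_, by rwa [evalAt_subst], fun w ↦ by rw [dirDeriv_subst]; exact h4 _⟩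
  · rintro rfl
    exact h1 (mulVec_zero _)
  · rw [evalAt_subst] at hx
    obtain ⟨t, ht⟩ := h2 _ hx
    refine ⟨t, ?_⟩
    rw [← inv_mulVec_mulVec g x, ht, mulVec_smul, inv_mulVec_mulVec]

theorem isConcurrent_subst_iff (g : GL (Fin 3) K) {r : Fin 10 → K} {v : Fin 3 → K} :
    IsConcurrent (TernaryCubic.subst g.1 r) v ↔ IsConcurrent r (g.1 *ᵥ v) := by
  refine ⟨fun h ↦ ?_, fun h ↦ h.subst⟩
  rw [← subst_inv_subst g r]
  refine IsConcurrent.subst _ ?_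
  rwa [inv_mulVec_mulVec]

theorem IsTripleLine.subst {r : Fin 10 → K} {l : Fin 3 → K} (g : GL (Fin 3) K)
    (h : IsTripleLine r l) : IsTripleLine (subst g.1 r) (l ᵥ* g.1) := by
  obtain ⟨h1, a, ha, h2⟩ := h
  refine ⟨fun h0 ↦ h1 ?_, a, ha, by rw [h2, subst_smul, subst_prodLinear]⟩
  rw [← vecMul_vecMul_inv g l, h0, zero_vecMul]

theorem isTripleLine_subst_iff (g : GL (Fin 3) K) {r : Fin 10 → K} {l : Fin 3 → K} :
    IsTripleLine (TernaryCubic.subst g.1 r) (l ᵥ* g.1) ↔ IsTripleLine r l := by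
  refine ⟨fun h ↦ ?_, fun h ↦ h.subst g⟩
  rw [← subst_inv_subst g r, ← vecMul_vecMul_inv g l]
  exact h.subst _

/-- Normal form of the concurrent lines through `(0 : 0 : 1)`: no monomial containing `z` occurs. -/
theorem isConcurrent_iff {r : Fin 10 → K} :
    IsConcurrent r ![0, 0, 1] ↔
      BinAnisotropic (restrictLine r) ∧ r 2 = 0 ∧ r 4 = 0 ∧ r 5 = 0 ∧ r 7 = 0 ∧ r 8 = 0 ∧
        r 9 = 0 := by
  constructor
  · rintro ⟨-, h1, h2, h3⟩
    have hbin : BinAnisotropic (restrictLine r) := by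
      intro x y hxy h0
      rw [← evalAt_line] at h0
      obtain ⟨t, ht⟩ := h1 _ h0
      have hx := congrFun ht 0
      have hy := congrFun ht 1
      simp at hx hy
      simp [hx, hy] at hxy
    have h9 : r 9 = 0 := by simpa [evalAt] using h2
    have h5 : r 5 = 0 := by simpa [dirDeriv] using h3 ![1, 0, 0]
    have h8 : r 8 = 0 := by simpa [dirDeriv] using h3 ![0, 1, 0]
    -- If the coefficient `q x y` of `z` did not vanish at `(x, y)`, the line through the point
    -- and `(x : y : 0)` would contain another zero.
    have hq (x y : K) (hxy : x ≠ 0 ∨ y ≠ 0) : r 2 * x ^ 2 + r 4 * x * y + r 7 * y ^ 2 = 0 := by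
      by_contra hne
      obtain ⟨z, hz⟩ : ∃ z, (r 2 * x ^ 2 + r 4 * x * y + r 7 * y ^ 2) * z =
          -evalBin (restrictLine r) x y := ⟨_, mul_div_cancel₀ _ hne⟩
      obtain ⟨t, ht⟩ := h1 ![x, y, z] (by
        simp [evalAt, h9, h5, h8, evalBin, restrictLine] at hz ⊢
        linear_combination hz)
      have hx := congrFun ht 0
      have hy := congrFun ht 1
      simp at hx hy
      simp [hx, hy] at hxy
    have h2' : r 2 = 0 := by simpa using hq 1 0 (by simp)
    have h7' : r 7 = 0 := by simpa using hq 0 1 (by simp)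
    have h4' : r 4 = 0 := by simpa [h2', h7'] using hq 1 1 (by simp)
    exact ⟨hbin, h2', h4', h5, h7', h8, h9⟩
  · rintro ⟨hbin, h2, h4, h5, h7, h8, h9⟩
    refine ⟨fun h ↦ by simpa using congrFun h 2, fun x hx ↦ ⟨x 2, ?_⟩, ?_, fun w ↦ ?_⟩
    · have h0 : evalBin (restrictLine r) (x 0) (x 1) = 0 := by
        rw [← hx]
        simp [evalBin, restrictLine, evalAt, h2, h4, h5, h7, h8, h9]
      have h1 : x 0 = 0 ∧ x 1 = 0 := by
        by_contra hne
        exact hbin _ _ (by tauto) h0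
      ext i
      fin_cases i <;> simp [h1]
    · simp [evalAt, h9]
    · simp [dirDeriv, h9, h5, h8]

theorem isTripleLine_iff {r : Fin 10 → K} :
    IsTripleLine r ![1, 0, 0] ↔ r 0 ≠ 0 ∧ ∀ i, i ≠ 0 → r i = 0 := by
  constructor
  · rintro ⟨-, a, ha, rfl⟩
    refine ⟨by simpa [prodLinear] using ha, fun i hi ↦ ?_⟩
    fin_cases i <;> simp [prodLinear] at hi ⊢
  · rintro ⟨h0, h⟩
    refine ⟨fun h ↦ by simpa using congrFun h 0, r 0, h0, ?_⟩
    ext i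
    by_cases hi : i = 0
    · subst hi
      simp [prodLinear]
    · rw [h i hi]
      fin_cases i <;> simp [prodLinear] at hi ⊢

theorem exists_mulVec_eq_and {v w : Fin 3 → K} (hv : v ≠ 0) (hw : ¬ ∃ t : K, w = t • v) :
    ∃ g : GL (Fin 3) K, g.1 *ᵥ ![0, 0, 1] = v ∧ g.1 *ᵥ ![0, 1, 0] = w := by
  obtain ⟨g, hg⟩ := exists_mulVec_eq hv
  set w' := (g⁻¹ : GL (Fin 3) K).1 *ᵥ w with hw'
  have hgw : g.1 *ᵥ w' = w := mulVec_inv_mulVec g w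
  have hne : w' 0 ≠ 0 ∨ w' 1 ≠ 0 := by
    by_contra! h
    refine hw ⟨w' 2, ?_⟩
    rw [← hg, ← mulVec_smul, ← hgw]
    congr 1
    ext i
    fin_cases i <;> simp [h]
  have key (A : Matrix (Fin 3) (Fin 3) K) (hA : A.det ≠ 0) (h3 : A *ᵥ ![0, 0, 1] = ![0, 0, 1])
      (h2 : A *ᵥ ![0, 1, 0] = w') :
      ∃ g : GL (Fin 3) K, g.1 *ᵥ ![0, 0, 1] = v ∧ g.1 *ᵥ ![0, 1, 0] = w := by
    refine ⟨g * GeneralLinearGroup.mkOfDetNeZero A hA, ?_, ?_⟩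
    · change (g.1 * A) *ᵥ _ = _
      rw [← mulVec_mulVec, h3, hg]
    · change (g.1 * A) *ᵥ _ = _
      rw [← mulVec_mulVec, h2, hgw]
  rcases hne with h | h
  · refine key !![0, w' 0, 0; 1, w' 1, 0; 0, w' 2, 1] ?_ ?_ ?_
    · simp [det_fin_three, h]
    · ext i
      fin_cases i <;> simp
    · ext i
      fin_cases i <;> simp
  · refine key !![1, w' 0, 0; 0, w' 1, 0; 0, w' 2, 1] ?_ ?_ ?_
    · simp [det_fin_three, h]
    · ext i
      fin_cases i <;> simp
    · ext i
      fin_cases i <;> simp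

/-- A cubic form without smooth rational zeros is anisotropic, a triple of concurrent conjugate
lines, a triple line, or zero. -/
theorem classification {r : Fin 10 → K} (h : ¬ HasSmoothZero r) :
    Anisotropic r ∨ (∃ v, IsConcurrent r v) ∨ (∃ l, IsTripleLine r l) ∨ r = 0 := by
  have hsing : ∀ x w, evalAt r x = 0 → dirDeriv r x w = 0 := by
    intro x w hx
    by_contra hne
    exact h ⟨x, w, hx, hne⟩
  by_cases ha : Anisotropic r
  · exact Or.inl ha
  obtain ⟨v, hv, hv0⟩ : ∃ v, v ≠ 0 ∧ evalAt r v = 0 := by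
    simpa [Anisotropic] using ha
  by_cases hc : ∀ x, evalAt r x = 0 → ∃ t : K, x = t • v
  · exact Or.inr (Or.inl ⟨v, hv, hc, hv0, fun w ↦ hsing v w hv0⟩)
  push Not at hc
  obtain ⟨w, hw0, hw⟩ := hc
  refine Or.inr (Or.inr ?_)
  obtain ⟨g, hg3, hg2⟩ := exists_mulVec_eq_and hv (by simpa using hw)
  set s := TernaryCubic.subst g.1 r with hs
  have hsing' : ∀ x w, evalAt s x = 0 → dirDeriv s x w = 0 := by
    intro x w hx
    rw [hs, evalAt_subst] at hx
    rw [hs, dirDeriv_subst]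
    exact hsing _ _ hx
  have hv' : evalAt s ![0, 0, 1] = 0 := by rw [hs, evalAt_subst, hg3, hv0]
  have hw' : evalAt s ![0, 1, 0] = 0 := by rw [hs, evalAt_subst, hg2, hw0]
  have s9 : s 9 = 0 := by simpa [evalAt] using hv'
  have s6 : s 6 = 0 := by simpa [evalAt] using hw'
  have s5 : s 5 = 0 := by simpa [dirDeriv] using hsing' _ ![1, 0, 0] hv'
  have s8 : s 8 = 0 := by simpa [dirDeriv] using hsing' _ ![0, 1, 0] hv'
  have s3 : s 3 = 0 := by simpa [dirDeriv] using hsing' _ ![1, 0, 0] hw'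
  have s7 : s 7 = 0 := by simpa [dirDeriv] using hsing' _ ![0, 0, 1] hw'
  have s4 : s 4 = 0 := by
    simpa [dirDeriv, s3, s5] using hsing' ![0, 1, 1] ![1, 0, 0] (by simp [evalAt, s6, s7, s8, s9])
  have s1 : s 1 = 0 := by
    by_contra hne
    have := hsing' ![1, -(s 0 / s 1), 0] ![0, 1, 0] (by
      simp [evalAt, s3, s6]
      field_simp
      ring)
    simp [dirDeriv, s3, s6] at this
    exact hne this
  have s2 : s 2 = 0 := by
    by_contra hne
    have := hsing' ![1, 0, -(s 0 / s 2)] ![0, 0, 1] (by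
      simp [evalAt, s5, s9]
      field_simp
      ring)
    simp [dirDeriv, s5, s9] at this
    exact hne this
  have hzero : ∀ i, i ≠ 0 → s i = 0 := by
    intro i hi
    fin_cases i
    · exact absurd rfl hi
    all_goals assumption
  by_cases s0 : s 0 = 0
  · right
    have h0 : s = 0 := by
      ext i
      by_cases hi : i = 0
      · rw [hi, s0]
        rfl
      · exact hzero i hi
    rw [← subst_inv_subst g r, ← hs, h0]
    simpa using subst_smul (g⁻¹ : GL (Fin 3) K).1 (0 : K) 0
  · left
    refine ⟨![1, 0, 0] ᵥ* (g⁻¹ : GL (Fin 3) K).1, ?_⟩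
    rw [← subst_inv_subst g r]
    exact (isTripleLine_iff.2 ⟨s0, hzero⟩).subst _

end Classification

/-! ### Masses of classes of residues -/

section ResidueClasses

variable {p : ℕ} [Fact p.Prime]

open Matrix

/-- The residue modulo `p` of the form with coefficients `p ^ e i * c i`, in terms of the residue
`r` of `c`. -/
def residue (e : Fin 10 → ℕ) (r : Fin 10 → ZMod p) : Fin 10 → ZMod p :=
  fun i ↦ if e i = 0 then r i else 0

theorem reduce_scale (e : Fin 10 → ℕ) (c : Fin 10 → ℤ_[p]) :
    reduce (scale e c) = residue e (reduce c) := by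
  ext1 i
  by_cases h : e i = 0 <;> simp [reduce, scale, residue, h]

theorem scale_zero (c : Fin 10 → ℤ_[p]) : scale 0 c = c := by
  ext1 i
  simp [scale]

theorem residue_zero (r : Fin 10 → ZMod p) : residue 0 r = r := by
  ext1 i
  simp [residue]

/-- By Hensel's lemma, residues with a smooth zero do not contribute to the mass of insoluble
forms. -/
theorem insolMass_of_smooth {e : Fin 10 → ℕ} {K : Set (Fin 10 → ZMod p)}
    (h : ∀ r ∈ K, HasSmoothZero (residue e r)) : insolMass e K = 0 := by
  refine insolMass_of_soluble fun c hc ↦ ?_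
  obtain ⟨x, w, h0, h1⟩ := h _ hc
  rw [← reduce_scale] at h0 h1
  exact soluble_of_smooth x w h0 h1

theorem insolMass_restrict {e : Fin 10 → ℕ} {K K' : Set (Fin 10 → ZMod p)} (hK : K' ⊆ K)
    (h : ∀ r ∈ K, r ∉ K' → HasSmoothZero (residue e r)) : insolMass e K = insolMass e K' := by
  rw [insolMass_split e K K', Set.inter_eq_self_of_subset_right hK,
    insolMass_of_smooth (K := K \ K') fun r hr ↦ h r hr.1 hr.2, add_zero]

theorem IsConcurrent.not_anisotropic {K : Type*} [Field K] {r : Fin 10 → K} {v : Fin 3 → K}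
    (h : IsConcurrent r v) : ¬ Anisotropic r := fun ha ↦ ha v h.1 h.2.2.1

theorem IsConcurrent.eq_smul {K : Type*} [Field K] {r : Fin 10 → K} {v w : Fin 3 → K}
    (h : IsConcurrent r v) (h' : IsConcurrent r w) : ∃ t : K, t ≠ 0 ∧ w = t • v := by
  obtain ⟨t, rfl⟩ := h.2.1 w h'.2.2.1
  refine ⟨t, ?_, rfl⟩
  rintro rfl
  exact h'.1 (zero_smul _ _)

theorem IsConcurrent.smul {K : Type*} [Field K] {r : Fin 10 → K} {v : Fin 3 → K}
    (h : IsConcurrent r v) {t : K} (ht : t ≠ 0) : IsConcurrent r (t • v) := by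
  obtain ⟨h1, h2, h3, h4⟩ := h
  refine ⟨smul_ne_zero ht h1, fun x hx ↦ ?_, by rw [evalAt_smul, h3, mul_zero], fun w ↦ ?_⟩
  · obtain ⟨s, rfl⟩ := h2 x hx
    exact ⟨s / t, by rw [smul_smul, div_mul_cancel₀ _ ht]⟩
  · have : dirDeriv r (t • v) w = t ^ 2 * dirDeriv r v w := by
      simp only [dirDeriv, Pi.smul_apply, smul_eq_mul]
      ring
    rw [this, h4, mul_zero]

theorem exists_ne_zero_dotProduct_eq_zero {K : Type*} [Field K] (l : Fin 3 → K) :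
    ∃ x y : K, (x ≠ 0 ∨ y ≠ 0) ∧ l ⬝ᵥ ![x, y, 0] = 0 := by
  by_cases h : l 1 = 0
  · exact ⟨0, 1, by simp, by simp [dotProduct, Fin.sum_univ_three, h]⟩
  · exact ⟨-l 1, l 0, by simp [h], by simp [dotProduct, Fin.sum_univ_three]; ring⟩

theorem IsTripleLine.evalAt_eq_zero_iff {K : Type*} [Field K] {r : Fin 10 → K} {l : Fin 3 → K}
    (h : IsTripleLine r l) (x : Fin 3 → K) : evalAt r x = 0 ↔ l ⬝ᵥ x = 0 := by
  obtain ⟨-, a, ha, rfl⟩ := h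
  rw [evalAt_smul_left, evalAt_prodLinear]
  simp [ha]

theorem IsTripleLine.not_restrictLine {K : Type*} [Field K] {r : Fin 10 → K} {l : Fin 3 → K}
    (h : IsTripleLine r l) : ¬ BinAnisotropic (restrictLine r) := by
  intro hb
  obtain ⟨x, y, hxy, h0⟩ := exists_ne_zero_dotProduct_eq_zero l
  apply hb x y hxy
  rw [← evalAt_line]
  exact (h.evalAt_eq_zero_iff _).2 h0

theorem IsTripleLine.not_anisotropic {K : Type*} [Field K] {r : Fin 10 → K} {l : Fin 3 → K}
    (h : IsTripleLine r l) : ¬ Anisotropic r := by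
  intro ha
  obtain ⟨x, y, hxy, h0⟩ := exists_ne_zero_dotProduct_eq_zero l
  refine ha ![x, y, 0] (fun h1 ↦ ?_) ((h.evalAt_eq_zero_iff _).2 h0)
  have hx := congrFun h1 0
  have hy := congrFun h1 1
  simp at hx hy
  tauto

theorem IsTripleLine.not_isConcurrent {K : Type*} [Field K] {r : Fin 10 → K} {l v : Fin 3 → K}
    (h : IsTripleLine r l) : ¬ IsConcurrent r v := by
  intro hc
  obtain ⟨a, b, hab⟩ : ∃ a b : Fin 3 → K, (l ⬝ᵥ a = 0 ∧ l ⬝ᵥ b = 0) ∧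
      ∀ s t : K, s • a = t • b → s = 0 ∧ t = 0 := by
    by_cases h0 : l 0 = 0
    · by_cases h1 : l 1 = 0
      · refine ⟨![1, 0, 0], ![0, 1, 0], by simp [dotProduct, Fin.sum_univ_three, h0, h1], ?_⟩
        intro s t hst
        have hx := congrFun hst 0
        have hy := congrFun hst 1
        simp at hx hy
        exact ⟨hx, hy.symm⟩
      · refine ⟨![1, 0, 0], ![0, -l 2, l 1], by
          simp [dotProduct, Fin.sum_univ_three, h0]; ring, ?_⟩
        intro s t hst
        have hx := congrFun hst 0
        have hz := congrFun hst 2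
        simp [h1] at hx hz
        exact ⟨hx, hz⟩
    · refine ⟨![-l 1, l 0, 0], ![-l 2, 0, l 0], by
        simp [dotProduct, Fin.sum_univ_three]; constructor <;> ring, ?_⟩
      intro s t hst
      have hy := congrFun hst 1
      have hz := congrFun hst 2
      simp [h0] at hy hz
      exact ⟨hy, hz⟩
  obtain ⟨s, rfl⟩ := hc.2.1 a ((h.evalAt_eq_zero_iff _).2 hab.1.1)
  obtain ⟨t, rfl⟩ := hc.2.1 b ((h.evalAt_eq_zero_iff _).2 hab.1.2)
  have h1 := hab.2 t s (by rw [smul_smul, smul_smul, mul_comm])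
  have h2 := hab.2 1 0 (by simp [h1.2])
  exact one_ne_zero h2.1

theorem IsTripleLine.eq_smul {K : Type*} [Field K] {r : Fin 10 → K} {l m : Fin 3 → K}
    (h : IsTripleLine r l) (h' : IsTripleLine r m) : ∃ t : K, t ≠ 0 ∧ m = t • l := by
  have hz (x) : l ⬝ᵥ x = 0 ↔ m ⬝ᵥ x = 0 := by
    rw [← h.evalAt_eq_zero_iff, h'.evalAt_eq_zero_iff]
  have key (i j : Fin 3) : l i * m j = l j * m i := by
    have h1 := (hz (l i • Pi.single j 1 - l j • Pi.single i 1)).1 (by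
      rw [dotProduct_sub, dotProduct_smul, dotProduct_smul, dotProduct_single, dotProduct_single]
      simp
      ring)
    rw [dotProduct_sub, dotProduct_smul, dotProduct_smul, dotProduct_single,
      dotProduct_single] at h1
    simp at h1
    linear_combination h1
  obtain ⟨i, hi⟩ : ∃ i, l i ≠ 0 := by
    by_contra! hall
    exact h.1 (funext hall)
  have hm : m = (m i / l i) • l := by
    ext j
    have := key i j
    simp only [Pi.smul_apply, smul_eq_mul]
    field_simp
    linear_combination this
  refine ⟨_, ?_, hm⟩
  intro h0
  rw [h0, zero_smul] at hm
  exact h'.1 hm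

theorem IsTripleLine.smul {K : Type*} [Field K] {r : Fin 10 → K} {l : Fin 3 → K}
    (h : IsTripleLine r l) {t : K} (ht : t ≠ 0) : IsTripleLine r (t • l) := by
  obtain ⟨h1, a, ha, rfl⟩ := h
  refine ⟨smul_ne_zero ht h1, a / t ^ 3, div_ne_zero ha (pow_ne_zero _ ht), ?_⟩
  ext i
  fin_cases i <;> simp [prodLinear] <;> field_simp

/-- The mass of a set of residues, by the type of the residual curve. -/
theorem insolMass_decompose (e : Fin 10 → ℕ) (K : Set (Fin 10 → ZMod p)) :
    insolMass e K = insolMass e {r | r ∈ K ∧ Anisotropic (residue e r)} +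
      insolMass e {r | r ∈ K ∧ ∃ v, IsConcurrent (residue e r) v} +
      insolMass e {r | r ∈ K ∧ ∃ l, IsTripleLine (residue e r) l} +
      insolMass e {r | r ∈ K ∧ residue e r = 0} := by
  rw [← insolMass_union, ← insolMass_union, ← insolMass_union]
  · refine insolMass_restrict ?_ ?_
    · rintro r (((h | h) | h) | h) <;> exact h.1
    · intro r hr hr'
      by_contra hs
      apply hr'
      rcases classification hs with h | h | h | h
      · exact Or.inl (Or.inl (Or.inl ⟨hr, h⟩))
      · exact Or.inl (Or.inl (Or.inr ⟨hr, h⟩))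
      · exact Or.inl (Or.inr ⟨hr, h⟩)
      · exact Or.inr ⟨hr, h⟩
  · rw [Set.disjoint_left]
    rintro r ((h | ⟨-, v, hv⟩) | ⟨-, l, hl⟩) ⟨-, h0⟩
    · refine h.2 ![1, 0, 0] (fun h ↦ by simpa using congrFun h 0) ?_
      rw [h0]
      simp [evalAt]
    · obtain ⟨t, ht⟩ := hv.2.1 ![1, 0, 0] (by rw [h0]; simp [evalAt])
      obtain ⟨s, hs⟩ := hv.2.1 ![0, 1, 0] (by rw [h0]; simp [evalAt])
      have h1 := congrFun ht 0
      have h2 := congrFun ht 1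
      have h3 := congrFun hs 0
      have h4 := congrFun hs 1
      simp at h1 h2 h3 h4
      rcases h2 with h2 | h2
      · simp [h2] at h1
      · simp [h2] at h4
    · have h2 (x : Fin 3 → ZMod p) : l ⬝ᵥ x = 0 :=
        (hl.evalAt_eq_zero_iff x).1 (by rw [h0]; simp [evalAt])
      apply hl.1
      ext i
      simpa using h2 (Pi.single i 1)
  · rw [Set.disjoint_left]
    rintro r (h | ⟨-, v, hv⟩) ⟨-, l, hl⟩
    · exact hl.not_anisotropic h.2
    · exact hl.not_isConcurrent hv
  · rw [Set.disjoint_left]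
    rintro r h ⟨-, v, hv⟩
    exact hv.not_anisotropic h.2

theorem natCard_vanishing_diff {m : ℕ} {I J : Finset (Fin m)} (hIJ : I ⊆ J) :
    (Nat.card {v : Fin m → ZMod p // (∀ i ∈ I, v i = 0) ∧ ∃ j ∈ J, v j ≠ 0} : ℝ) =
      (p : ℝ) ^ (m - I.card) - (p : ℝ) ^ (m - J.card) := by
  have h1 := natCard_eq_zero_on (K := ZMod p) I
  have h2 := natCard_eq_zero_on (K := ZMod p) J
  rw [Nat.card_coe_set_eq, Nat.card_zmod] at h1 h2
  have h3 : {v : Fin m → ZMod p | ∀ i ∈ J, v i = 0} ⊆ {v | ∀ i ∈ I, v i = 0} :=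
    fun v hv i hi ↦ hv i (hIJ hi)
  have h4 := Set.ncard_sdiff_add_ncard_of_subset h3
  have h5 : {v : Fin m → ZMod p | (∀ i ∈ I, v i = 0) ∧ ∃ j ∈ J, v j ≠ 0} =
      {v | ∀ i ∈ I, v i = 0} \ {v | ∀ i ∈ J, v i = 0} := by
    ext v
    simp
  have h6 : Nat.card {v : Fin m → ZMod p // (∀ i ∈ I, v i = 0) ∧ ∃ j ∈ J, v j ≠ 0} =
      Set.ncard {v : Fin m → ZMod p | (∀ i ∈ I, v i = 0) ∧ ∃ j ∈ J, v j ≠ 0} := rfl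
  rw [h6, h5, eq_sub_iff_add_eq]
  rw [h1, h2] at h4
  exact_mod_cast h4

theorem natCard_eq_sub_one {ι : Type*} {P : (Fin 3 → ZMod p) → Prop} {v : Fin 3 → ZMod p}
    (f : ι → Fin 3 → ZMod p) (hf : Function.Injective f) (hfP : ∀ w, P w → ∃ i, f i = w)
    (hv : v ≠ 0) (hP : ∀ w, P w ↔ ∃ t : ZMod p, t ≠ 0 ∧ w = t • v) :
    Nat.card {i // P (f i)} = p - 1 := by
  have e : (ZMod p)ˣ ≃ {i // P (f i)} := by
    have h1 (t : (ZMod p)ˣ) : ∃ i, f i = t.1 • v := hfP _ ((hP _).2 ⟨t, t.ne_zero, rfl⟩)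
    choose g hg using h1
    refine Equiv.ofBijective (fun t ↦ ⟨g t, by rw [hg]; exact (hP _).2 ⟨t, t.ne_zero, rfl⟩⟩)
      ⟨fun s t hst ↦ ?_, fun ⟨i, hi⟩ ↦ ?_⟩
    · have h2 : g s = g t := congrArg Subtype.val hst
      have h3 := congrArg f h2
      rw [hg, hg] at h3
      exact Units.ext (smul_left_injective _ hv h3)
    · obtain ⟨t, ht, hit⟩ := (hP _).1 hi
      refine ⟨Units.mk0 t ht, Subtype.ext (hf ?_)⟩
      rw [hg, hit]
      rfl
  rw [← Nat.card_congr e, Nat.card_units, Nat.card_zmod]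

theorem cast_prime_sub_one : ((p - 1 : ℕ) : ℝ) = p - 1 := by
  rw [Nat.cast_sub (Fact.out : p.Prime).one_le, Nat.cast_one]

/-- The mass of the triple lines, as a sum over the lines. -/
theorem insolMass_tripleLine {e : Fin 10 → ℕ} {K : Set (Fin 10 → ZMod p)} {C : ℝ}
    {I J : Finset (Fin 3)} (hIJ : I ⊆ J)
    (hP : ∀ r ∈ K, ∀ l, IsTripleLine (residue e r) l → (∀ i ∈ I, l i = 0) ∧ ∃ j ∈ J, l j ≠ 0)
    (hC : ∀ l : Fin 3 → ZMod p, (∀ i ∈ I, l i = 0) → (∃ j ∈ J, l j ≠ 0) →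
      insolMass e {r | r ∈ K ∧ IsTripleLine (residue e r) l} = C) :
    (p - 1) * insolMass e {r | r ∈ K ∧ ∃ l, IsTripleLine (residue e r) l} =
      ((p : ℝ) ^ (3 - I.card) - (p : ℝ) ^ (3 - J.card)) * C := by
  rw [← natCard_vanishing_diff hIJ, ← cast_prime_sub_one]
  refine mul_insolMass_eq (fun l ↦ {r | r ∈ K ∧ IsTripleLine (residue e r) l.1})
    (fun l r hr ↦ ⟨hr.1, l, hr.2⟩) ?_ fun l ↦ hC l.1 l.2.1 l.2.2
  rintro r ⟨hr, l, hl⟩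
  refine natCard_eq_sub_one (P := fun l ↦ r ∈ K ∧ IsTripleLine (residue e r) l) Subtype.val
    Subtype.val_injective (fun w hw ↦ ⟨⟨w, hP r hr w hw.2⟩, rfl⟩) hl.1 fun w ↦ ?_
  constructor
  · intro hw
    exact hl.eq_smul hw.2
  · rintro ⟨t, ht, rfl⟩
    exact ⟨hr, hl.smul ht⟩

/-- The mass of the triples of concurrent conjugate lines, as a sum over their centres. -/
theorem insolMass_concurrent {K : Set (Fin 10 → ZMod p)} {C : ℝ} (J : Finset (Fin 3))
    (hP : ∀ r v, IsConcurrent r v → (r ∈ K ↔ ∃ j ∈ J, v j ≠ 0))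
    (hC : ∀ v : Fin 3 → ZMod p, v ≠ 0 → insolMass 0 {r | IsConcurrent r v} = C) :
    (p - 1) * insolMass 0 {r | r ∈ K ∧ ∃ v, IsConcurrent (residue 0 r) v} =
      ((p : ℝ) ^ 3 - (p : ℝ) ^ (3 - J.card)) * C := by
  rw [show (p : ℝ) ^ 3 = (p : ℝ) ^ (3 - (∅ : Finset (Fin 3)).card) by simp,
    ← natCard_vanishing_diff (Finset.empty_subset J), ← cast_prime_sub_one]
  simp only [residue_zero]
  refine mul_insolMass_eq (ι := {v : Fin 3 → ZMod p //
      (∀ i ∈ (∅ : Finset (Fin 3)), v i = 0) ∧ ∃ j ∈ J, v j ≠ 0}) (fun v ↦ {r | IsConcurrent r v.1})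
    (fun v r (hr : IsConcurrent r v.1) ↦ ⟨(hP r v.1 hr).2 v.2.2, v.1, hr⟩) ?_ fun v ↦ hC v.1 ?_
  · rintro r ⟨hr, v, hv⟩
    refine natCard_eq_sub_one (P := fun v ↦ IsConcurrent r v) Subtype.val
      Subtype.val_injective (fun w hw ↦ ⟨⟨w, by simp, (hP r w hw).1 hr⟩, rfl⟩) hv.1 fun w ↦ ?_
    constructor
    · intro hw
      exact hv.eq_smul hw
    · rintro ⟨t, ht, rfl⟩
      exact hv.smul ht
  · obtain ⟨j, -, hj⟩ := v.2.2
    intro h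
    exact hj (congrFun h j)

/-- The mass is the same for all centres. -/
theorem insolMass_isConcurrent {v : Fin 3 → ZMod p} (hv : v ≠ 0) :
    insolMass 0 {r | IsConcurrent r v} =
      insolMass 0 {r : Fin 10 → ZMod p | IsConcurrent r ![0, 0, 1]} := by
  obtain ⟨g, rfl⟩ := exists_mulVec_eq hv
  rw [insolMass_subst (e := 0) g (fun c ↦ by rw [scale_zero, scale_zero])
    {r | IsConcurrent r ![0, 0, 1]}]
  simp only [Set.mem_ofPred_eq, isConcurrent_subst_iff]

/-- The mass is the same for all lines. -/
theorem insolMass_isTripleLine {l : Fin 3 → ZMod p} (hl : l ≠ 0) :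
    insolMass 0 {r | IsTripleLine r l} =
      insolMass 0 {r : Fin 10 → ZMod p | IsTripleLine r ![1, 0, 0]} := by
  have key (l : Fin 3 → ZMod p) (hl : l ≠ 0) :
      insolMass 0 {r | IsTripleLine r l} =
        insolMass 0 {r : Fin 10 → ZMod p | IsTripleLine r ![0, 0, 1]} := by
    obtain ⟨g, hg⟩ := exists_vecMul_eq hl
    rw [insolMass_subst (e := 0) g (fun c ↦ by rw [scale_zero, scale_zero])
      {r | IsTripleLine r ![0, 0, 1]}]
    simp only [Set.mem_ofPred_eq, ← hg, isTripleLine_subst_iff]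
  rw [key l hl, key ![1, 0, 0] fun h ↦ by simpa using congrFun h 0]

end ResidueClasses

/-! ### Substitutions respecting the degree in one variable -/

section Graded

open Matrix

variable {R : Type*} [CommRing R]

/-- Substitutions that fix `x` and act on `(y, z)` only respect the degree in `x`. -/
theorem subst_mul_of_graded {g : Matrix (Fin 3) (Fin 3) R} (h01 : g 0 1 = 0) (h02 : g 0 2 = 0)
    (h10 : g 1 0 = 0) (h20 : g 2 0 = 0) (a b d e : R) (c : Fin 10 → R) :
    subst g (![a, b, b, d, d, d, e, e, e, e] * c) =
      ![a, b, b, d, d, d, e, e, e, e] * subst g c := by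
  ext1 i
  fin_cases i <;>
    simp [subst, evalAt, dirDeriv, polar, h01, h02, h10, h20] <;> ring

theorem subst_zero_apply_of_graded {g : Matrix (Fin 3) (Fin 3) R} (h00 : g 0 0 = 1)
    (h10 : g 1 0 = 0) (h20 : g 2 0 = 0) (c : Fin 10 → R) : subst g c 0 = c 0 := by
  simp [subst, evalAt, h00, h10, h20]

/-- Exchanging `x` and `y`. -/
def swapMatrix (R : Type*) [CommRing R] : Matrix (Fin 3) (Fin 3) R :=
  !![0, 1, 0; 1, 0, 0; 0, 0, 1]

/-- The permutation of the coefficients induced by exchanging `x` and `y`. -/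
def swapCoeff {M : Type*} (c : Fin 10 → M) : Fin 10 → M :=
  ![c 6, c 3, c 7, c 1, c 4, c 8, c 0, c 2, c 5, c 9]

theorem subst_swapMatrix (c : Fin 10 → R) : subst (swapMatrix R) c = swapCoeff c := by
  ext1 i
  fin_cases i <;> simp [subst, swapMatrix, swapCoeff, evalAt, dirDeriv, polar]

variable {p : ℕ} [Fact p.Prime]

theorem liftMatrix_apply_of_eq_zero {g : Matrix (Fin 3) (Fin 3) (ZMod p)} {i j : Fin 3}
    (h : g i j = 0) : liftMatrix g i j = 0 := by
  simp [liftMatrix, h]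

theorem insolMass_swap (e : Fin 10 → ℕ) (K : Set (Fin 10 → ZMod p)) :
    insolMass (swapCoeff e) K = insolMass e {r | swapCoeff r ∈ K} := by
  have hdet : (swapMatrix (ZMod p)).det ≠ 0 := by
    simp [swapMatrix, det_fin_three]
  have hlift : liftMatrix (swapMatrix (ZMod p)) = swapMatrix ℤ_[p] := by
    have : Fact (1 < p) := ⟨(Fact.out : p.Prime).one_lt⟩
    ext i j
    fin_cases i <;> fin_cases j <;> simp [liftMatrix, swapMatrix, -ZMod.natCast_val, ZMod.val_one]
  have h := insolMass_subst (e := e) (e' := swapCoeff e)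
    (GeneralLinearGroup.mkOfDetNeZero (swapMatrix (ZMod p)) hdet) (fun c ↦ by
      change scale _ (subst (liftMatrix (swapMatrix (ZMod p))) c) =
        subst (liftMatrix (swapMatrix (ZMod p))) _
      rw [hlift, subst_swapMatrix, subst_swapMatrix]
      ext1 i
      fin_cases i <;> simp [scale, swapCoeff]) K
  rw [h]
  congr 1
  ext r
  change subst (swapMatrix (ZMod p)) r ∈ K ↔ _
  rw [subst_swapMatrix]
  rfl

/-- In `(y, z)`, all lines are equivalent. -/
theorem exists_vecMul_eq_of_graded {K : Type*} [Field K] {l : Fin 3 → K} (h0 : l 0 = 0)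
    (hl : ∃ j ∈ (Finset.univ : Finset (Fin 3)), l j ≠ 0) :
    ∃ g : GL (Fin 3) K, (g.1 0 0 = 1 ∧ g.1 0 1 = 0 ∧ g.1 0 2 = 0 ∧ g.1 1 0 = 0 ∧ g.1 2 0 = 0) ∧
      l ᵥ* g.1 = ![0, 1, 0] := by
  have key (A : Matrix (Fin 3) (Fin 3) K) (hA : A.det ≠ 0)
      (h : (A 0 0 = 1 ∧ A 0 1 = 0 ∧ A 0 2 = 0 ∧ A 1 0 = 0 ∧ A 2 0 = 0) ∧ l ᵥ* A = ![0, 1, 0]) :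
      ∃ g : GL (Fin 3) K, (g.1 0 0 = 1 ∧ g.1 0 1 = 0 ∧ g.1 0 2 = 0 ∧ g.1 1 0 = 0 ∧
        g.1 2 0 = 0) ∧ l ᵥ* g.1 = ![0, 1, 0] := ⟨GeneralLinearGroup.mkOfDetNeZero A hA, h⟩
  by_cases h1 : l 1 = 0
  · have h2 : l 2 ≠ 0 := by
      intro h2
      obtain ⟨j, -, hj⟩ := hl
      apply hj
      fin_cases j <;> assumption
    refine key !![1, 0, 0; 0, 0, 1; 0, (l 2)⁻¹, 0] ?_ ?_
    · simp [det_fin_three, h2]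
    · refine ⟨by simp, ?_⟩
      ext i
      fin_cases i <;> simp [vecMul, dotProduct, Fin.sum_univ_three, h0, h1, h2]
  · refine key !![1, 0, 0; 0, (l 1)⁻¹, -l 2; 0, 0, l 1] ?_ ?_
    · simp [det_fin_three, h1]
    · refine ⟨by simp, ?_⟩
      ext i
      fin_cases i <;> simp [vecMul, dotProduct, Fin.sum_univ_three, h0, h1]
      ring

end Graded

section ConesStates

open Matrix

variable {p : ℕ} [Fact p.Prime]

/-- The number of anisotropic binary cubic forms over the field with `p` elements. -/
noncomputable def numBin (p : ℕ) [Fact p.Prime] : ℕ :=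
  Nat.card {n : Fin 4 → ZMod p // BinAnisotropic n}

/-- The coefficients of the monomials not involving `x`. -/
def restrictX {R : Type*} (c : Fin 10 → R) : Fin 4 → R := ![c 6, c 7, c 8, c 9]

theorem evalAt_of_cone {K : Type*} [Field K] {r : Fin 10 → K}
    (h : r 0 = 0 ∧ r 1 = 0 ∧ r 2 = 0 ∧ r 3 = 0 ∧ r 4 = 0 ∧ r 5 = 0) (x : Fin 3 → K) :
    evalAt r x = evalBin (restrictX r) (x 1) (x 2) := by
  obtain ⟨h0, h1, h2, h3, h4, h5⟩ := h
  simp [evalAt, evalBin, restrictX, h0, h1, h2, h3, h4, h5]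

theorem exists_isConcurrent_iff_of_cone {K : Type*} [Field K] {r : Fin 10 → K}
    (h : r 0 = 0 ∧ r 1 = 0 ∧ r 2 = 0 ∧ r 3 = 0 ∧ r 4 = 0 ∧ r 5 = 0) :
    (∃ v, IsConcurrent r v) ↔ BinAnisotropic (restrictX r) := by
  constructor
  · rintro ⟨v, hv⟩ y z hyz h0
    obtain ⟨s, hs⟩ := hv.2.1 ![1, 0, 0] (by rw [evalAt_of_cone h]; simp [evalBin])
    obtain ⟨t, ht⟩ := hv.2.1 ![0, y, z] (by rw [evalAt_of_cone h]; simpa using h0)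
    have e0 := congrFun hs 0
    have e1 := congrFun hs 1
    have e2 := congrFun hs 2
    have f1 := congrFun ht 1
    have f2 := congrFun ht 2
    simp at e0 e1 e2 f1 f2
    have hs0 : s ≠ 0 := by
      rintro rfl
      simp at e0
    simp [hs0] at e1 e2
    simp [f1, f2, e1, e2] at hyz
  · intro hb
    refine ⟨![1, 0, 0], fun h ↦ by simpa using congrFun h 0, fun x hx ↦ ⟨x 0, ?_⟩, ?_, fun w ↦ ?_⟩
    · rw [evalAt_of_cone h] at hx
      have h1 : x 1 = 0 ∧ x 2 = 0 := by
        by_contra hne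
        exact hb _ _ (by tauto) hx
      ext i
      fin_cases i <;> simp [h1]
    · rw [evalAt_of_cone h]
      simp [evalBin]
    · simp [dirDeriv, h]

theorem natCard_ne_zero_and_binAnisotropic (σ : Fin 5 ↪ Fin 10) :
    Nat.card {r : Fin 10 → ZMod p | r (σ 0) ≠ 0 ∧ BinAnisotropic (Fin.tail (r ∘ σ))} =
      (p - 1) * numBin p * p ^ 5 := by
  let e : {w : Fin 5 → ZMod p // w 0 ≠ 0 ∧ BinAnisotropic (Fin.tail w)} ≃
      (ZMod p)ˣ × {n : Fin 4 → ZMod p // BinAnisotropic n} :=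
    { toFun w := (Units.mk0 (w.1 0) w.2.1, ⟨Fin.tail w.1, w.2.2⟩)
      invFun t := ⟨Fin.cons t.1.1 t.2.1, by simp, by simpa using t.2.2⟩
      left_inv w := Subtype.ext (Fin.cons_self_tail w.1)
      right_inv t := Prod.ext (Units.ext (by simp)) (Subtype.ext (by simp)) }
  have h := natCard_comp_mem σ {w : Fin 5 → ZMod p | w 0 ≠ 0 ∧ BinAnisotropic (Fin.tail w)}
  rw [show Nat.card {w : Fin 5 → ZMod p | w 0 ≠ 0 ∧ BinAnisotropic (Fin.tail w)} =
    Nat.card {w : Fin 5 → ZMod p // w 0 ≠ 0 ∧ BinAnisotropic (Fin.tail w)} from rfl,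
    Nat.card_congr e, Nat.card_prod, Nat.card_units, Nat.card_zmod] at h
  exact h

theorem natCard_restrictX :
    Nat.card {r : Fin 10 → ZMod p | r 0 ≠ 0 ∧ BinAnisotropic (restrictX r)} =
      (p - 1) * numBin p * p ^ 5 := by
  let σ : Fin 5 ↪ Fin 10 := ⟨![0, 6, 7, 8, 9], by decide⟩
  have h (r : Fin 10 → ZMod p) : Fin.tail (r ∘ σ) = restrictX r := by
    ext i
    fin_cases i <;> rfl
  simp only [← h]
  exact natCard_ne_zero_and_binAnisotropic σ

theorem natCard_restrictLine :
    Nat.card {r : Fin 10 → ZMod p | r 9 ≠ 0 ∧ BinAnisotropic (restrictLine r)} =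
      (p - 1) * numBin p * p ^ 5 := by
  let σ : Fin 5 ↪ Fin 10 := ⟨![9, 0, 1, 3, 6], by decide⟩
  have h (r : Fin 10 → ZMod p) : Fin.tail (r ∘ σ) = restrictLine r := by
    ext i
    fin_cases i <;> rfl
  simp only [← h]
  exact natCard_ne_zero_and_binAnisotropic σ

end ConesStates

/-! ### Insoluble forms and smooth zeros -/

section Insoluble

variable {p : ℕ} [Fact p.Prime]

theorem dvd_of_dvd_mul_pow {a x : ℤ_[p]} {k : ℕ} (ha : PadicInt.toZMod a ≠ 0)
    (h : (p : ℤ_[p]) ∣ a * x ^ k) : (p : ℤ_[p]) ∣ x := by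
  rw [ne_eq, toZMod_eq_zero_iff] at ha
  exact PadicInt.prime_p.dvd_of_dvd_pow ((PadicInt.prime_p.dvd_or_dvd h).resolve_left ha)

/-- An integral value of a binary form with anisotropic residue is divisible by `p` only if both
arguments are. -/
theorem dvd_of_dvd_evalBin {n : Fin 4 → ℤ_[p]} (hn : BinAnisotropic (reduce n)) {x y : ℤ_[p]}
    (h : (p : ℤ_[p]) ∣ evalBin n x y) : (p : ℤ_[p]) ∣ x ∧ (p : ℤ_[p]) ∣ y := by
  rw [← toZMod_eq_zero_iff] at h
  rw [← toZMod_eq_zero_iff, ← toZMod_eq_zero_iff]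
  by_contra hne
  refine hn _ _ (not_and_or.1 hne) (Eq.trans ?_ h)
  simp [evalBin, reduce]

theorem reduce_restrictX (c : Fin 10 → ℤ_[p]) : restrictX (reduce c) = reduce (restrictX c) := by
  ext i
  fin_cases i <;> rfl

theorem reduce_restrictLine (c : Fin 10 → ℤ_[p]) :
    restrictLine (reduce c) = reduce (restrictLine c) := by
  ext i
  fin_cases i <;> rfl

theorem not_soluble_of_anisotropic {c : Fin 10 → ℤ_[p]} (h : Anisotropic (reduce c)) :
    ¬ Soluble c := by
  refine not_soluble_of_dvd fun x hx i ↦ ?_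
  rw [← toZMod_eq_zero_iff]
  have h0 : reduce x = 0 := by
    by_contra hne
    refine h _ hne ?_
    have := evalAt_map PadicInt.toZMod c x
    rw [hx, map_zero] at this
    exact this
  exact congrFun h0 i

/-- Modulo `p`, the equation forces `p` to divide `y` and `z`, and then modulo `p³` also `x`. -/
theorem not_soluble_cone_two {c : Fin 10 → ℤ_[p]} (h0 : reduce c 0 ≠ 0)
    (hb : BinAnisotropic (restrictX (reduce c))) :
    ¬ Soluble (scale ![2, 2, 2, 1, 1, 1, 0, 0, 0, 0] c) := by
  rw [reduce_restrictX] at hb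
  refine not_soluble_of_dvd fun x hx ↦ ?_
  have hp := ne_zero_of_prime (p := p)
  simp only [evalAt, scale, Matrix.cons_val, pow_zero, pow_one] at hx
  obtain ⟨⟨Y, hY⟩, Z, hZ⟩ := dvd_of_dvd_evalBin hb (x := x 1) (y := x 2)
    ⟨-(p * (c 0 * x 0 ^ 3 + c 1 * x 0 ^ 2 * x 1 + c 2 * x 0 ^ 2 * x 2) + c 3 * x 0 * x 1 ^ 2 +
      c 4 * x 0 * x 1 * x 2 + c 5 * x 0 * x 2 ^ 2), by
      simp only [evalBin, restrictX, Matrix.cons_val]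
      linear_combination hx⟩
  have hX := dvd_of_dvd_mul_pow (a := c 0) (x := x 0) (k := 3) h0
    ⟨-(c 1 * x 0 ^ 2 * Y + c 2 * x 0 ^ 2 * Z + c 3 * x 0 * Y ^ 2 + c 4 * x 0 * Y * Z +
      c 5 * x 0 * Z ^ 2 + c 6 * Y ^ 3 + c 7 * Y ^ 2 * Z + c 8 * Y * Z ^ 2 + c 9 * Z ^ 3), by
      refine mul_left_cancel₀ (pow_ne_zero 2 hp) ?_
      rw [hY, hZ] at hx
      linear_combination hx⟩
  intro i
  fin_cases i
  exacts [hX, ⟨Y, hY⟩, ⟨Z, hZ⟩]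

/-- Modulo `p`, the equation forces `p` to divide `y` and `z`, and then modulo `p²` also `x`. -/
theorem not_soluble_cone_one {c : Fin 10 → ℤ_[p]} (h0 : reduce c 0 ≠ 0)
    (hb : BinAnisotropic (restrictX (reduce c))) :
    ¬ Soluble (scale ![1, 1, 1, 1, 1, 1, 0, 0, 0, 0] c) := by
  rw [reduce_restrictX] at hb
  refine not_soluble_of_dvd fun x hx ↦ ?_
  have hp := ne_zero_of_prime (p := p)
  simp only [evalAt, scale, Matrix.cons_val, pow_zero, pow_one] at hx
  obtain ⟨⟨Y, hY⟩, Z, hZ⟩ := dvd_of_dvd_evalBin hb (x := x 1) (y := x 2)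
    ⟨-(c 0 * x 0 ^ 3 + c 1 * x 0 ^ 2 * x 1 + c 2 * x 0 ^ 2 * x 2 + c 3 * x 0 * x 1 ^ 2 +
      c 4 * x 0 * x 1 * x 2 + c 5 * x 0 * x 2 ^ 2), by
      simp only [evalBin, restrictX, Matrix.cons_val]
      linear_combination hx⟩
  have hX := dvd_of_dvd_mul_pow (a := c 0) (x := x 0) (k := 3) h0
    ⟨-(c 1 * x 0 ^ 2 * Y + c 2 * x 0 ^ 2 * Z + p * (c 3 * x 0 * Y ^ 2 + c 4 * x 0 * Y * Z +
      c 5 * x 0 * Z ^ 2 + c 6 * Y ^ 3 + c 7 * Y ^ 2 * Z + c 8 * Y * Z ^ 2 + c 9 * Z ^ 3)), by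
      refine mul_left_cancel₀ hp ?_
      rw [hY, hZ] at hx
      linear_combination hx⟩
  intro i
  fin_cases i
  exacts [hX, ⟨Y, hY⟩, ⟨Z, hZ⟩]

/-- Modulo `p`, `p²` and `p³`, the equation forces `p` to divide `z`, `x` and `y`, in this order. -/
theorem not_soluble_edge {c : Fin 10 → ℤ_[p]} (h0 : reduce c 0 ≠ 0) (h6 : reduce c 6 ≠ 0)
    (h5 : reduce c 5 = 0) (h9 : reduce c 9 ≠ 0) :
    ¬ Soluble (scale ![1, 2, 1, 2, 1, 0, 2, 2, 1, 0] c) := by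
  refine not_soluble_of_dvd fun x hx ↦ ?_
  have hp := ne_zero_of_prime (p := p)
  obtain ⟨d, hd⟩ := toZMod_eq_zero_iff.1 h5
  simp only [evalAt, scale, Matrix.cons_val, pow_zero, pow_one, hd] at hx
  have hz := dvd_of_dvd_mul_pow (a := c 9) (x := x 2) (k := 3) h9
    ⟨-(c 0 * x 0 ^ 3 + p * c 1 * x 0 ^ 2 * x 1 + c 2 * x 0 ^ 2 * x 2 + p * c 3 * x 0 * x 1 ^ 2 +
      c 4 * x 0 * x 1 * x 2 + d * x 0 * x 2 ^ 2 + p * c 6 * x 1 ^ 3 + p * c 7 * x 1 ^ 2 * x 2 +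
      c 8 * x 1 * x 2 ^ 2), by linear_combination hx⟩
  obtain ⟨Z, hZ⟩ := hz
  rw [hZ] at hx
  have hX := dvd_of_dvd_mul_pow (a := c 0) (x := x 0) (k := 3) h0
    ⟨-(c 1 * x 0 ^ 2 * x 1 + c 2 * x 0 ^ 2 * Z + c 3 * x 0 * x 1 ^ 2 + c 4 * x 0 * x 1 * Z +
      p * d * x 0 * Z ^ 2 + c 6 * x 1 ^ 3 + p * c 7 * x 1 ^ 2 * Z + p * c 8 * x 1 * Z ^ 2 +
      p * c 9 * Z ^ 3), by
      refine mul_left_cancel₀ hp ?_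
      linear_combination hx⟩
  obtain ⟨X, hX⟩ := hX
  rw [hX] at hx
  have hY := dvd_of_dvd_mul_pow (a := c 6) (x := x 1) (k := 3) h6
    ⟨-(p * c 0 * p * X ^ 3 + p * c 1 * X ^ 2 * x 1 + p * c 2 * X ^ 2 * Z + c 3 * X * x 1 ^ 2 +
      c 4 * X * x 1 * Z + p * d * X * Z ^ 2 + c 7 * x 1 ^ 2 * Z + c 8 * x 1 * Z ^ 2 +
      c 9 * Z ^ 3) + p * c 0 * (p - 1) * X ^ 3, by
      refine mul_left_cancel₀ (pow_ne_zero 2 hp) ?_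
      linear_combination hx⟩
  intro i
  fin_cases i
  exacts [⟨X, hX⟩, hY, ⟨Z, hZ⟩]

/-- Modulo `p`, the equation forces `p` to divide `x` and `y`, and then modulo `p²` also `z`. -/
theorem not_soluble_concurrent_first {c : Fin 10 → ℤ_[p]}
    (hb : BinAnisotropic (restrictLine (reduce c))) (h9 : reduce c 9 ≠ 0) :
    ¬ Soluble (scale ![0, 0, 1, 0, 1, 1, 0, 1, 1, 1] c) := by
  rw [reduce_restrictLine] at hb
  refine not_soluble_of_dvd fun x hx ↦ ?_
  have hp := ne_zero_of_prime (p := p)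
  simp only [evalAt, scale, Matrix.cons_val, pow_zero, pow_one] at hx
  obtain ⟨⟨X, hX⟩, Y, hY⟩ := dvd_of_dvd_evalBin hb (x := x 0) (y := x 1)
    ⟨-(c 2 * x 0 ^ 2 * x 2 + c 4 * x 0 * x 1 * x 2 + c 5 * x 0 * x 2 ^ 2 + c 7 * x 1 ^ 2 * x 2 +
      c 8 * x 1 * x 2 ^ 2 + c 9 * x 2 ^ 3), by
      simp only [evalBin, restrictLine, Matrix.cons_val]
      linear_combination hx⟩
  have hZ := dvd_of_dvd_mul_pow (a := c 9) (x := x 2) (k := 3) h9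
    ⟨-(p * (c 0 * X ^ 3 + c 1 * X ^ 2 * Y + c 3 * X * Y ^ 2 + c 6 * Y ^ 3) +
      p * (c 2 * X ^ 2 + c 4 * X * Y + c 7 * Y ^ 2) * x 2 + (c 5 * X + c 8 * Y) * x 2 ^ 2), by
      refine mul_left_cancel₀ hp ?_
      rw [hX, hY] at hx
      linear_combination hx⟩
  intro i
  fin_cases i
  exacts [⟨X, hX⟩, ⟨Y, hY⟩, hZ]

/-- Modulo `p`, the equation forces `p` to divide `z`, and then modulo `p²` also `x` and `y`. -/
theorem not_soluble_concurrent_second {c : Fin 10 → ℤ_[p]}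
    (hb : BinAnisotropic (restrictLine (reduce c))) (h9 : reduce c 9 ≠ 0) :
    ¬ Soluble (scale ![1, 1, 1, 1, 1, 1, 1, 1, 1, 0] c) := by
  rw [reduce_restrictLine] at hb
  refine not_soluble_of_dvd fun x hx ↦ ?_
  have hp := ne_zero_of_prime (p := p)
  simp only [evalAt, scale, Matrix.cons_val, pow_zero, pow_one] at hx
  obtain ⟨Z, hZ⟩ := dvd_of_dvd_mul_pow (a := c 9) (x := x 2) (k := 3) h9
    ⟨-(c 0 * x 0 ^ 3 + c 1 * x 0 ^ 2 * x 1 + c 2 * x 0 ^ 2 * x 2 + c 3 * x 0 * x 1 ^ 2 +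
      c 4 * x 0 * x 1 * x 2 + c 5 * x 0 * x 2 ^ 2 + c 6 * x 1 ^ 3 + c 7 * x 1 ^ 2 * x 2 +
      c 8 * x 1 * x 2 ^ 2), by linear_combination hx⟩
  obtain ⟨hX, hY⟩ := dvd_of_dvd_evalBin hb (x := x 0) (y := x 1)
    ⟨-(c 2 * x 0 ^ 2 * Z + c 4 * x 0 * x 1 * Z + c 7 * x 1 ^ 2 * Z +
      p * (c 5 * x 0 * Z ^ 2 + c 8 * x 1 * Z ^ 2) + p * c 9 * Z ^ 3), by
      simp only [evalBin, restrictLine, Matrix.cons_val]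
      refine mul_left_cancel₀ hp ?_
      rw [hZ] at hx
      linear_combination hx⟩
  intro i
  fin_cases i
  exacts [hX, hY, ⟨Z, hZ⟩]

end Insoluble

section Smooth

variable {K : Type*} [Field K]

theorem hasSmoothZero_of_linear_x {r : Fin 10 → K}
    (h : r 0 = 0 ∧ r 1 = 0 ∧ r 2 = 0) {y z : K}
    (hq : r 3 * y ^ 2 + r 4 * y * z + r 5 * z ^ 2 ≠ 0) : HasSmoothZero r := by
  obtain ⟨h0, h1, h2⟩ := h
  obtain ⟨x, hx⟩ : ∃ x, (r 3 * y ^ 2 + r 4 * y * z + r 5 * z ^ 2) * x =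
      -evalBin (restrictX r) y z := ⟨_, mul_div_cancel₀ _ hq⟩
  refine ⟨![x, y, z], ![1, 0, 0], ?_, ?_⟩
  · simp [evalAt, evalBin, restrictX, h0, h1, h2] at hx ⊢
    linear_combination hx
  · simpa [dirDeriv, h0, h1, h2] using hq

theorem hasSmoothZero_of_linear_y {r : Fin 10 → K}
    (h : r 3 = 0 ∧ r 6 = 0 ∧ r 7 = 0) {x z : K}
    (hq : r 1 * x ^ 2 + r 4 * x * z + r 8 * z ^ 2 ≠ 0) : HasSmoothZero r := by
  obtain ⟨h0, h1, h2⟩ := h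
  obtain ⟨y, hy⟩ : ∃ y, (r 1 * x ^ 2 + r 4 * x * z + r 8 * z ^ 2) * y =
      -(r 0 * x ^ 3 + r 2 * x ^ 2 * z + r 5 * x * z ^ 2 + r 9 * z ^ 3) :=
    ⟨_, mul_div_cancel₀ _ hq⟩
  refine ⟨![x, y, z], ![0, 1, 0], ?_, ?_⟩
  · simp [evalAt, h0, h1, h2] at hy ⊢
    linear_combination hy
  · simpa [dirDeriv, h0, h1, h2] using hq

end Smooth

/-! ### Residues that are cones over points of a line -/

section Cones

open Matrix

variable {p : ℕ} [Fact p.Prime]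

/-- Exponents depending only on the degree in `x`, and zero for the monomials without `x`. -/
def coneExp (a b d : ℕ) : Fin 10 → ℕ := ![a, b, b, d, d, d, 0, 0, 0, 0]

/-- The mass of the insoluble forms with exponents `e`, for which the coefficient of `x³` divided by
its power of `p` is a unit, and the coefficients `r 6, ..., r 9` of the monomials without `x` reduce
to a nonzero multiple of `y³`. For `e = coneExp a b d` with `a, b, d` positive, this says that the
residual curve is the triple line `y = 0`. -/
noncomputable def lineMass (p : ℕ) [Fact p.Prime] (e : Fin 10 → ℕ) : ℝ :=
  insolMass e {r : Fin 10 → ZMod p | r 0 ≠ 0 ∧ r 6 ≠ 0 ∧ r 7 = 0 ∧ r 8 = 0 ∧ r 9 = 0}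

theorem residue_coneExp {a b d : ℕ} (ha : a ≠ 0) (hb : b ≠ 0) (hd : d ≠ 0)
    (r : Fin 10 → ZMod p) :
    residue (coneExp a b d) r = ![0, 0, 0, 0, 0, 0, 1, 1, 1, 1] * r := by
  ext1 i
  fin_cases i <;> simp [residue, coneExp, ha, hb, hd]

theorem scale_coneExp (a b d : ℕ) (c : Fin 10 → ℤ_[p]) :
    scale (coneExp a b d) c = ![(p : ℤ_[p]) ^ a, (p : ℤ_[p]) ^ b, (p : ℤ_[p]) ^ b,
      (p : ℤ_[p]) ^ d, (p : ℤ_[p]) ^ d, (p : ℤ_[p]) ^ d, 1, 1, 1, 1] * c := by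
  ext1 i
  fin_cases i <;> simp [scale, coneExp]

theorem isTripleLine_cone_iff {r : Fin 10 → ZMod p} :
    IsTripleLine (![0, 0, 0, 0, 0, 0, 1, 1, 1, 1] * r) ![0, 1, 0] ↔
      r 6 ≠ 0 ∧ r 7 = 0 ∧ r 8 = 0 ∧ r 9 = 0 := by
  constructor
  · rintro ⟨-, a, ha, h⟩
    have h6 := congrFun h 6
    have h7 := congrFun h 7
    have h8 := congrFun h 8
    have h9 := congrFun h 9
    simp [prodLinear] at h6 h7 h8 h9
    exact ⟨by rwa [h6], h7, h8, h9⟩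
  · rintro ⟨h6, h7, h8, h9⟩
    refine ⟨fun h ↦ by simpa using congrFun h 1, r 6, h6, ?_⟩
    ext i
    fin_cases i <;> simp [prodLinear, h7, h8, h9]

/-- The mass is the same for all lines through the point `(1 : 0 : 0)`. -/
theorem insolMass_cone_isTripleLine {a b d : ℕ} (ha : a ≠ 0) (hb : b ≠ 0) (hd : d ≠ 0)
    {l : Fin 3 → ZMod p} (h0 : l 0 = 0) (hl : l ≠ 0) :
    insolMass (coneExp a b d) {r | r 0 ≠ 0 ∧ IsTripleLine (residue (coneExp a b d) r) l} =
      lineMass p (coneExp a b d) := by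
  obtain ⟨g, ⟨h00, h01, h02, h10, h20⟩, hg⟩ := exists_vecMul_eq_of_graded h0 (by
    by_contra! h
    exact hl (funext fun i ↦ h i (Finset.mem_univ i)))
  symm
  rw [lineMass, insolMass_subst (e := coneExp a b d) g (fun c ↦ by
    rw [scale_coneExp, scale_coneExp, subst_mul_of_graded] <;>
      exact liftMatrix_apply_of_eq_zero (by assumption))]
  congr 1
  ext r
  simp only [Set.mem_ofPred_eq, residue_coneExp ha hb hd, subst_zero_apply_of_graded h00 h10 h20]
  rw [← isTripleLine_cone_iff, ← subst_mul_of_graded h01 h02 h10 h20, ← hg, isTripleLine_subst_iff]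

/-- The decomposition by residual curves for the exponents `coneExp a b d`. The residues are binary
forms in `y` and `z`, that is, cones with vertex `(1 : 0 : 0)`. -/
theorem insolMass_cone {a b d : ℕ} (ha : a ≠ 0) (hb : b ≠ 0) (hd : d ≠ 0)
    (hins : ∀ c : Fin 10 → ℤ_[p], reduce c 0 ≠ 0 → BinAnisotropic (restrictX (reduce c)) →
      ¬ Soluble (scale (coneExp a b d) c))
    {K : Set (Fin 10 → ZMod p)} (hK : ∀ r ∈ K, r 0 ≠ 0)
    (hKb : ∀ r, r 0 ≠ 0 → BinAnisotropic (restrictX r) → r ∈ K) {J : Finset (Fin 3)}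
    (hJ : {0} ⊆ J)
    (hKl : ∀ r l, r 0 ≠ 0 → IsTripleLine (residue (coneExp a b d) r) l → l 0 = 0 →
      (r ∈ K ↔ ∃ j ∈ J, l j ≠ 0)) :
    insolMass (coneExp a b d) K = (p - 1) * numBin p / (p : ℝ) ^ 5 +
      ((p : ℝ) ^ 2 - (p : ℝ) ^ (3 - J.card)) / (p - 1) * lineMass p (coneExp a b d) +
      insolMass (coneExp a b d) {r | r ∈ K ∧ r 6 = 0 ∧ r 7 = 0 ∧ r 8 = 0 ∧ r 9 = 0} := by
  have hp0 : (p : ℝ) ≠ 0 := by exact_mod_cast (Fact.out : p.Prime).ne_zero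
  have hp1 : (p : ℝ) - 1 ≠ 0 := by
    have : (1 : ℝ) < p := by exact_mod_cast (Fact.out : p.Prime).one_lt
    linarith
  have hcone (r : Fin 10 → ZMod p) : let s := residue (coneExp a b d) r
      s 0 = 0 ∧ s 1 = 0 ∧ s 2 = 0 ∧ s 3 = 0 ∧ s 4 = 0 ∧ s 5 = 0 := by
    simp [residue_coneExp ha hb hd]
  have hrX (r : Fin 10 → ZMod p) : restrictX (residue (coneExp a b d) r) = restrictX r := by
    ext i
    fin_cases i <;> simp [residue_coneExp ha hb hd, restrictX]
  have hl0 (r : Fin 10 → ZMod p) (l) (h : IsTripleLine (residue (coneExp a b d) r) l) :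
      l 0 = 0 := by
    have := (h.evalAt_eq_zero_iff ![1, 0, 0]).1 (by
      rw [evalAt_of_cone (hcone r)]
      simp [evalBin])
    simpa [dotProduct, Fin.sum_univ_three] using this
  rw [insolMass_decompose]
  have h1 : {r : Fin 10 → ZMod p | r ∈ K ∧ Anisotropic (residue (coneExp a b d) r)} = ∅ := by
    ext r
    simp only [Set.mem_ofPred_eq, Set.mem_empty_iff_false, iff_false, not_and]
    intro _ h
    refine h ![1, 0, 0] (fun h ↦ by simpa using congrFun h 0) ?_
    rw [evalAt_of_cone (hcone r)]
    simp [evalBin]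
  have h2 : {r | r ∈ K ∧ ∃ v, IsConcurrent (residue (coneExp a b d) r) v} =
      {r | r 0 ≠ 0 ∧ BinAnisotropic (restrictX r)} := by
    ext r
    simp only [Set.mem_ofPred_eq]
    rw [exists_isConcurrent_iff_of_cone (hcone r), hrX]
    exact ⟨fun h ↦ ⟨hK r h.1, h.2⟩, fun h ↦ ⟨hKb r h.1 h.2, h.2⟩⟩
  have h3 := insolMass_tripleLine (e := coneExp a b d) (K := K) (C := lineMass p (coneExp a b d))
    hJ (fun r hr l hl ↦ ⟨by simpa using hl0 r l hl, (hKl r l (hK r hr) hl (hl0 r l hl)).1 hr⟩)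
    (fun l hl hl' ↦ by
      have hl0 : l 0 = 0 := by simpa using hl
      rw [← insolMass_cone_isTripleLine ha hb hd hl0 (by
        rintro rfl
        simp at hl')]
      congr 1
      ext r
      exact ⟨fun h ↦ ⟨hK r h.1, h.2⟩, fun h ↦ ⟨(hKl r l h.1 h.2 hl0).2 hl', h.2⟩⟩)
  have h4 : {r | r ∈ K ∧ residue (coneExp a b d) r = 0} =
      {r | r ∈ K ∧ r 6 = 0 ∧ r 7 = 0 ∧ r 8 = 0 ∧ r 9 = 0} := by
    ext r
    simp only [Set.mem_ofPred_eq]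
    refine and_congr_right fun _ ↦ ?_
    rw [residue_coneExp ha hb hd]
    constructor
    · intro h
      have h6 := congrFun h 6
      have h7 := congrFun h 7
      have h8 := congrFun h 8
      have h9 := congrFun h 9
      simp at h6 h7 h8 h9
      exact ⟨h6, h7, h8, h9⟩
    · rintro ⟨h6, h7, h8, h9⟩
      ext i
      fin_cases i <;> simp [h6, h7, h8, h9]
  rw [h1, insolMass_empty, h2, h4, insolMass_of_not_soluble fun c hc ↦ hins c hc.1 hc.2,
    natCard_restrictX]
  push_cast [cast_prime_sub_one]
  rw [Finset.card_singleton] at h3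
  congr 1
  have h5 : insolMass (coneExp a b d) {r | r ∈ K ∧ ∃ l, IsTripleLine (residue (coneExp a b d) r) l}
      = ((p : ℝ) ^ 2 - (p : ℝ) ^ (3 - J.card)) / (p - 1) * lineMass p (coneExp a b d) := by
    rw [div_mul_eq_mul_div, eq_div_iff hp1, ← h3]
    ring
  rw [h5]
  field_simp
  ring

theorem isTripleLine_apply_six {r : Fin 10 → ZMod p} {l : Fin 3 → ZMod p}
    (h : IsTripleLine r l) : r 6 ≠ 0 ↔ l 1 ≠ 0 := by
  obtain ⟨-, a, ha, rfl⟩ := h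
  simp [prodLinear, ha]

theorem BinAnisotropic.restrictX_ne_zero {r : Fin 10 → ZMod p}
    (h : BinAnisotropic (restrictX r)) : r 6 ≠ 0 := h.ne_zero

theorem insolMass_cone_ne_zero {a b d : ℕ} (ha : a ≠ 0) (hb : b ≠ 0) (hd : d ≠ 0)
    (hins : ∀ c : Fin 10 → ℤ_[p], reduce c 0 ≠ 0 → BinAnisotropic (restrictX (reduce c)) →
      ¬ Soluble (scale (coneExp a b d) c)) :
    insolMass (coneExp a b d) {r : Fin 10 → ZMod p | r 0 ≠ 0} =
      (p - 1) * numBin p / (p : ℝ) ^ 5 + (p + 1) * lineMass p (coneExp a b d) +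
      insolMass (coneExp a b d)
        {r : Fin 10 → ZMod p | r 0 ≠ 0 ∧ r 6 = 0 ∧ r 7 = 0 ∧ r 8 = 0 ∧ r 9 = 0} := by
  have hp1 : (p : ℝ) - 1 ≠ 0 := by
    have : (1 : ℝ) < p := by exact_mod_cast (Fact.out : p.Prime).one_lt
    linarith
  rw [insolMass_cone ha hb hd hins (K := {r : Fin 10 → ZMod p | r 0 ≠ 0}) (J := Finset.univ)
    (fun r hr ↦ hr) (fun r hr _ ↦ hr)
    (Finset.subset_univ _)]
  · congr 3
    rw [div_eq_iff hp1]
    simp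
    ring
  · intro r l hr hl _
    refine ⟨fun _ ↦ ?_, fun _ ↦ hr⟩
    by_contra! h
    exact hl.1 (funext fun i ↦ h i (Finset.mem_univ i))

theorem insolMass_cone_ne_zero_and {a b d : ℕ} (ha : a ≠ 0) (hb : b ≠ 0) (hd : d ≠ 0)
    (hins : ∀ c : Fin 10 → ℤ_[p], reduce c 0 ≠ 0 → BinAnisotropic (restrictX (reduce c)) →
      ¬ Soluble (scale (coneExp a b d) c)) :
    insolMass (coneExp a b d) {r : Fin 10 → ZMod p | r 0 ≠ 0 ∧ r 6 ≠ 0} =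
      (p - 1) * numBin p / (p : ℝ) ^ 5 + p * lineMass p (coneExp a b d) := by
  have hp1 : (p : ℝ) - 1 ≠ 0 := by
    have : (1 : ℝ) < p := by exact_mod_cast (Fact.out : p.Prime).one_lt
    linarith
  rw [insolMass_cone ha hb hd hins (K := {r : Fin 10 → ZMod p | r 0 ≠ 0 ∧ r 6 ≠ 0})
    (J := {0, 1}) (fun r hr ↦ hr.1)
    (fun r hr hb ↦ ⟨hr, hb.restrictX_ne_zero⟩) (by decide)]
  · rw [show {r : Fin 10 → ZMod p | r ∈ {r : Fin 10 → ZMod p | r 0 ≠ 0 ∧ r 6 ≠ 0} ∧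
      r 6 = 0 ∧ r 7 = 0 ∧ r 8 = 0 ∧ r 9 = 0} = ∅ by
        ext r
        simp only [Set.mem_ofPred_eq, Set.mem_empty_iff_false, iff_false]
        tauto, insolMass_empty, add_zero]
    congr 2
    rw [div_eq_iff hp1]
    simp
    ring
  · intro r l hr hl h0
    have h6 := isTripleLine_apply_six hl
    simp only [residue_coneExp ha hb hd] at h6
    simp [h0, hr] at h6 ⊢
    exact h6

end Cones

/-! ### Linear relations between masses -/

section Recursion

open Matrix

variable {p : ℕ} [Fact p.Prime]

/-- If the part of the form without `x` reduces to a multiple of `y³` then substituting `p y` for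
`y`, dividing by `p` and exchanging `x` and `y` changes the exponents `coneExp 1 1 1` into
`coneExp 2 2 1`, with a part without `x` that contains `y³`. -/
theorem lineMass_one : lineMass p (coneExp 1 1 1) =
    ((p : ℝ) ^ 3)⁻¹ * ((p - 1) * numBin p / (p : ℝ) ^ 5 + p * lineMass p (coneExp 2 2 1)) := by
  rw [lineMass, insolMass_scale (e' := ![1, 1, 1, 1, 1, 1, 0, 1, 1, 1]) {7, 8, 9} (by decide)
    (K' := {r | r 0 ≠ 0 ∧ r 6 ≠ 0}), insolMass_congr 0 1 0 1 0
    (e' := swapCoeff (coneExp 2 2 1)) (by decide), insolMass_swap,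
    ← insolMass_cone_ne_zero_and (by norm_num) (by norm_num) (by norm_num)
      fun c h0 hb ↦ not_soluble_cone_two h0 hb]
  · congr 2
    ext r
    simp [swapCoeff, and_comm]
  · rintro r ⟨-, -, h7, h8, h9⟩ i hi
    simp at hi
    rcases hi with rfl | rfl | rfl <;> assumption
  · intro r
    simp

theorem natCard_edge :
    Nat.card {r : Fin 10 → ZMod p | r 0 ≠ 0 ∧ r 6 ≠ 0 ∧ r 5 = 0 ∧ r 9 ≠ 0} =
      (p - 1) ^ 3 * p ^ 6 := by
  let σ : Fin 4 ↪ Fin 10 := ⟨![0, 6, 9, 5], by decide⟩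
  have h1 : {w : Fin 4 → ZMod p | w 0 ≠ 0 ∧ w 1 ≠ 0 ∧ w 3 = 0 ∧ w 2 ≠ 0} =
      (Fintype.piFinset fun i ↦ if i = 3 then {0} else {0}ᶜ : Finset (Fin 4 → ZMod p)) := by
    ext w
    simp [Fin.forall_fin_succ]
    tauto
  have h2 : Nat.card {r : Fin 10 → ZMod p | r 0 ≠ 0 ∧ r 6 ≠ 0 ∧ r 5 = 0 ∧ r 9 ≠ 0} =
      Nat.card {r : Fin 10 → ZMod p |
        r ∘ σ ∈ {w : Fin 4 → ZMod p | w 0 ≠ 0 ∧ w 1 ≠ 0 ∧ w 3 = 0 ∧ w 2 ≠ 0}} := rfl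
  rw [h2, natCard_comp_mem, h1, Nat.card_coe_set_eq (SetLike.coe _), Set.ncard_coe_finset,
    Fintype.card_piFinset, Fin.prod_univ_four, Nat.card_zmod]
  simp only [Fin.isValue, Fin.reduceEq, if_true, if_false, Finset.card_compl,
    Finset.card_singleton, ZMod.card]
  ring

/-- Substituting `p y` for `y` and dividing by `p` leaves `x z²` and `z³` as the only monomials with
unit coefficient. By Hensel's lemma the first has to vanish modulo `p`. If the second does not, the
form is insoluble. Otherwise the form can be divided by `p`, `x y z` and `y z²` have to vanish by
Hensel's lemma again, and exchanging `x` and `y` leads to the exponents `coneExp 1 1 1`. -/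
theorem lineMass_two : lineMass p (coneExp 2 2 1) =
    ((p : ℝ) ^ 3)⁻¹ * ((p - 1) ^ 3 / (p : ℝ) ^ 4 + ((p : ℝ) ^ 2)⁻¹ * (((p : ℝ) ^ 2)⁻¹ *
      ((p - 1) * numBin p / (p : ℝ) ^ 5 + p * lineMass p (coneExp 1 1 1)))) := by
  have hp0 : (p : ℝ) ≠ 0 := by exact_mod_cast (Fact.out : p.Prime).ne_zero
  rw [lineMass, insolMass_scale (e' := ![2, 2, 2, 1, 1, 1, 0, 1, 1, 1]) {7, 8, 9} (by decide)
    (K' := {r | r 0 ≠ 0 ∧ r 6 ≠ 0}), insolMass_congr 0 1 0 1 0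
    (e' := ![1, 2, 1, 2, 1, 0, 2, 2, 1, 0]) (by decide),
    insolMass_restrict (K' := {r | r 0 ≠ 0 ∧ r 6 ≠ 0 ∧ r 5 = 0}), insolMass_split _ _ {r | r 9 ≠ 0}]
  · congr 2
    · rw [insolMass_of_not_soluble (fun c hc ↦
        not_soluble_edge hc.1.1 hc.1.2.1 hc.1.2.2 hc.2)]
      rw [show ({r : Fin 10 → ZMod p | r 0 ≠ 0 ∧ r 6 ≠ 0 ∧ r 5 = 0} ∩ {r | r 9 ≠ 0} : Set _) =
        {r | r 0 ≠ 0 ∧ r 6 ≠ 0 ∧ r 5 = 0 ∧ r 9 ≠ 0} by ext r; simp; tauto, natCard_edge]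
      push_cast [cast_prime_sub_one]
      field_simp
    · rw [insolMass_scale (e' := ![1, 2, 1, 2, 1, 1, 2, 2, 1, 1]) {5, 9} (by decide)
        (K' := {r | r 0 ≠ 0 ∧ r 6 ≠ 0}), insolMass_congr 0 0 0 1 0
        (e' := ![0, 1, 0, 1, 0, 0, 1, 1, 0, 0]) (by decide),
        insolMass_restrict (K' := {r | r 0 ≠ 0 ∧ r 6 ≠ 0 ∧ r 4 = 0 ∧ r 8 = 0}),
        insolMass_scale (e' := swapCoeff (coneExp 1 1 1)) {4, 8} (by decide)
        (K' := {r | r 0 ≠ 0 ∧ r 6 ≠ 0}), insolMass_swap,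
        ← insolMass_cone_ne_zero_and (by norm_num) (by norm_num) (by norm_num)
          fun c h0 hb ↦ not_soluble_cone_one h0 hb]
      · congr 3
        ext r
        simp [swapCoeff, and_comm]
      · rintro r ⟨-, -, h4, h8⟩ i hi
        simp at hi
        rcases hi with rfl | rfl <;> assumption
      · intro r
        simp
      · rintro r ⟨h0, h6, -⟩
        exact ⟨h0, h6⟩
      · rintro r ⟨h0, h6⟩ h
        by_cases h8 : r 8 = 0
        · have h4 : r 4 ≠ 0 := fun h4 ↦ h ⟨h0, h6, h4, h8⟩
          exact hasSmoothZero_of_linear_y (x := 1) (z := 1) (by simp [residue])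
            (by simpa [residue, h8] using h4)
        · exact hasSmoothZero_of_linear_y (x := 0) (z := 1) (by simp [residue])
            (by simpa [residue] using h8)
      · rintro r ⟨⟨-, -, h5⟩, h9⟩ i hi
        simp at hi h9
        rcases hi with rfl | rfl <;> assumption
      · intro r
        simp
  · rintro r ⟨h0, h6, -⟩
    exact ⟨h0, h6⟩
  · rintro r ⟨h0, h6⟩ h
    have h5 : r 5 ≠ 0 := fun h5 ↦ h ⟨h0, h6, h5⟩
    exact hasSmoothZero_of_linear_x (y := 0) (z := 1) (by simp [residue])
      (by simpa [residue] using h5)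
  · rintro r ⟨-, -, h7, h8, h9⟩ i hi
    simp at hi
    rcases hi with rfl | rfl | rfl <;> assumption
  · intro r
    simp

/-- For residue a multiple of `x³`, substitute `p x` for `x` and divide by `p`. -/
theorem insolMass_isTripleLine_eq :
    insolMass 0 {r : Fin 10 → ZMod p | IsTripleLine r ![1, 0, 0]} =
      ((p : ℝ) ^ 9)⁻¹ * insolMass (coneExp 2 2 1) {r : Fin 10 → ZMod p | r 0 ≠ 0} := by
  rw [insolMass_scale (e' := ![0, 1, 1, 1, 1, 1, 1, 1, 1, 1]) (Finset.univ.erase 0) (by decide)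
    (K' := {r | r 0 ≠ 0}), insolMass_congr 1 0 0 1 0 (e' := coneExp 2 2 1) (by decide)]
  · rfl
  · intro r hr i hi
    exact (isTripleLine_iff.1 hr).2 i (by simpa using hi)
  · intro r
    simp only [Set.mem_ofPred_eq, isTripleLine_iff]
    simp +contextual

/-- If the part without `x` vanishes modulo `p`, divide by `p`. The part linear in `x` then vanishes
modulo `p` by Hensel's lemma. -/
theorem insolMass_cone_two_zero :
    insolMass (coneExp 2 2 1)
        {r : Fin 10 → ZMod p | r 0 ≠ 0 ∧ r 6 = 0 ∧ r 7 = 0 ∧ r 8 = 0 ∧ r 9 = 0} =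
      ((p : ℝ) ^ 4)⁻¹ * (((p : ℝ) ^ 3)⁻¹ *
        insolMass (coneExp 1 1 1) {r : Fin 10 → ZMod p | r 0 ≠ 0}) := by
  rw [insolMass_scale (e' := ![2, 2, 2, 1, 1, 1, 1, 1, 1, 1]) {6, 7, 8, 9} (by decide)
    (K' := {r | r 0 ≠ 0}), insolMass_congr 0 0 0 1 0
    (e' := ![1, 1, 1, 0, 0, 0, 0, 0, 0, 0]) (by decide),
    insolMass_restrict (K' := {r | r 0 ≠ 0 ∧ r 3 = 0 ∧ r 4 = 0 ∧ r 5 = 0}),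
    insolMass_scale (e' := coneExp 1 1 1) {3, 4, 5} (by decide) (K' := {r | r 0 ≠ 0})]
  · rfl
  · rintro r ⟨-, h3, h4, h5⟩ i hi
    simp at hi
    rcases hi with rfl | rfl | rfl <;> assumption
  · intro r
    simp
  · rintro r ⟨h0, -⟩
    exact h0
  · intro r h0 h
    by_cases h3 : r 3 = 0
    · by_cases h5 : r 5 = 0
      · have h4 : r 4 ≠ 0 := fun h4 ↦ h ⟨h0, h3, h4, h5⟩
        exact hasSmoothZero_of_linear_x (y := 1) (z := 1) (by simp [residue])
          (by simpa [residue, h3, h5] using h4)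
      · exact hasSmoothZero_of_linear_x (y := 0) (z := 1) (by simp [residue])
          (by simpa [residue] using h5)
    · exact hasSmoothZero_of_linear_x (y := 1) (z := 0) (by simp [residue])
        (by simpa [residue] using h3)
  · rintro r ⟨-, h6, h7, h8, h9⟩ i hi
    simp at hi
    rcases hi with rfl | rfl | rfl | rfl <;> assumption
  · intro r
    simp

/-- If the part without `x` vanishes modulo `p`, the form is divisible by `p` and arbitrary apart
from the condition on `x³`. -/
theorem insolMass_cone_one_zero :
    insolMass (coneExp 1 1 1)
        {r : Fin 10 → ZMod p | r 0 ≠ 0 ∧ r 6 = 0 ∧ r 7 = 0 ∧ r 8 = 0 ∧ r 9 = 0} =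
      ((p : ℝ) ^ 4)⁻¹ * insolMass 0 {r : Fin 10 → ZMod p | r 0 ≠ 0} := by
  rw [insolMass_scale (e' := ![1, 1, 1, 1, 1, 1, 1, 1, 1, 1]) {6, 7, 8, 9} (by decide)
    (K' := {r | r 0 ≠ 0}), insolMass_congr 0 0 0 1 0 (e' := 0) (by decide)]
  · rfl
  · rintro r ⟨-, h6, h7, h8, h9⟩ i hi
    simp at hi
    rcases hi with rfl | rfl | rfl | rfl <;> assumption
  · intro r
    simp

theorem insolMass_eq_zero :
    insolMass 0 {r : Fin 10 → ZMod p | r = 0} =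
      ((p : ℝ) ^ 10)⁻¹ * insolMass 0 (Set.univ : Set (Fin 10 → ZMod p)) := by
  rw [insolMass_scale (e' := ![1, 1, 1, 1, 1, 1, 1, 1, 1, 1]) Finset.univ (by decide)
    (K' := Set.univ), insolMass_congr 0 0 0 1 0 (e' := 0) (by decide)]
  · rfl
  · rintro r rfl i -
    rfl
  · intro r
    simp [funext_iff]

theorem restrictLine_ite {I : Finset (Fin 10)} (h : 0 ∉ I ∧ 1 ∉ I ∧ 3 ∉ I ∧ 6 ∉ I)
    (r : Fin 10 → ZMod p) :
    restrictLine (fun i ↦ if i ∈ I then 0 else r i) = restrictLine r := by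
  ext i
  fin_cases i <;> simp [restrictLine, h]

/-- The forms whose residue consists of three conjugate lines through `(0 : 0 : 1)`. They are
insoluble if the valuation of the coefficient of `z³` is one. Otherwise substitute `p x`, `p y` for
`x`, `y` and divide by `p²`. The coefficients of `x z²` and `y z²` then vanish modulo `p` by
Hensel's lemma, the form is insoluble if the coefficient of `z³` is a unit, and it can be divided by
`p` otherwise. -/
theorem insolMass_concurrent_eq :
    insolMass 0 {r : Fin 10 → ZMod p | IsConcurrent r ![0, 0, 1]} =
      ((p : ℝ) ^ 6)⁻¹ * ((p - 1) * numBin p / (p : ℝ) ^ 5 + ((p : ℝ) ^ 1)⁻¹ * (((p : ℝ) ^ 2)⁻¹ *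
        ((p - 1) * numBin p / (p : ℝ) ^ 5 + ((p : ℝ) ^ 1)⁻¹ *
          insolMass 0 {r : Fin 10 → ZMod p | BinAnisotropic (restrictLine r)}))) := by
  have hp0 : (p : ℝ) ≠ 0 := by exact_mod_cast (Fact.out : p.Prime).ne_zero
  have hcard : (Nat.card ({r : Fin 10 → ZMod p | BinAnisotropic (restrictLine r)} ∩
      {r | r 9 ≠ 0} : Set (Fin 10 → ZMod p)) : ℝ) / (p : ℝ) ^ 10 =
      (p - 1) * numBin p / (p : ℝ) ^ 5 := by
    rw [show ({r : Fin 10 → ZMod p | BinAnisotropic (restrictLine r)} ∩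
      {r | r 9 ≠ 0} : Set (Fin 10 → ZMod p)) = {r | r 9 ≠ 0 ∧ BinAnisotropic (restrictLine r)} from
      Set.ext fun r ↦ and_comm, natCard_restrictLine]
    push_cast [cast_prime_sub_one]
    field_simp
  simp only [isConcurrent_iff]
  rw [insolMass_scale (e' := ![0, 0, 1, 0, 1, 1, 0, 1, 1, 1]) {2, 4, 5, 7, 8, 9} (by decide)
    (K' := {r | BinAnisotropic (restrictLine r)}), insolMass_split _ _ {r | r 9 ≠ 0}]
  · congr 2
    · rw [insolMass_of_not_soluble fun c hc ↦ not_soluble_concurrent_first hc.1 hc.2, hcard]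
    · rw [insolMass_scale (e' := ![0, 0, 1, 0, 1, 1, 0, 1, 1, 2]) {9} (by decide)
        (K' := {r | BinAnisotropic (restrictLine r)}), insolMass_congr 1 1 0 2 0
        (e' := ![1, 1, 1, 1, 1, 0, 1, 1, 0, 0]) (by decide),
        insolMass_restrict (K' := {r | BinAnisotropic (restrictLine r) ∧ r 5 = 0 ∧ r 8 = 0}),
        insolMass_scale (e' := ![1, 1, 1, 1, 1, 1, 1, 1, 1, 0]) {5, 8} (by decide)
        (K' := {r | BinAnisotropic (restrictLine r)}), insolMass_split _ _ {r | r 9 ≠ 0},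
        insolMass_of_not_soluble fun c hc ↦ not_soluble_concurrent_second hc.1 hc.2, hcard,
        insolMass_scale (e := ![1, 1, 1, 1, 1, 1, 1, 1, 1, 0])
        (e' := ![1, 1, 1, 1, 1, 1, 1, 1, 1, 1]) {9} (by decide)
        (K' := {r | BinAnisotropic (restrictLine r)}), insolMass_congr 0 0 0 1 0
        (e' := 0) (by decide)]
      · rfl
      · rintro r ⟨-, h9⟩ i hi
        simp at hi h9
        rw [hi, h9]
      · intro r
        simp only [Set.mem_sdiff, Set.mem_ofPred_eq]
        rw [restrictLine_ite (by decide)]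
        simp
      · rintro r ⟨-, h5, h8⟩ i hi
        simp at hi
        rcases hi with rfl | rfl <;> assumption
      · intro r
        simp only [Set.mem_ofPred_eq]
        rw [restrictLine_ite (by decide)]
        simp
      · exact fun r h ↦ h.1
      · intro r hb h
        by_cases h5 : r 5 = 0
        · have h8 : r 8 ≠ 0 := fun h8 ↦ h ⟨hb, h5, h8⟩
          exact hasSmoothZero_of_linear_y (x := 0) (z := 1) (by simp [residue])
            (by simpa [residue] using h8)
        · exact hasSmoothZero_of_linear_x (y := 0) (z := 1) (by simp [residue])
            (by simpa [residue] using h5)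
      · rintro r ⟨-, h9⟩ i hi
        simp at hi h9
        rw [hi, h9]
      · intro r
        simp only [Set.mem_sdiff, Set.mem_ofPred_eq]
        rw [restrictLine_ite (by decide)]
        simp
  · rintro r ⟨-, h2, h4, h5, h7, h8, h9⟩ i hi
    simp at hi
    rcases hi with rfl | rfl | rfl | rfl | rfl | rfl <;> assumption
  · intro r
    simp only [Set.mem_ofPred_eq]
    rw [restrictLine_ite (by decide)]
    simp

theorem insolMass_anisotropic (K : Set (Fin 10 → ZMod p)) (hK : ∀ r, Anisotropic r → r ∈ K) :
    insolMass 0 {r | r ∈ K ∧ Anisotropic (residue 0 r)} =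
      numBin p * ((p : ℝ) ^ 2 * (p - 1)) / (p : ℝ) ^ 10 := by
  have h : {r | r ∈ K ∧ Anisotropic (residue 0 r)} = {r | Anisotropic r} := by
    ext r
    simp only [Set.mem_ofPred_eq, residue_zero]
    exact ⟨fun h ↦ h.2, fun h ↦ ⟨hK r h, h⟩⟩
  rw [h, insolMass_of_not_soluble fun c hc ↦ by
    rw [scale_zero]
    exact not_soluble_of_anisotropic hc]
  congr 1
  have := natCard_anisotropic (K := ZMod p)
  rw [Nat.card_zmod] at this
  rw [← cast_prime_sub_one, numBin]
  exact_mod_cast this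

end Recursion

/-! ### Solution of the linear system -/

section Total

open Matrix

variable {p : ℕ} [Fact p.Prime]

theorem cast_prime_sub_one_ne_zero : (p : ℝ) - 1 ≠ 0 := by
  have : (1 : ℝ) < p := by exact_mod_cast (Fact.out : p.Prime).one_lt
  linarith

/-- All the forms: there are `p² + p + 1` possible centres and as many triple lines. -/
theorem insolMass_univ :
    insolMass 0 (Set.univ : Set (Fin 10 → ZMod p)) =
      numBin p * ((p : ℝ) ^ 2 * (p - 1)) / (p : ℝ) ^ 10 +
      ((p : ℝ) ^ 2 + p + 1) * insolMass 0 {r : Fin 10 → ZMod p | IsConcurrent r ![0, 0, 1]} +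
      ((p : ℝ) ^ 2 + p + 1) * insolMass 0 {r : Fin 10 → ZMod p | IsTripleLine r ![1, 0, 0]} +
      ((p : ℝ) ^ 10)⁻¹ * insolMass 0 (Set.univ : Set (Fin 10 → ZMod p)) := by
  have hp1 := cast_prime_sub_one_ne_zero (p := p)
  conv_lhs => rw [insolMass_decompose, insolMass_anisotropic _ fun r _ ↦ Set.mem_univ r]
  congr 1
  · congr 1
    · congr 1
      have h := insolMass_concurrent (p := p) (K := Set.univ) Finset.univ
        (fun r v h ↦ ⟨fun _ ↦ by
          by_contra! h0
          exact h.1 (funext fun i ↦ h0 i (Finset.mem_univ i)), fun _ ↦ Set.mem_univ r⟩)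
        (fun v hv ↦ insolMass_isConcurrent hv)
      simp only [Finset.card_univ, Fintype.card_fin] at h
      refine mul_left_cancel₀ hp1 (h.trans ?_)
      ring
    · have h := insolMass_tripleLine (p := p) (e := 0) (K := Set.univ) (I := ∅)
        (J := Finset.univ) (Finset.empty_subset _)
        (fun r _ l h ↦ ⟨by simp, by
          by_contra! h0
          exact h.1 (funext fun i ↦ h0 i (Finset.mem_univ i))⟩)
        (fun l _ ⟨j, _, hj⟩ ↦ by
          simp only [Set.mem_univ, true_and, residue_zero]
          exact insolMass_isTripleLine fun h ↦ hj (congrFun h j))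
      simp only [Finset.card_univ, Fintype.card_fin, Finset.card_empty] at h
      refine mul_left_cancel₀ hp1 (h.trans ?_)
      ring
  · rw [← insolMass_eq_zero]
    congr 1
    ext r
    simp [residue_zero]

theorem IsConcurrent.evalAt_ne_zero_iff {K : Type*} [Field K] {r : Fin 10 → K} {v : Fin 3 → K}
    (h : IsConcurrent r v) : r 0 ≠ 0 ↔ ∃ j ∈ ({1, 2} : Finset (Fin 3)), v j ≠ 0 := by
  have h0 : r 0 = evalAt r ![1, 0, 0] := by simp [evalAt]
  constructor
  · intro hr
    by_contra! hv
    have hv1 : v 1 = 0 := hv 1 (by simp)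
    have hv2 : v 2 = 0 := hv 2 (by simp)
    have hv0 : v 0 ≠ 0 := by
      intro hv0
      apply h.1
      ext i
      fin_cases i <;> assumption
    have h3 := h.2.2.1
    simp [evalAt, hv1, hv2] at h3
    tauto
  · rintro ⟨j, hj, hvj⟩ hr
    obtain ⟨t, ht⟩ := h.2.1 ![1, 0, 0] (by rw [← h0, hr])
    have ht0 : t ≠ 0 := by
      rintro rfl
      simpa using congrFun ht 0
    have h1 := congrFun ht 1
    have h2 := congrFun ht 2
    simp [ht0] at h1 h2
    simp at hj
    rcases hj with rfl | rfl
    · exact hvj h1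
    · exact hvj h2

/-- The forms whose coefficient of `x³` is a unit: centres other than `(1 : 0 : 0)` and triple lines
not passing through `(1 : 0 : 0)`. -/
theorem insolMass_apply_zero_ne_zero :
    insolMass 0 {r : Fin 10 → ZMod p | r 0 ≠ 0} =
      numBin p * ((p : ℝ) ^ 2 * (p - 1)) / (p : ℝ) ^ 10 +
      ((p : ℝ) ^ 2 + p) * insolMass 0 {r : Fin 10 → ZMod p | IsConcurrent r ![0, 0, 1]} +
      (p : ℝ) ^ 2 * insolMass 0 {r : Fin 10 → ZMod p | IsTripleLine r ![1, 0, 0]} := by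
  have hp1 := cast_prime_sub_one_ne_zero (p := p)
  have h4 : {r : Fin 10 → ZMod p | r ∈ {r : Fin 10 → ZMod p | r 0 ≠ 0} ∧ residue 0 r = 0} = ∅ := by
    ext r
    simp only [Set.mem_ofPred_eq, Set.mem_empty_iff_false, iff_false, not_and, residue_zero]
    rintro h rfl
    exact h rfl
  have haniso (r : Fin 10 → ZMod p) (h : Anisotropic r) : r 0 ≠ 0 := by
    simpa [evalAt] using h ![1, 0, 0] fun h ↦ by simpa using congrFun h 0
  have hline (r : Fin 10 → ZMod p) (l) (h : IsTripleLine r l) : r 0 ≠ 0 ↔ l 0 ≠ 0 := by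
    obtain ⟨-, a, ha, rfl⟩ := h
    simp [prodLinear, ha]
  rw [insolMass_decompose, insolMass_anisotropic {r : Fin 10 → ZMod p | r 0 ≠ 0} haniso, h4,
    insolMass_empty, add_zero]
  congr 1
  · congr 1
    have h := insolMass_concurrent (p := p) (K := {r | r 0 ≠ 0}) {1, 2}
      (fun r v h ↦ h.evalAt_ne_zero_iff)
      (fun v hv ↦ insolMass_isConcurrent hv)
    rw [Finset.card_pair (by decide)] at h
    refine mul_left_cancel₀ hp1 (h.trans ?_)
    ring
  · have h := insolMass_tripleLine (p := p) (e := 0) (K := {r | r 0 ≠ 0}) (I := ∅)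
      (J := {0}) (C := insolMass 0 {r : Fin 10 → ZMod p | IsTripleLine r ![1, 0, 0]})
      (Finset.empty_subset _)
      (fun r hr l h ↦ ⟨by simp, by
        rw [residue_zero] at h
        simpa using (hline r l h).1 hr⟩)
      (fun l _ hl ↦ by
        have hl0 : l 0 ≠ 0 := by simpa using hl
        rw [← insolMass_isTripleLine (l := l) fun h ↦ hl0 (congrFun h 0)]
        congr 1
        ext r
        simp only [Set.mem_ofPred_eq, residue_zero]
        exact ⟨fun h ↦ h.2, fun h ↦ ⟨(hline r l h).2 hl0, h⟩⟩)
    simp only [Finset.card_singleton, Finset.card_empty] at h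
    refine mul_left_cancel₀ hp1 (h.trans ?_)
    ring

theorem IsConcurrent.restrictLine_iff {K : Type*} [Field K] {r : Fin 10 → K} {v : Fin 3 → K}
    (h : IsConcurrent r v) : BinAnisotropic (restrictLine r) ↔
      ∃ j ∈ ({2} : Finset (Fin 3)), v j ≠ 0 := by
  simp only [Finset.mem_singleton, exists_eq_left]
  constructor
  · intro hb h2
    have hv : v = ![v 0, v 1, 0] := by
      ext i
      fin_cases i
      exacts [rfl, rfl, h2]
    refine hb (v 0) (v 1) ?_ ?_
    · by_contra! h0
      apply h.1
      rw [hv, h0.1, h0.2]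
      ext i
      fin_cases i <;> rfl
    · rw [← evalAt_line, ← hv]
      exact h.2.2.1
  · intro h2 x y hxy h0
    rw [← evalAt_line] at h0
    obtain ⟨t, ht⟩ := h.2.1 _ h0
    have e0 := congrFun ht 0
    have e1 := congrFun ht 1
    have e2 := congrFun ht 2
    simp [h2] at e0 e1 e2
    simp [e0, e1, e2] at hxy

/-- The forms whose restriction to `z = 0` has anisotropic residue: centres off this line, and no
triple lines. -/
theorem insolMass_restrictLine :
    insolMass 0 {r : Fin 10 → ZMod p | BinAnisotropic (restrictLine r)} =
      numBin p * ((p : ℝ) ^ 2 * (p - 1)) / (p : ℝ) ^ 10 +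
      (p : ℝ) ^ 2 * insolMass 0 {r : Fin 10 → ZMod p | IsConcurrent r ![0, 0, 1]} := by
  have hp1 := cast_prime_sub_one_ne_zero (p := p)
  have h3 : {r : Fin 10 → ZMod p | r ∈ {r : Fin 10 → ZMod p | BinAnisotropic (restrictLine r)} ∧
      ∃ l, IsTripleLine (residue 0 r) l} = ∅ := by
    ext r
    simp only [Set.mem_ofPred_eq, Set.mem_empty_iff_false, iff_false, not_and, residue_zero]
    rintro h ⟨l, hl⟩
    exact hl.not_restrictLine h
  have h4 : {r : Fin 10 → ZMod p | r ∈ {r : Fin 10 → ZMod p | BinAnisotropic (restrictLine r)} ∧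
      residue 0 r = 0} = ∅ := by
    ext r
    simp only [Set.mem_ofPred_eq, Set.mem_empty_iff_false, iff_false, not_and, residue_zero]
    rintro h rfl
    exact h.ne_zero rfl
  rw [insolMass_decompose,
    insolMass_anisotropic {r : Fin 10 → ZMod p | BinAnisotropic (restrictLine r)}
      fun r h ↦ h.restrictLine, h3, h4,
    insolMass_empty, add_zero, add_zero]
  congr 1
  have h := insolMass_concurrent (p := p) (K := {r | BinAnisotropic (restrictLine r)}) {2}
    (fun r v h ↦ h.restrictLine_iff) (fun v hv ↦ insolMass_isConcurrent hv)
  rw [Finset.card_singleton] at h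
  refine mul_left_cancel₀ hp1 (h.trans ?_)
  ring

end Total

section Solution

/-- An affine map with linear part different from `1` has at most one fixed point. -/
theorem eq_of_fixed {x y a k : ℝ} (hx : x = a + k * x) (hy : y = a + k * y) (hk : k ≠ 1) :
    x = y := by
  have h : (1 - k) * (x - y) = 0 := by linear_combination hx - hy
  rcases mul_eq_zero.1 h with h | h
  · exact absurd (by linarith) hk
  · linarith

/-- The solution of the linear system satisfied by the masses. -/
theorem solve_system {q n a i v w c b d t s : ℝ} (hq : 1 < q)
    (hn : 3 * n = (q - 1) * (q ^ 3 - q))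
    (ha : a = n * (q ^ 2 * (q - 1)) / q ^ 10) (hi : i = (q - 1) * n / q ^ 5)
    (hw : w = (q ^ 3)⁻¹ * (i + q * v))
    (hv : v = (q ^ 3)⁻¹ * ((q - 1) ^ 3 / q ^ 4 + (q ^ 2)⁻¹ * ((q ^ 2)⁻¹ * (i + q * w))))
    (hb : b = a + q ^ 2 * c)
    (hc : c = (q ^ 6)⁻¹ * (i + (q ^ 1)⁻¹ * ((q ^ 2)⁻¹ * (i + (q ^ 1)⁻¹ * b))))
    (ht : t = (q ^ 9)⁻¹ * (i + (q + 1) * v + (q ^ 4)⁻¹ * ((q ^ 3)⁻¹ *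
      (i + (q + 1) * w + (q ^ 4)⁻¹ * d))))
    (hd : d = a + (q ^ 2 + q) * c + q ^ 2 * t)
    (hs : s = a + (q ^ 2 + q + 1) * c + (q ^ 2 + q + 1) * t + (q ^ 10)⁻¹ * s) :
    s = (q ^ 9 - q ^ 8 + q ^ 6 - q ^ 4 + q ^ 3 + q ^ 2 - 2 * q + 1) /
      (3 * (q ^ 2 + 1) * (q ^ 4 + 1) * (q ^ 6 + q ^ 3 + 1)) := by
  have hq0 : q ≠ 0 := by positivity
  have hq1 : q + 1 ≠ 0 := by positivity
  have hq3 : q ^ 2 + q + 1 ≠ 0 := by positivity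
  have hq4 : q ^ 2 + 1 ≠ 0 := by positivity
  have hq8 : q ^ 4 + 1 ≠ 0 := by positivity
  have hq9 : q ^ 6 + q ^ 3 + 1 ≠ 0 := by positivity
  have hpow {m : ℕ} (hm : m ≠ 0) : (q ^ m)⁻¹ ≠ 1 := by
    intro h
    have h1 : 1 < q ^ m := one_lt_pow₀ hq hm
    rw [inv_eq_one] at h
    linarith
  have hn' : n = (q - 1) * (q ^ 3 - q) / 3 := by linear_combination hn / 3
  subst hn'
  have hv' : v = (q - 1) ^ 2 * (3 * q ^ 6 + q ^ 3 + q ^ 2 + q + 1) /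
      (3 * q ^ 5 * (q + 1) * (q ^ 2 + 1) * (q ^ 4 + 1)) := by
    refine eq_of_fixed (k := (q ^ 8)⁻¹) (a := (q ^ 3)⁻¹ * ((q - 1) ^ 3 / q ^ 4 +
      (q ^ 2)⁻¹ * ((q ^ 2)⁻¹ * (i + q * ((q ^ 3)⁻¹ * i))))) ?_ ?_ (hpow (by norm_num))
    · rw [hw] at hv
      conv_lhs => rw [hv]
      field_simp
      ring
    · rw [hi]
      field_simp
      ring
  have hw' : w = (q - 1) ^ 2 * (q ^ 7 + q ^ 6 + 3 * q ^ 4 + q + 1) /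
      (3 * q ^ 5 * (q + 1) * (q ^ 2 + 1) * (q ^ 4 + 1)) := by
    rw [hw, hv', hi]
    field_simp
    ring
  have hc' : c = (q - 1) ^ 2 * (q ^ 7 + q ^ 4 + 1) / (3 * q ^ 9 * (q ^ 2 + 1) * (q ^ 4 + 1)) := by
    refine eq_of_fixed (k := (q ^ 8)⁻¹) (a := (q ^ 6)⁻¹ * (i + (q ^ 1)⁻¹ * ((q ^ 2)⁻¹ *
      (i + (q ^ 1)⁻¹ * a)))) ?_ ?_ (hpow (by norm_num))
    · rw [hb] at hc
      conv_lhs => rw [hc]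
      field_simp
      ring
    · rw [hi, ha]
      field_simp
      ring
  have hd' : d = (q - 1) * (q ^ 11 + q ^ 10 + q ^ 9 + 2 * q ^ 7 + q ^ 6 + 3 * q ^ 4 + 1) /
      (3 * q * (q ^ 2 + q + 1) * (q ^ 2 + 1) * (q ^ 4 + 1) * (q ^ 6 + q ^ 3 + 1)) := by
    refine eq_of_fixed (k := (q ^ 18)⁻¹) (a := a + (q ^ 2 + q) * c + q ^ 2 * ((q ^ 9)⁻¹ *
      (i + (q + 1) * v + (q ^ 4)⁻¹ * ((q ^ 3)⁻¹ * (i + (q + 1) * w))))) ?_ ?_ (hpow (by norm_num))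
    · rw [ht] at hd
      conv_lhs => rw [hd]
      field_simp
      ring
    · rw [hc', hv', hw', hi, ha]
      field_simp
      ring
  have ht' : t = (q - 1) * (q ^ 14 + 3 * q ^ 11 + q ^ 8 + 2 * q ^ 7 + q ^ 5 + q ^ 4 + 1) /
      (3 * q ^ 10 * (q ^ 2 + q + 1) * (q ^ 2 + 1) * (q ^ 4 + 1) * (q ^ 6 + q ^ 3 + 1)) := by
    rw [ht, hd', hv', hw', hi]
    field_simp
    ring
  refine eq_of_fixed (k := (q ^ 10)⁻¹) (a := a + (q ^ 2 + q + 1) * c + (q ^ 2 + q + 1) * t) hs ?_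
    (hpow (by norm_num))
  rw [hc', ht', ha]
  field_simp
  ring

variable (p : ℕ) [Fact p.Prime]

/-- The probability of insolubility. -/
theorem insolMass_univ_eq : insolMass 0 (Set.univ : Set (Fin 10 → ZMod p)) =
    ((p : ℝ) ^ 9 - p ^ 8 + p ^ 6 - p ^ 4 + p ^ 3 + p ^ 2 - 2 * p + 1) /
      (3 * ((p : ℝ) ^ 2 + 1) * (p ^ 4 + 1) * (p ^ 6 + p ^ 3 + 1)) := by
  have hn : 3 * (numBin p : ℝ) = (p - 1) * ((p : ℝ) ^ 3 - p) := by
    have h := three_mul_natCard_binAnisotropic (K := ZMod p)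
    rw [Nat.card_zmod] at h
    exact_mod_cast h
  refine solve_system (by exact_mod_cast (Fact.out : p.Prime).one_lt) hn rfl rfl lineMass_one
    lineMass_two insolMass_restrictLine insolMass_concurrent_eq ?_ insolMass_apply_zero_ne_zero
    insolMass_univ
  rw [insolMass_isTripleLine_eq, insolMass_cone_ne_zero (by norm_num) (by norm_num) (by norm_num)
      fun c h0 hb ↦ not_soluble_cone_two h0 hb, insolMass_cone_two_zero,
    insolMass_cone_ne_zero (by norm_num) (by norm_num) (by norm_num)
      fun c h0 hb ↦ not_soluble_cone_one h0 hb, insolMass_cone_one_zero]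

theorem rho_eq_one_sub : rho p = 1 - insolMass 0 (Set.univ : Set (Fin 10 → ZMod p)) := by
  rw [rho, eq_sub_iff_add_eq, insolMass]
  have h : {c : Fin 10 → ℤ_[p] | reduce c ∈ Set.univ ∧ ¬ Soluble (scale 0 c)} =
      (solubleSet p)ᶜ := by
    ext c
    rw [Set.mem_compl_iff, mem_solubleSet_iff]
    simp [scale_zero]
  rw [h, probReal_compl_eq_one_sub measurableSet_solubleSet]
  ring

end Solution
end TernaryCubic

theorem theorem1p1 :
    TernaryCubic.f.natDegree = 9 ∧ TernaryCubic.g.natDegree = 12 ∧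
      ∀ (p : ℕ) [Fact p.Prime],
        MeasurableSet (TernaryCubic.solubleSet p) ∧
          TernaryCubic.rho p =
            1 - ((TernaryCubic.f.eval (p : ℤ) : ℤ) : ℝ) / ((TernaryCubic.g.eval (p : ℤ) : ℤ) : ℝ) := by
  refine ⟨?_, ?_, fun p _ ↦ ⟨TernaryCubic.measurableSet_solubleSet, ?_⟩⟩
  · unfold TernaryCubic.f
    compute_degree!
  · unfold TernaryCubic.g
    compute_degree!
  · rw [TernaryCubic.rho_eq_one_sub, TernaryCubic.insolMass_univ_eq]
    simp [TernaryCubic.f, TernaryCubic.g]
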